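/- **Setting.** Let $n\ge 0$. Fix real analytic functions $F^\alpha$ and $F^{\alpha\beta}=F^{\beta\alpha}$ on an open subset of $\mathbb R^n$, and real analytic functions $f,f^\alpha$ ($1\le\alpha,\beta\le n$) of $(\phi^\gamma,v^\gamma_a)$, $1\le\gamma\le n$, $a=1,2,3$, on an open subset of $\mathbb R^n\times(\mathbb R^3)^n$. Assume that $f$, $f^\alpha$ and their domain are invariant under simultaneous rotations $v^\gamma\mapsto Rv^\gamma$, $R\in SO(3)$. Repeated indices are summed. Consider the field equations $$\Delta_h\phi^\alpha=f^\alpha(\phi,D\phi),\qquad R_{ab}[h]=F^\alpha(\phi)D_aD_b\phi^\alpha+F^{\alpha\beta}(\phi)D_a\phi^\alpha D_b\phi^\beta+f(\phi,D\phi)\,h_{ab}$$ for a negative definite metric $h$ and scalar fields $\phi^1,\dots,\phi^n$ on a 3-manifold $N$, where $D$ is the Levi-Civita connection of $h$ and $f,f^\alpha$ are evaluated at $\phi^\gamma$ and at the components of $D\phi^\gamma$ in a normal frame as below. A solution $(N,h,\phi)$ of class $C^r$, $r\in\{\infty,\omega\}$, is always taken on a manifold $N$ that is a normal neighbourhood of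 a point $q$: it carries global $h$-normal coordinates $x^a$ of class $C^r$ centred at $q$, with star-shaped range, and a normal frame $c_a$ centred at $q$. The latter means a $C^r$ frame field with $h(c_a,c_b)=-\delta_{ab}$ that is parallel along the geodesics through $q$ and satisfies $c_a=\partial_{x^a}$ at $q$. The fields take values in the domains of the coefficient functions, and $D_{a_p}\cdots D_{a_1}\phi^\alpha(q)$ denotes the components of the iterated covariant derivative in the frame $c_a$. **Spinors.** Put $\epsilon_{01}=-\epsilon_{10}=1$, $\epsilon_{00}=\epsilon_{11}=0$, and $c_{AB}=\alpha^a{}_{AB}c_a$ with $$\alpha^1=\tfrac1{\sqrt2}\begin{pmatrix}-1&0\\0&1\end{pmatrix},\quad \alpha^2=\tfrac1{\sqrt2}\begin{pmatrix}i&0\\0&i\end{pmatrix},\quad \alpha^3=\tfrac1{\sqrt2}\begin{pmatrix}0&1\\1&0\end{pmatrix},$$ so that $h(c_{AB},c_{CD})=-\epsilon_{A(C}\epsilon_{D)B}$. Let $D_{A_pB_p}\cdots D_{A_1B_1}\phi^\alpha(q)=\alpha^{a_p}{}_{A_pB_p}\cdots\alpha^{a_1}{}_{A_1B_1}D_{a_p}\cdots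 D_{a_1}\phi^\alpha(q)$. The *null data* of the solution are the totally symmetric parts $D_{(A_pB_p}\cdots D_{A_1B_1)}\phi^\alpha(q)$, $p\ge0$, or equivalently the symmetric trace-free parts $\mathcal C(D_{a_p}\cdots D_{a_1}\phi^\alpha)(q)$. The *reality condition* for a spinor is $$T_{A_1B_1\cdots A_pB_p}=(-1)^p\,\tau_{A_1}{}^{A_1'}\cdots\tau_{B_p}{}^{B_p'}\,\overline{T_{A_1'B_1'\cdots A_p'B_p'}},\qquad \tau_0{}^{1}=-1,\ \tau_1{}^{0}=1,\ \tau_0{}^0=\tau_1{}^1=0.$$ **Lemma.** (1) Let $\psi^\alpha_{A_pB_p\cdots A_1B_1}$ ($p\ge 0$, $\alpha=1,\dots,n$) be $n$ sequences of totally symmetric spinors satisfying the reality condition. Suppose that a solution of class $C^r$ exists with $$\psi^\alpha_{A_pB_p\cdots A_1B_1}=D_{(A_pB_p}\cdots D_{A_1B_1)}\phi^\alpha(q)\quad\text{for all }p\ge0\text{ and all }\alpha.$$ Then all coefficients $D_{A_pB_p}\cdots D_{A_1B_1}\phi^\alpha(q)$, $p\ge0$, of the normal expansions of the $\phi^\alpha$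 satisfy the reality condition. They are uniquely determined by the $\psi^\alpha$: any two solutions of class $C^r$ of the same field equations with these null data have the same coefficients. (2) Let $(N,h,\phi)$ and $(N',h',\phi')$ be two analytic solutions of the same field equations, with base points $q$ and $q'$. If there is a rotation $R\in SO(3)$ with $$\mathcal C(D_{a_p}\cdots D_{a_1}\phi'^\alpha)(q')=R_{a_pb_p}\cdots R_{a_1b_1}\,\mathcal C(D_{b_p}\cdots D_{b_1}\phi^\alpha)(q)\quad\text{for all }p\ge0\text{ and all }\alpha,$$ then the solutions are isometric near the base points: there is an analytic diffeomorphism $\Psi$ from a neighbourhood of $q$ to a neighbourhood of $q'$ with $\Psi(q)=q'$, $\Psi^*h'=h$ and $\phi'^\alpha\circ\Psi=\phi^\alpha$ for all $\alpha$. -/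

import Mathlib

open scoped Manifold ContDiff

universe u v

noncomputable section

namespace NullData

/-- The coordinate space `ℝ³`. -/
abbrev E3 := EuclideanSpace ℝ (Fin 3)

/-! ### Tensor calculus in a coordinate system -/

/-- The partial derivative `∂_i f`. -/
def pd (i : Fin 3) (f : E3 → ℝ) (y : E3) : ℝ :=
  fderiv ℝ f y (EuclideanSpace.single i 1)

/-- The Christoffel symbol `Γ^i_{jk}` of the Levi-Civita connection of the metric with
components `g`. -/
def christoffel (g : E3 → Matrix (Fin 3) (Fin 3) ℝ) (i j k : Fin 3) (y : E3) : ℝ :=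
  (1 / 2) * ∑ l, (g y)⁻¹ i l *
    (pd j (fun z => g z l k) y + pd k (fun z => g z l j) y - pd l (fun z => g z j k) y)

/-- The Ricci tensor
`R_ij = ∂_l Γ^l_{ij} - ∂_j Γ^l_{il} + Γ^l_{lm} Γ^m_{ij} - Γ^l_{jm} Γ^m_{il}`. -/
def ricci (g : E3 → Matrix (Fin 3) (Fin 3) ℝ) (i j : Fin 3) (y : E3) : ℝ :=
  ∑ l, (pd l (christoffel g l i j) y - pd j (christoffel g l i l) y
    + ∑ m, (christoffel g l l m y * christoffel g m i j y
      - christoffel g l j m y * christoffel g m i l y))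

/-- The components of a covariant tensor of rank `p`. -/
abbrev Tensor (p : ℕ) := (Fin p → Fin 3) → ℝ

/-- The covariant derivative of a covariant tensor field of rank `p`. The index of the derivative
is the first one: `(D T)_{j i_1 ... i_p} = D_j T_{i_1 ... i_p}`. -/
def covDeriv (g : E3 → Matrix (Fin 3) (Fin 3) ℝ) {p : ℕ} (T : E3 → Tensor p) :
    E3 → Tensor (p + 1) := fun y a =>
  pd (a 0) (fun z => T z (Fin.tail a)) y
    - ∑ i, ∑ l, christoffel g l (a 0) (Fin.tail a i) y
        * T y (Function.update (Fin.tail a) i l)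

/-- The tensor field `D_{i_p} ... D_{i_1} φ`, its indices in this order. -/
def iterCovDeriv (g : E3 → Matrix (Fin 3) (Fin 3) ℝ) (φ : E3 → ℝ) :
    (p : ℕ) → E3 → Tensor p
  | 0 => fun y _ => φ y
  | p + 1 => covDeriv g (iterCovDeriv g φ p)

/-- The Laplacian `h^{ij} D_i D_j φ`. -/
def laplacian (g : E3 → Matrix (Fin 3) (Fin 3) ℝ) (φ : E3 → ℝ) (y : E3) : ℝ :=
  ∑ i, ∑ j, (g y)⁻¹ i j * iterCovDeriv g φ 2 y ![i, j]

/-! ### The field equations -/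

/-- The coefficient functions of the system
`Δ φ^α = f^α(φ, Dφ)`,
`R_ab = F^α(φ) D_a D_b φ^α + F^{αβ}(φ) D_a φ^α D_b φ^β + f(φ, Dφ) h_ab`.
`F1`, `F2`, `f0`, `f1` stand for `F^α`, `F^{αβ}`, `f`, `f^α`. The functions `f` and `f^α` are given
as functions of the values `φ^γ` and of the components `D_a φ^γ` in an orthonormal frame; that they
define scalars means that they do not change under a rotation of the frame. -/
structure FieldSystem (n : ℕ) where
  domF : Set (Fin n → ℝ)
  domf : Set ((Fin n → ℝ) × (Fin n → Fin 3 → ℝ))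
  F1 : Fin n → (Fin n → ℝ) → ℝ
  F2 : Fin n → Fin n → (Fin n → ℝ) → ℝ
  f0 : (Fin n → ℝ) × (Fin n → Fin 3 → ℝ) → ℝ
  f1 : Fin n → (Fin n → ℝ) × (Fin n → Fin 3 → ℝ) → ℝ
  isOpen_domF : IsOpen domF
  isOpen_domf : IsOpen domf
  analytic_F1 : ∀ α, AnalyticOnNhd ℝ (F1 α) domF
  analytic_F2 : ∀ α β, AnalyticOnNhd ℝ (F2 α β) domF
  analytic_f0 : AnalyticOnNhd ℝ f0 domf
  analytic_f1 : ∀ α, AnalyticOnNhd ℝ (f1 α) domf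
  F2_symm : ∀ α β, ∀ w ∈ domF, F2 α β w = F2 β α w
  domf_scalar : ∀ R ∈ Matrix.specialOrthogonalGroup (Fin 3) ℝ, ∀ w ∈ domf,
    (w.1, fun γ => R.mulVec (w.2 γ)) ∈ domf
  f0_scalar : ∀ R ∈ Matrix.specialOrthogonalGroup (Fin 3) ℝ, ∀ w ∈ domf,
    f0 (w.1, fun γ => R.mulVec (w.2 γ)) = f0 w
  f1_scalar : ∀ R ∈ Matrix.specialOrthogonalGroup (Fin 3) ℝ, ∀ w ∈ domf, ∀ α,
    f1 α (w.1, fun γ => R.mulVec (w.2 γ)) = f1 α w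

section Manifold

variable {N : Type u} [TopologicalSpace N] [ChartedSpace E3 N]

/-- The components `h_ij` of a bilinear form field in the coordinates `x`. -/
def metricInChart (x : OpenPartialHomeomorph N E3)
    (h : ∀ p : N, TangentSpace (𝓡 3) p →L[ℝ] TangentSpace (𝓡 3) p →L[ℝ] ℝ) :
    E3 → Matrix (Fin 3) (Fin 3) ℝ := fun y =>
  Matrix.of fun i j =>
    h (x.symm y) (mfderiv (𝓡 3) (𝓡 3) x.symm y (EuclideanSpace.single i (1 : ℝ) : E3))
      (mfderiv (𝓡 3) (𝓡 3) x.symm y (EuclideanSpace.single j (1 : ℝ) : E3))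

/-- The components `c^i_a = ⟨dx^i, c_a⟩` of a frame field in the coordinates `x`. -/
def frameInChart (x : OpenPartialHomeomorph N E3)
    (c : Fin 3 → ∀ p : N, TangentSpace (𝓡 3) p) (i a : Fin 3) (y : E3) : ℝ :=
  WithLp.ofLp (p := 2) (V := Fin 3 → ℝ) (mfderiv (𝓡 3) (𝓡 3) x (x.symm y) (c a (x.symm y))) i

end Manifold

/-- A solution `(h, φ)` of class `C^r` of the field equations on a 3-manifold `N` that is a normal
neighbourhood of the point `q`, together with normal coordinates `x` centred at `q` and a normal
frame `c` centred at `q`. -/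
structure NormalSolution {n : ℕ} (S : FieldSystem n) (r : WithTop ℕ∞)
    (N : Type u) [TopologicalSpace N] [ChartedSpace E3 N] [IsManifold (𝓡 3) r N] where
  /-- the base point -/
  q : N
  /-- the metric -/
  h : ∀ p : N, TangentSpace (𝓡 3) p →L[ℝ] TangentSpace (𝓡 3) p →L[ℝ] ℝ
  /-- the scalar fields -/
  φ : Fin n → N → ℝ
  /-- the normal coordinates -/
  x : OpenPartialHomeomorph N E3
  /-- the normal frame -/
  c : Fin 3 → ∀ p : N, TangentSpace (𝓡 3) p
  h_symm : ∀ p v w, h p v w = h p w v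
  h_neg : ∀ p v, v ≠ 0 → h p v v < 0
  φ_reg : ∀ α, ContMDiff (𝓡 3) 𝓘(ℝ, ℝ) r (φ α)
  x_mem : x ∈ IsManifold.maximalAtlas (𝓡 3) r N
  x_source : x.source = Set.univ
  x_target : StarConvex ℝ 0 x.target
  x_q : x q = 0
  h_reg : ∀ i j, ContDiffOn ℝ r (fun y => metricInChart x h y i j) x.target
  c_reg : ∀ i a, ContDiffOn ℝ r (frameInChart x c i a) x.target
  /-- the rays through the origin of the coordinates are geodesics -/
  x_normal : ∀ y ∈ x.target, ∀ i,
    ∑ j, ∑ k, christoffel (metricInChart x h) i j k y * y j * y k = 0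
  c_orthonormal : ∀ p a b, h p (c a p) (c b p) = if a = b then -1 else 0
  /-- at `q` the frame is the coordinate frame -/
  c_q : ∀ i a, frameInChart x c i a 0 = if i = a then 1 else 0
  /-- the frame is parallel along the geodesics through `q` -/
  c_parallel : ∀ y ∈ x.target, ∀ i a,
    ∑ j, y j * (pd j (frameInChart x c i a) y
      + ∑ k, christoffel (metricInChart x h) i j k y * frameInChart x c k a y) = 0
  /-- the values of the fields lie in the domains of the coefficient functions -/
  mem_domF : ∀ y ∈ x.target, (fun γ => φ γ (x.symm y)) ∈ S.domF
  mem_domf : ∀ y ∈ x.target,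
    ((fun γ => φ γ (x.symm y),
      fun γ a => ∑ i, frameInChart x c i a y * pd i (φ γ ∘ x.symm) y) :
        (Fin n → ℝ) × (Fin n → Fin 3 → ℝ)) ∈ S.domf
  /-- the first field equation -/
  eq_laplacian : ∀ y ∈ x.target, ∀ α,
    laplacian (metricInChart x h) (φ α ∘ x.symm) y
      = S.f1 α (fun γ => φ γ (x.symm y),
          fun γ a => ∑ i, frameInChart x c i a y * pd i (φ γ ∘ x.symm) y)
  /-- the second field equation -/
  eq_ricci : ∀ y ∈ x.target, ∀ i j,
    ricci (metricInChart x h) i j y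
      = ∑ α, S.F1 α (fun γ => φ γ (x.symm y))
            * iterCovDeriv (metricInChart x h) (φ α ∘ x.symm) 2 y ![i, j]
        + ∑ α, ∑ β, S.F2 α β (fun γ => φ γ (x.symm y))
            * pd i (φ α ∘ x.symm) y * pd j (φ β ∘ x.symm) y
        + S.f0 (fun γ => φ γ (x.symm y),
            fun γ a => ∑ i, frameInChart x c i a y * pd i (φ γ ∘ x.symm) y)
          * metricInChart x h y i j

/-! ### Frame components at `q`, symmetric trace-free parts, space spinors -/

/-- The frame components `D_{a_p} ... D_{a_1} φ^α (q)`. -/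
def NormalSolution.coeff {n : ℕ} {S : FieldSystem n} {r : WithTop ℕ∞}
    {N : Type u} [TopologicalSpace N] [ChartedSpace E3 N] [IsManifold (𝓡 3) r N]
    (s : NormalSolution S r N) (α : Fin n) (p : ℕ) : Tensor p := fun a =>
  ∑ b : Fin p → Fin 3, (∏ k, frameInChart s.x s.c (b k) (a k) 0)
    * iterCovDeriv (metricInChart s.x s.h) (s.φ α ∘ s.x.symm) p 0 b

/-- The space of symmetric trace-free tensors of rank `p`. -/
def stf (p : ℕ) : Submodule ℝ (EuclideanSpace ℝ (Fin p → Fin 3)) where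
  carrier := {T | (∀ (σ : Equiv.Perm (Fin p)) (a : Fin p → Fin 3), T (a ∘ σ) = T a) ∧
    ∀ i j : Fin p, i ≠ j → ∀ a : Fin p → Fin 3,
      ∑ k, T (Function.update (Function.update a i k) j k) = 0}
  add_mem' := by
    rintro S T ⟨hS, hS'⟩ ⟨hT, hT'⟩
    refine ⟨fun σ a => ?_, fun i j hij a => ?_⟩
    · simp [hS σ a, hT σ a]
    · simp only [PiLp.add_apply, Finset.sum_add_distrib, hS' i j hij a, hT' i j hij a, add_zero]
  zero_mem' := by
    refine ⟨fun σ a => ?_, fun i j hij a => ?_⟩ <;> simp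
  smul_mem' := by
    rintro t T ⟨hT, hT'⟩
    refine ⟨fun σ a => ?_, fun i j hij a => ?_⟩
    · simp [hT σ a]
    · simp only [PiLp.smul_apply, ← Finset.smul_sum, hT' i j hij a, smul_zero]

/-- The symmetric trace-free part `C(T)` of a tensor: its orthogonal projection to the symmetric
trace-free tensors. -/
def stfPart {p : ℕ} (T : Tensor p) : Tensor p := fun a =>
  (stf p).starProjection (WithLp.toLp 2 T) a

/-- The action of a rotation on a tensor, `(R T)_{a_1 ... a_p} = R_{a_1 b_1} ... T_{b_1 ...}`. -/
def rotate (R : Matrix (Fin 3) (Fin 3) ℝ) {p : ℕ} (T : Tensor p) : Tensor p := fun a =>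
  ∑ b : Fin p → Fin 3, (∏ k, R (a k) (b k)) * T b

/-- The components of a spinor `T_{A_1 B_1 ... A_p B_p}`; the index `A_k` has the label `(k, 0)`
and the index `B_k` has the label `(k, 1)`. -/
abbrev Spinor (p : ℕ) := (Fin p × Fin 2 → Fin 2) → ℂ

/-- The spinor `ε_{AB}`, with `ε_{01} = 1`. -/
def eps : Matrix (Fin 2) (Fin 2) ℂ := !![0, 1; -1, 0]

/-- The coefficients in `c_{AB} = α^a_{AB} c_a`. They are symmetric in `A`, `B` and satisfy
`h(c_{AB}, c_{CD}) = - ε_{A(C} ε_{D)B}`. -/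
def waerden : Fin 3 → Matrix (Fin 2) (Fin 2) ℂ :=
  ![((1 / Real.sqrt 2 : ℝ) : ℂ) • !![-1, 0; 0, 1],
    ((1 / Real.sqrt 2 : ℝ) : ℂ) • !![Complex.I, 0; 0, Complex.I],
    ((1 / Real.sqrt 2 : ℝ) : ℂ) • !![0, 1; 1, 0]]

/-- The spinor that corresponds to a tensor. -/
def toSpinor {p : ℕ} (T : Tensor p) : Spinor p := fun s =>
  ∑ a : Fin p → Fin 3, (∏ k, waerden (a k) (s (k, 0)) (s (k, 1))) * (T a : ℂ)

/-- The totally symmetric part `T_{(A_1 B_1 ... A_p B_p)}` of a spinor. -/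
def symPart {p : ℕ} (T : Spinor p) : Spinor p := fun s =>
  (((2 * p).factorial : ℂ))⁻¹ * ∑ σ : Equiv.Perm (Fin p × Fin 2), T (s ∘ σ)

/-- Total symmetry of a spinor. -/
def TotallySymmetric {p : ℕ} (T : Spinor p) : Prop :=
  ∀ (σ : Equiv.Perm (Fin p × Fin 2)) (s : Fin p × Fin 2 → Fin 2), T (s ∘ σ) = T s

/-- `τ_A^{A'}`, obtained from `τ^{BA'} = ε_0^B ε_0^{A'} + ε_1^B ε_1^{A'}` by lowering the first
index, `τ_A^{A'} = τ^{BA'} ε_{BA}`. -/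
def tau (A A' : Fin 2) : ℂ := ∑ B : Fin 2, (if B = A' then 1 else 0) * eps B A

/-- The reality condition
`T_{A_1 B_1 ... A_p B_p} = (-1)^p τ_{A_1}^{A_1'} ... τ_{B_p}^{B_p'} conj T_{A_1' B_1' ...}`. -/
def RealityCondition {p : ℕ} (T : Spinor p) : Prop :=
  ∀ s : Fin p × Fin 2 → Fin 2, T s = (-1) ^ p *
    ∑ s' : Fin p × Fin 2 → Fin 2, (∏ k, tau (s k) (s' k)) * starRingEnd ℂ (T s')

section Data

variable {n : ℕ} {S : FieldSystem n} {r : WithTop ℕ∞}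
  {N : Type u} [TopologicalSpace N] [ChartedSpace E3 N] [IsManifold (𝓡 3) r N]

/-- The spinors `D_{A_p B_p} ... D_{A_1 B_1} φ^α (q)`. -/
def NormalSolution.coeffSpinor (s : NormalSolution S r N) (α : Fin n) (p : ℕ) : Spinor p :=
  toSpinor (s.coeff α p)

/-- The null data `D_{(A_p B_p} ... D_{A_1 B_1)} φ^α (q)` in spinor form. -/
def NormalSolution.nullSpinor (s : NormalSolution S r N) (α : Fin n) (p : ℕ) : Spinor p :=
  symPart (s.coeffSpinor α p)

/-- The null data `C(D_{a_p} ... D_{a_1} φ^α)(q)` in tensor form. -/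
def NormalSolution.nullTensor (s : NormalSolution S r N) (α : Fin n) (p : ℕ) : Tensor p :=
  stfPart (s.coeff α p)

end Data

/-- Two solutions are isometric near their base points: an analytic diffeomorphism between
neighbourhoods of the base points maps base point, metric and scalar fields of one solution to
those of the other. -/
def LocallyIsometric {n : ℕ} {S : FieldSystem n}
    {N : Type u} [TopologicalSpace N] [ChartedSpace E3 N] [IsManifold (𝓡 3) ω N]
    {N' : Type v} [TopologicalSpace N'] [ChartedSpace E3 N'] [IsManifold (𝓡 3) ω N']
    (s : NormalSolution S ω N) (s' : NormalSolution S ω N') : Prop :=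
  ∃ Ψ : OpenPartialHomeomorph N N',
    s.q ∈ Ψ.source ∧ Ψ s.q = s'.q ∧
    ContMDiffOn (𝓡 3) (𝓡 3) ω Ψ Ψ.source ∧ ContMDiffOn (𝓡 3) (𝓡 3) ω Ψ.symm Ψ.target ∧
    (∀ p ∈ Ψ.source, ∀ v w : TangentSpace (𝓡 3) p,
      s'.h (Ψ p) (mfderiv (𝓡 3) (𝓡 3) Ψ p v) (mfderiv (𝓡 3) (𝓡 3) Ψ p w) = s.h p v w) ∧
    ∀ p ∈ Ψ.source, ∀ α, s'.φ α (Ψ p) = s.φ α p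

end NullData

end

noncomputable section

namespace NullData

open Filter Topology

/-! ### Germs of smooth functions that vanish to a given order at the origin -/

/-! Two solutions are compared in their normal coordinates, where the claim becomes one about jets
at the origin: metrics, fields and normal frames agree to every order `p` (derivatives of order less
than `p` coincide). This is proved by induction on `p` in `CoordSol.jetEq`.

Let u be the difference of the fields, k that of the metrics, and E = y^j ∂_j. If all data agree to
order `p`, the covariant derivatives of order `p` at the origin differ by the partial derivatives
∂^p u. Subtracting the first field equations shows that the flat Laplacian of u vanishes to order `p
- 1`, so the symmetric tensor ∂^p u(0) is also trace-free. The null data see all of such a tensor,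
hence it vanishes and the fields gain an order. The second field equation then makes the linearised
Ricci tensor of k vanish to order `p - 1`. In dimension three the Ricci tensor determines the
Riemann tensor, and in the radial gauge given by the Gauss lemma (`gauss_lemma`) the Riemann tensor
contracted twice with y is -(E² + E)k up to flat terms. Inverting E + 1 and E (`Vanish.of_euler`)
gives one more order for k (`vanish_of_linRicci`). Parallel transport along rays is an Euler
equation for the frame, which follows suit.

For part (1), the spinor of a symmetric trace-free tensor is totally symmetric
(`toSpinor_totallySymmetric`), so such a tensor is zero once its null spinor is. Reality is an
algebraic property of the spinor of any real tensor. For part (2), the invariance of f and f^α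
allows the second solution to be rotated (`CoordSol.rotate`) until its null data are those of the
first. All jets then agree, analyticity turns this into equality of germs
(`eventually_eq_zero_of_vanish`), and the isometry is the rotation read in the two normal coordinate
systems. -/

theorem pd_congr {f g : E3 → ℝ} (h : f =ᶠ[𝓝 0] g) (i : Fin 3) : pd i f =ᶠ[𝓝 0] pd i g := by
  filter_upwards [h.fderiv (𝕜 := ℝ)] with y hy
  simp only [pd, hy]

theorem smooth_pd {f : E3 → ℝ} (hf : ContDiffAt ℝ ∞ f 0) (i : Fin 3) :
    ContDiffAt ℝ ∞ (pd i f) 0 :=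
  (hf.fderiv_right (m := ∞) (by simp)).clm_apply contDiffAt_const

theorem eventually_differentiableAt {W : Type*} [NormedAddCommGroup W] [NormedSpace ℝ W]
    {f : E3 → W} (hf : ContDiffAt ℝ ∞ f 0) : ∀ᶠ y in 𝓝 0, DifferentiableAt ℝ f y := by
  filter_upwards [(hf.of_le (m := 1) (by exact_mod_cast le_top)).eventually (by simp)] with y hy
  exact hy.differentiableAt (by simp)

theorem pd_add {f g : E3 → ℝ} (hf : ContDiffAt ℝ ∞ f 0) (hg : ContDiffAt ℝ ∞ g 0) (i : Fin 3) :
    pd i (fun y => f y + g y) =ᶠ[𝓝 0] fun y => pd i f y + pd i g y := by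
  filter_upwards [eventually_differentiableAt hf, eventually_differentiableAt hg] with y h1 h2
  simp only [pd]
  rw [fderiv_fun_add h1 h2]; rfl

theorem pd_sub {f g : E3 → ℝ} (hf : ContDiffAt ℝ ∞ f 0) (hg : ContDiffAt ℝ ∞ g 0) (i : Fin 3) :
    pd i (fun y => f y - g y) =ᶠ[𝓝 0] fun y => pd i f y - pd i g y := by
  filter_upwards [eventually_differentiableAt hf, eventually_differentiableAt hg] with y h1 h2
  simp only [pd]
  rw [fderiv_fun_sub h1 h2]; rfl

theorem pd_mul {f g : E3 → ℝ} (hf : ContDiffAt ℝ ∞ f 0) (hg : ContDiffAt ℝ ∞ g 0) (i : Fin 3) :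
    pd i (fun y => f y * g y) =ᶠ[𝓝 0] fun y => pd i f y * g y + f y * pd i g y := by
  filter_upwards [eventually_differentiableAt hf, eventually_differentiableAt hg] with y h1 h2
  simp only [pd]
  rw [fderiv_fun_mul h1 h2]
  simp; ring

theorem pd_sum {ι : Type*} (s : Finset ι) {f : ι → E3 → ℝ}
    (hf : ∀ c ∈ s, ContDiffAt ℝ ∞ (f c) 0) (i : Fin 3) :
    pd i (fun y => ∑ c ∈ s, f c y) =ᶠ[𝓝 0] fun y => ∑ c ∈ s, pd i (f c) y := by
  have h : ∀ᶠ y in 𝓝 (0 : E3), ∀ c ∈ s, DifferentiableAt ℝ (f c) y :=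
    (Filter.eventually_all_finset s).2 fun c hc => eventually_differentiableAt (hf c hc)
  filter_upwards [h] with y hy
  simp only [pd]
  rw [fderiv_fun_sum hy]
  simp

theorem pd_const (c : ℝ) (i : Fin 3) (y : E3) : pd i (fun _ => c) y = 0 := by
  simp [pd]

theorem pd_coord (i j : Fin 3) (y : E3) : pd i (fun z => z j) y = if i = j then 1 else 0 := by
  have : fderiv ℝ (fun z : E3 => z j) y = EuclideanSpace.proj j :=
    (EuclideanSpace.proj j : E3 →L[ℝ] ℝ).fderiv
  simp only [pd, this]
  simp [eq_comm]

theorem smooth_coord (j : Fin 3) (y : E3) : ContDiffAt ℝ ∞ (fun z : E3 => z j) y :=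
  (EuclideanSpace.proj j : E3 →L[ℝ] ℝ).contDiff.contDiffAt

theorem pd_comm {f : E3 → ℝ} (hf : ContDiffAt ℝ ∞ f 0) (i j : Fin 3) :
    pd i (pd j f) =ᶠ[𝓝 0] pd j (pd i f) := by
  have h2 : ∀ᶠ y in 𝓝 (0 : E3), ContDiffAt ℝ 2 f y :=
    (hf.of_le (m := 2)
      (mod_cast ENat.natCast_le_of_coe_top_le_withTop le_rfl 2)).eventually (by simp)
  filter_upwards [h2] with y hy
  have hs : IsSymmSndFDerivAt ℝ f y := hy.isSymmSndFDerivAt (by simp)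
  have hd : DifferentiableAt ℝ (fderiv ℝ f) y :=
    (hy.fderiv_right (m := 1) (by norm_num)).differentiableAt (by simp)
  have key : ∀ v w : E3, fderiv ℝ (fun z => fderiv ℝ f z v) y w = fderiv ℝ (fderiv ℝ f) y w v := by
    intro v w
    rw [fderiv_clm_apply hd (differentiableAt_const v)]
    simp
  show fderiv ℝ (fun z => fderiv ℝ f z _) y _ = fderiv ℝ (fun z => fderiv ℝ f z _) y _
  rw [key, key]
  exact hs _ _

/-- `f` is smooth at the origin and its derivatives of order less than `m` vanish there. -/
def Vanish : ℕ → (E3 → ℝ) → Prop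
  | 0, f => ContDiffAt ℝ ∞ f 0
  | m + 1, f => ContDiffAt ℝ ∞ f 0 ∧ f 0 = 0 ∧ ∀ i, Vanish m (pd i f)

namespace Vanish

variable {m a b : ℕ} {f g : E3 → ℝ}

theorem smooth : ∀ {m : ℕ} {f : E3 → ℝ}, Vanish m f → ContDiffAt ℝ ∞ f 0
  | 0, _, h => h
  | _ + 1, _, h => h.1

theorem eq_zero (h : Vanish (m + 1) f) : f 0 = 0 := h.2.1

theorem pd (h : Vanish (m + 1) f) (i : Fin 3) : Vanish m (pd i f) := h.2.2 i

theorem congr : ∀ {m : ℕ} {f g : E3 → ℝ}, Vanish m f → f =ᶠ[𝓝 0] g → Vanish m g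
  | 0, _, _, h, e => ContDiffAt.congr_of_eventuallyEq h e.symm
  | _ + 1, _, _, h, e => ⟨ContDiffAt.congr_of_eventuallyEq h.1 e.symm, e.self_of_nhds ▸ h.2.1,
      fun i => (h.2.2 i).congr (pd_congr e i)⟩

theorem pred : ∀ {m : ℕ} {f : E3 → ℝ}, Vanish (m + 1) f → Vanish m f
  | 0, _, h => h.1
  | _ + 1, _, h => ⟨h.1, h.2.1, fun i => (h.2.2 i).pred⟩

theorem mono {m k : ℕ} (h : Vanish m f) (hk : k ≤ m) : Vanish k f := by
  induction m, hk using Nat.le_induction with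
  | base => exact h
  | succ m _ ih => exact ih h.pred

theorem zero : ∀ m : ℕ, Vanish m fun _ => 0
  | 0 => contDiffAt_const
  | m + 1 => ⟨contDiffAt_const, rfl, fun i =>
      (zero m).congr (Eventually.of_forall fun y => (pd_const 0 i y).symm)⟩

theorem add : ∀ {m : ℕ} {f g : E3 → ℝ}, Vanish m f → Vanish m g → Vanish m fun y => f y + g y
  | 0, _, _, hf, hg => ContDiffAt.add hf hg
  | _ + 1, _, _, hf, hg => ⟨hf.1.add hg.1, by simp [hf.2.1, hg.2.1],
      fun i => ((hf.2.2 i).add (hg.2.2 i)).congr (pd_add hf.1 hg.1 i).symm⟩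

/-- The Leibniz rule lowers sometimes `a` and sometimes `b`, so the recursion runs on a bound `N`
for `a + b`. -/
theorem mul_aux : ∀ (N a b : ℕ) {f g : E3 → ℝ}, a + b ≤ N → Vanish a f → Vanish b g →
    Vanish (a + b) fun y => f y * g y
  | _, 0, 0, _, _, _, hf, hg => ContDiffAt.mul hf hg
  | 0, a + 1, b, _, _, hN, _, _ => by omega
  | 0, 0, b + 1, _, _, hN, _, _ => by omega
  | N + 1, 0, b + 1, f, g, hN, hf, hg => by
      rw [← Nat.add_assoc]
      refine ⟨ContDiffAt.mul hf hg.1, by simp [hg.2.1], fun i => ?_⟩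
      refine Vanish.congr ?_ (pd_mul hf hg.1 i).symm
      exact ((mul_aux N 0 b (by omega) (smooth_pd hf i : Vanish 0 _) hg.pred)).add
        (mul_aux N 0 b (by omega) hf (hg.2.2 i))
  | N + 1, a + 1, 0, f, g, hN, hf, hg => by
      refine ⟨ContDiffAt.mul hf.1 hg, by simp [hf.2.1], fun i => ?_⟩
      refine Vanish.congr ?_ (pd_mul hf.1 hg i).symm
      exact ((mul_aux N a 0 (by omega) (hf.2.2 i) hg)).add
        (mul_aux N a 0 (by omega) hf.pred (smooth_pd hg i : Vanish 0 _))
  | N + 1, a + 1, b + 1, f, g, hN, hf, hg => by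
      rw [← Nat.add_assoc]
      refine ⟨ContDiffAt.mul hf.1 hg.1, by simp [hf.2.1], fun i => ?_⟩
      refine Vanish.congr ?_ (pd_mul hf.1 hg.1 i).symm
      have h1 := mul_aux N a (b + 1) (by omega) (hf.2.2 i) hg
      have h2 := mul_aux N (a + 1) b (by omega) hf (hg.2.2 i)
      exact (h1.mono (by omega)).add (h2.mono (by omega))

theorem mul {c : ℕ} (hf : Vanish a f) (hg : Vanish b g) (h : c ≤ a + b) :
    Vanish c fun y => f y * g y :=
  (mul_aux _ a b le_rfl hf hg).mono h

theorem const_mul (c : ℝ) (hf : Vanish m f) : Vanish m fun y => c * f y :=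
  Vanish.mul (a := 0) (contDiffAt_const : ContDiffAt ℝ ∞ (fun _ : E3 => c) 0) hf (by omega)

theorem neg (hf : Vanish m f) : Vanish m fun y => -f y := by
  simpa using hf.const_mul (-1)

theorem sub (hf : Vanish m f) (hg : Vanish m g) : Vanish m fun y => f y - g y := by
  simpa [sub_eq_add_neg] using hf.add hg.neg

theorem sum {ι : Type*} (s : Finset ι) {f : ι → E3 → ℝ} (hf : ∀ c ∈ s, Vanish m (f c)) :
    Vanish m fun y => ∑ c ∈ s, f c y := by
  classical
  induction s using Finset.induction_on with
  | empty => simpa using zero m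
  | insert c s hc ih =>
    simp only [Finset.sum_insert hc]
    exact (hf c (by simp)).add (ih fun d hd => hf d (by simp [hd]))

theorem coord (j : Fin 3) : Vanish 1 fun y => y j :=
  ⟨smooth_coord j 0, by simp, fun i => by
    have : NullData.pd i (fun z : E3 => z j) = fun _ => if i = j then 1 else 0 :=
      funext fun y => pd_coord i j y
    rw [this]
    exact contDiffAt_const⟩

end Vanish

/-! ### The Euler operator on germs -/

/-- The Euler operator `y^j ∂_j`. -/
def euler (f : E3 → ℝ) (y : E3) : ℝ := ∑ j, y j * pd j f y

theorem smooth_euler {f : E3 → ℝ} (hf : ContDiffAt ℝ ∞ f 0) : ContDiffAt ℝ ∞ (euler f) 0 :=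
  ContDiffAt.sum fun j _ => (smooth_coord j 0).mul (smooth_pd hf j)

/-- The commutator of ∂_i with E is ∂_i. This is what shifts the constant `c` by one at each
differentiation in `Vanish.of_euler`. -/
theorem pd_euler {f : E3 → ℝ} (hf : ContDiffAt ℝ ∞ f 0) (i : Fin 3) :
    pd i (euler f) =ᶠ[𝓝 0] fun y => pd i f y + euler (pd i f) y := by
  have h1 : pd i (euler f) =ᶠ[𝓝 0] fun y => ∑ j, pd i (fun z => z j * pd j f z) y :=
    pd_sum Finset.univ (f := fun j z => z j * pd j f z)
      (fun j _ => (smooth_coord j 0).mul (smooth_pd hf j)) i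
  have h2 : ∀ᶠ y in 𝓝 (0 : E3), ∀ j, pd i (fun z => z j * pd j f z) y
      = pd i (fun z => z j) y * pd j f y + y j * pd i (pd j f) y :=
    Filter.eventually_all.2 fun j => pd_mul (smooth_coord j 0) (smooth_pd hf j) i
  have h3 : ∀ᶠ y in 𝓝 (0 : E3), ∀ j, pd i (pd j f) y = pd j (pd i f) y :=
    Filter.eventually_all.2 fun j => pd_comm hf i j
  filter_upwards [h1, h2, h3] with y h1 h2 h3
  simp only [h1, h2, h3, pd_coord, Finset.sum_add_distrib, euler]
  simp

/-- The indicial roots of `y^j ∂_j + c` on germs of order `m` are avoided if `c + m > 0`. -/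
theorem Vanish.of_euler {q : ℕ} : ∀ {m : ℕ} {f : E3 → ℝ} {c : ℝ}, 0 < c + m → Vanish m f →
    Vanish q (fun y => euler f y + c * f y) → Vanish q f := by
  induction q with
  | zero => exact fun _ h _ => h.smooth
  | succ q ih =>
    intro m f c hc hf h
    -- For `m = 0`, evaluation at the origin kills the Euler term and leaves `c * f 0 = 0` with `c >
    -- 0`.
    have h0 : f 0 = 0 := by
      cases m with
      | succ m => exact hf.eq_zero
      | zero =>
        have := h.eq_zero
        simp only [euler] at this
        simp at this
        rcases this with h | h
        · simp [h] at hc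
        · exact h
    refine ⟨hf.smooth, h0, fun i => ?_⟩
    -- Differentiation raises `c` by one and lowers the known order `m` by at most one, so `0 < c +
    -- m` persists.
    have hi : Vanish q fun y => euler (NullData.pd i f) y + (c + 1) * NullData.pd i f y := by
      refine (h.pd i).congr ?_
      have e1 := pd_add (smooth_euler hf.smooth) (contDiffAt_const.mul hf.smooth) i
        (g := fun y => c * f y)
      have e2 := pd_mul (contDiffAt_const (c := c)) hf.smooth i
      filter_upwards [e1, e2, pd_euler hf.smooth i] with y h1 h2 h3
      rw [h1, h2, h3, pd_const]
      ring
    cases m with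
    | succ m => exact ih (m := m) (by push_cast at hc; linarith) (hf.pd i) hi
    | zero => exact ih (m := 0) (by push_cast at hc ⊢; linarith) (smooth_pd hf i) hi

/-! ### Germs of smooth functions that agree to a given order at the origin -/

/-- `f` and `g` are smooth at the origin and their derivatives of order less than `m` agree
there. -/
structure JetEq (m : ℕ) (f g : E3 → ℝ) : Prop where
  left : ContDiffAt ℝ ∞ f 0
  right : ContDiffAt ℝ ∞ g 0
  sub : Vanish m fun y => f y - g y

namespace JetEq

variable {m : ℕ} {f g f' g' : E3 → ℝ}

theorem refl (hf : ContDiffAt ℝ ∞ f 0) : JetEq m f f := ⟨hf, hf, by simpa using Vanish.zero m⟩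

theorem symm (h : JetEq m f g) : JetEq m g f := ⟨h.right, h.left, by simpa using h.sub.neg⟩

theorem mono {k : ℕ} (h : JetEq m f g) (hk : k ≤ m) : JetEq k f g :=
  ⟨h.left, h.right, h.sub.mono hk⟩

theorem zero (hf : ContDiffAt ℝ ∞ f 0) (hg : ContDiffAt ℝ ∞ g 0) : JetEq 0 f g :=
  ⟨hf, hg, hf.sub hg⟩

theorem congr (h : JetEq m f g) (e : f =ᶠ[𝓝 0] f') (e' : g =ᶠ[𝓝 0] g') : JetEq m f' g' :=
  ⟨h.left.congr_of_eventuallyEq e.symm, h.right.congr_of_eventuallyEq e'.symm,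
    h.sub.congr (by filter_upwards [e, e'] with y h1 h2; rw [h1, h2])⟩

theorem eq (h : JetEq (m + 1) f g) : f 0 = g 0 := sub_eq_zero.1 h.sub.eq_zero

theorem add (h : JetEq m f g) (h' : JetEq m f' g') :
    JetEq m (fun y => f y + f' y) fun y => g y + g' y :=
  ⟨h.left.add h'.left, h.right.add h'.right, by
    convert h.sub.add h'.sub using 2; ring⟩

theorem minus (h : JetEq m f g) (h' : JetEq m f' g') :
    JetEq m (fun y => f y - f' y) fun y => g y - g' y :=
  ⟨h.left.sub h'.left, h.right.sub h'.right, by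
    convert h.sub.sub h'.sub using 2; ring⟩

theorem mul (h : JetEq m f g) (h' : JetEq m f' g') :
    JetEq m (fun y => f y * f' y) fun y => g y * g' y :=
  ⟨h.left.mul h'.left, h.right.mul h'.right, by
    convert (h.sub.mul (b := 0) (c := m) h'.left le_rfl).add
      (Vanish.mul (a := 0) h.right h'.sub (Nat.zero_add m).ge) using 2
    ring⟩

theorem const (c : ℝ) : JetEq m (fun _ => c) fun _ => c := refl contDiffAt_const

theorem sum {ι : Type*} (s : Finset ι) {f g : ι → E3 → ℝ} (h : ∀ c ∈ s, JetEq m (f c) (g c)) :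
    JetEq m (fun y => ∑ c ∈ s, f c y) fun y => ∑ c ∈ s, g c y :=
  ⟨ContDiffAt.sum fun c hc => (h c hc).left, ContDiffAt.sum fun c hc => (h c hc).right, by
    simpa only [Finset.sum_sub_distrib] using Vanish.sum s fun c hc => (h c hc).sub⟩

theorem pd (h : JetEq (m + 1) f g) (i : Fin 3) : JetEq m (pd i f) (pd i g) :=
  ⟨smooth_pd h.left i, smooth_pd h.right i, (h.sub.pd i).congr (pd_sub h.left h.right i)⟩

/-- The order gained from the factor `y j` is what advances the frame in `CoordSol.jetEq_frame`. -/
theorem coord_mul (h : JetEq m f g) (j : Fin 3) :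
    JetEq (m + 1) (fun y => y j * f y) fun y => y j * g y :=
  ⟨(smooth_coord j 0).mul h.left, (smooth_coord j 0).mul h.right, by
    convert (Vanish.coord j).mul h.sub (Nat.add_comm 1 m).ge using 2
    ring⟩

end JetEq

/-! ### Composition with smooth functions and iterated derivatives -/

theorem smooth_combination {ι : Type*} [Fintype ι] {W : Type*} [NormedAddCommGroup W]
    [NormedSpace ℝ W] (b : ι → W) {w : ι → E3 → ℝ} (hw : ∀ c, ContDiffAt ℝ ∞ (w c) 0) :
    ContDiffAt ℝ ∞ (fun y => ∑ c, w c y • b c) 0 :=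
  ContDiffAt.sum fun c _ => (hw c).smul contDiffAt_const

theorem pd_comp {ι : Type*} [Fintype ι] {W : Type*} [NormedAddCommGroup W] [NormedSpace ℝ W]
    (b : ι → W) {w : ι → E3 → ℝ} (hw : ∀ c, ContDiffAt ℝ ∞ (w c) 0) {F : W → ℝ}
    (hF : ContDiffAt ℝ ∞ F (∑ c, w c 0 • b c)) (i : Fin 3) :
    pd i (fun y => F (∑ c, w c y • b c)) =ᶠ[𝓝 0]
      fun y => ∑ c, fderiv ℝ F (∑ c, w c y • b c) (b c) * pd i (w c) y := by
  have hF1 : ∀ᶠ z in 𝓝 (∑ c, w c 0 • b c), DifferentiableAt ℝ F z := by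
    filter_upwards [(hF.of_le (m := 1) (by exact_mod_cast le_top)).eventually (by simp)] with z hz
    exact hz.differentiableAt (by simp)
  have hw1 : ∀ᶠ y in 𝓝 (0 : E3), ∀ c, DifferentiableAt ℝ (w c) y :=
    Filter.eventually_all.2 fun c => eventually_differentiableAt (hw c)
  have hc : Tendsto (fun y => ∑ c, w c y • b c) (𝓝 0) (𝓝 (∑ c, w c 0 • b c)) :=
    (smooth_combination b hw).continuousAt
  filter_upwards [hc.eventually hF1, hw1] with y h1 h2
  have hd : HasFDerivAt (fun y => ∑ c, w c y • b c)
      (∑ c, (fderiv ℝ (w c) y).smulRight (b c)) y :=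
    HasFDerivAt.fun_sum fun c _ => (h2 c).hasFDerivAt.smul_const (b c)
  have := h1.hasFDerivAt.comp y hd
  simp only [pd]
  rw [show (fun y => F (∑ c, w c y • b c)) = F ∘ fun y => ∑ c, w c y • b c from rfl, this.fderiv]
  simp [map_sum, mul_comm]

/-- By the chain rule each partial derivative is a sum of directional derivatives of `F`, composed
with the same arguments, times ∂_i of the coefficients. The induction on `m` is therefore over all
`F` at once. Combinations of fixed vectors `b` keep the chain rule a finite sum in any `W`. -/
theorem JetEq.comp {ι : Type*} [Fintype ι] {W : Type*} [NormedAddCommGroup W] [NormedSpace ℝ W]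
    (b : ι → W) {m : ℕ} {w w' : ι → E3 → ℝ} (h : ∀ c, JetEq m (w c) (w' c)) {F : W → ℝ}
    (hF : ContDiffAt ℝ ∞ F (∑ c, w c 0 • b c)) (hF' : ContDiffAt ℝ ∞ F (∑ c, w' c 0 • b c)) :
    JetEq m (fun y => F (∑ c, w c y • b c)) fun y => F (∑ c, w' c y • b c) := by
  have hl : ContDiffAt ℝ ∞ (fun y => F (∑ c, w c y • b c)) 0 :=
    hF.comp (0 : E3) (smooth_combination b fun c => (h c).left)
  have hr : ContDiffAt ℝ ∞ (fun y => F (∑ c, w' c y • b c)) 0 :=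
    hF'.comp (0 : E3) (smooth_combination b fun c => (h c).right)
  induction m generalizing F with
  | zero => exact JetEq.zero hl hr
  | succ m ih =>
    refine ⟨hl, hr, hl.sub hr, by simp only [fun c => (h c).eq, sub_self], fun i => ?_⟩
    refine Vanish.congr ?_ (pd_sub hl hr i).symm
    have hd : ∀ {z : W} (c : ι), ContDiffAt ℝ ∞ F z →
        ContDiffAt ℝ ∞ (fun z => fderiv ℝ F z (b c)) z := fun c hz =>
      (hz.fderiv_right (m := ∞) (by simp)).clm_apply contDiffAt_const
    have key : JetEq m (fun y => ∑ c, fderiv ℝ F (∑ c, w c y • b c) (b c) * NullData.pd i (w c) y)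
        fun y => ∑ c, fderiv ℝ F (∑ c, w' c y • b c) (b c) * NullData.pd i (w' c) y :=
      JetEq.sum _ fun c _ => (ih (F := fun z => fderiv ℝ F z (b c))
        (fun c => (h c).mono (Nat.le_succ m)) (hd c hF) (hd c hF')
        (ContDiffAt.comp (g := fun z => fderiv ℝ F z (b c)) (0 : E3) (hd c hF)
          (smooth_combination b fun c => (h c).left))
        (ContDiffAt.comp (g := fun z => fderiv ℝ F z (b c)) (0 : E3) (hd c hF')
          (smooth_combination b fun c => (h c).right))).mul ((h c).pd i)
    exact (key.congr (pd_comp b (fun c => (h c).left) hF i).symm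
      (pd_comp b (fun c => (h c).right) hF' i).symm).sub

/-- Iterated partial derivatives. -/
def pds (l : List (Fin 3)) (f : E3 → ℝ) : E3 → ℝ := l.foldr pd f

theorem smooth_pds {f : E3 → ℝ} (hf : ContDiffAt ℝ ∞ f 0) :
    ∀ l : List (Fin 3), ContDiffAt ℝ ∞ (pds l f) 0
  | [] => hf
  | i :: l => smooth_pd (smooth_pds hf l) i

theorem pds_append (l l' : List (Fin 3)) (f : E3 → ℝ) : pds (l ++ l') f = pds l (pds l' f) :=
  List.foldr_append

theorem pds_perm {f : E3 → ℝ} (hf : ContDiffAt ℝ ∞ f 0) {l l' : List (Fin 3)} (h : l.Perm l') :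
    pds l f =ᶠ[𝓝 0] pds l' f := by
  induction h with
  | nil => rfl
  | cons i _ ih => exact pd_congr ih i
  | swap i j l => exact pd_comm (smooth_pds hf l) j i
  | trans _ _ h1 h2 => exact h1.trans h2

theorem pds_sum {ι : Type*} (s : Finset ι) {f : ι → E3 → ℝ}
    (hf : ∀ c ∈ s, ContDiffAt ℝ ∞ (f c) 0) : ∀ l : List (Fin 3),
    pds l (fun y => ∑ c ∈ s, f c y) =ᶠ[𝓝 0] fun y => ∑ c ∈ s, pds l (f c) y
  | [] => EventuallyEq.rfl
  | i :: l => (pd_congr (pds_sum s hf l) i).trans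
      (pd_sum s (fun c hc => smooth_pds (hf c hc) l) i)

/-- With truncated subtraction the case `m = 0` asserts smoothness only. -/
theorem Vanish.pd' {m : ℕ} {f : E3 → ℝ} (h : Vanish m f) (i : Fin 3) :
    Vanish (m - 1) (NullData.pd i f) := by
  cases m with
  | zero => exact smooth_pd h i
  | succ m => exact h.pd i

theorem Vanish.pds {m : ℕ} {f : E3 → ℝ} : ∀ {l : List (Fin 3)}, Vanish (m + l.length) f →
    Vanish m (pds l f)
  | [], h => h
  | i :: l, h => (Vanish.pds (m := m + 1) (l := l) (h.mono (by simp; omega))).pd i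

theorem Vanish.succ_of_pds {m : ℕ} : ∀ {f : E3 → ℝ}, Vanish m f →
    (∀ l : List (Fin 3), l.length = m → NullData.pds l f 0 = 0) → Vanish (m + 1) f := by
  induction m with
  | zero => exact fun h h0 => ⟨h, h0 [] rfl, fun i => smooth_pd h i⟩
  | succ m ih =>
    refine fun h h0 => ⟨h.1, h.2.1, fun i => ih (h.pd i) fun l hl => ?_⟩
    -- `pds` applies the last entry of the list first, and `i` is the derivative already taken.
    have := h0 (l ++ [i]) (by simp [hl])
    rwa [pds_append] at this

/-! ### The Gauss lemma and the linearised Ricci tensor -/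

theorem pd_contract {k : Fin 3 → E3 → ℝ} (hk : ∀ l, ContDiffAt ℝ ∞ (k l) 0) (i : Fin 3) :
    pd i (fun y => ∑ l, y l * k l y) =ᶠ[𝓝 0] fun y => k i y + ∑ l, y l * pd i (k l) y := by
  have h1 := pd_sum Finset.univ (f := fun l y => y l * k l y)
    (fun l _ => (smooth_coord l 0).mul (hk l)) i
  have h2 : ∀ᶠ y in 𝓝 (0 : E3), ∀ l, pd i (fun y => y l * k l y) y
      = pd i (fun y => y l) y * k l y + y l * pd i (k l) y :=
    Filter.eventually_all.2 fun l => pd_mul (smooth_coord l 0) (hk l) i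
  filter_upwards [h1, h2] with y h1 h2
  rw [h1]
  simp only [h2, pd_coord, Finset.sum_add_distrib]
  simp

theorem pd_pd_contract {k : Fin 3 → E3 → ℝ} (hk : ∀ l, ContDiffAt ℝ ∞ (k l) 0) (i j : Fin 3) :
    pd i (pd j (fun y => ∑ l, y l * k l y)) =ᶠ[𝓝 0]
      fun y => pd i (k j) y + pd j (k i) y + ∑ l, y l * pd i (pd j (k l)) y := by
  have h1 := pd_congr (pd_contract hk j) i
  have h2 := pd_add (hk j) (g := fun y => ∑ l, y l * pd j (k l) y)
    (ContDiffAt.sum fun l _ => (smooth_coord l 0).mul (smooth_pd (hk l) j)) i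
  have h3 := pd_contract (fun l => smooth_pd (hk l) j) i
  filter_upwards [h1, h2, h3] with y h1 h2 h3
  rw [h1, h2, h3]
  ring

/-- The Gauss lemma for jets: the radial components of `G` are flat if `G` is the deviation of the
metric from its value at the origin. -/
theorem gauss_lemma {G : Fin 3 → Fin 3 → E3 → ℝ} (hG : ∀ i j, Vanish 1 (G i j))
    (hs : ∀ i j, G i j = G j i)
    (hn : ∀ᶠ y in 𝓝 (0 : E3), ∀ l, ∑ j, ∑ k,
      (pd j (G l k) y + pd k (G l j) y - pd l (G j k) y) * y j * y k = 0)
    (m : ℕ) (l : Fin 3) : Vanish m fun y => ∑ k, y k * G l k y := by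
  have hW : ∀ l, Vanish 2 fun y => ∑ k, y k * G l k y := fun l =>
    Vanish.sum _ fun k _ => (Vanish.coord k).mul (hG l k) le_rfl
  have hQ : Vanish 3 fun y => ∑ l, y l * ∑ k, y k * G l k y :=
    Vanish.sum _ fun k _ => (Vanish.coord k).mul (hW k) le_rfl
  have eW : ∀ᶠ y in 𝓝 (0 : E3), ∀ l i, pd i (fun y => ∑ k, y k * G l k y) y
      = G l i y + ∑ k, y k * pd i (G l k) y :=
    Filter.eventually_all.2 fun l => Filter.eventually_all.2 fun i =>
      pd_contract (fun k => (hG l k).smooth) i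
  have eQ : ∀ᶠ y in 𝓝 (0 : E3), ∀ i, pd i (fun y => ∑ l, y l * ∑ k, y k * G l k y) y
      = ∑ k, y k * G i k y + ∑ l, y l * pd i (fun y => ∑ k, y k * G l k y) y :=
    Filter.eventually_all.2 fun i => pd_contract (fun l => (hW l).smooth) i
  -- Contracting the normal coordinate condition with y^l gives EQ = 2Q for Q = y^l y^k G_lk. Since
  -- Q starts at order 3, the constant -2 is admissible in `Vanish.of_euler`.
  have hQ' : ∀ m, Vanish m fun y => ∑ l, y l * ∑ k, y k * G l k y := by
    intro m
    refine Vanish.of_euler (c := -2) (by norm_num) hQ ((Vanish.zero m).congr ?_)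
    filter_upwards [eW, eQ, hn] with y h1 h2 h3
    have h0 := congrArg₂ (· + ·) (congrArg₂ (· + ·) (congrArg (y 0 * ·) (h3 0))
      (congrArg (y 1 * ·) (h3 1))) (congrArg (y 2 * ·) (h3 2))
    simp only [euler, h2, h1]
    simp only [Fin.sum_univ_three, hs 1 0, hs 2 0, hs 2 1] at h0 ⊢
    linear_combination -h0
  -- With the index `l` free the condition reads E W_l = ∂_l Q / 2 for W_l = y^k G_lk, and Q is
  -- already flat.
  refine Vanish.of_euler (c := 0) (by norm_num) (hW l) ?_
  refine (((hQ' (m + 1)).pd l).const_mul (1 / 2)).congr ?_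
  filter_upwards [eW, eQ, hn] with y h1 h2 h3
  have h0 := h3 l
  simp only [euler, h2, h1]
  simp only [Fin.sum_univ_three] at h0 ⊢
  fin_cases l <;> simp only [Fin.zero_eta, Fin.mk_one, Fin.reduceFinMk, hs 1 0, hs 2 0, hs 2 1]
    at h0 ⊢ <;> linear_combination -(1 / 2) * h0

/-- The linearisation at the Euclidean metric of the Ricci tensor, as a function of the second
derivatives `s i j a b = ∂_i ∂_j k_ab`. -/
def linRicci (s : Fin 3 → Fin 3 → Fin 3 → Fin 3 → ℝ) (i j : Fin 3) : ℝ :=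
  (1 / 2) * ∑ l, (s l i l j + s l j l i - s l l i j - s j i l l)

/-- In three dimensions the linearised Riemann tensor is determined by the linearised Ricci
tensor. -/
theorem linRiemann_radial (s : Fin 3 → Fin 3 → Fin 3 → Fin 3 → ℝ)
    (h1 : ∀ i j a b, s i j a b = s j i a b) (h2 : ∀ i j a b, s i j a b = s i j b a)
    (y : Fin 3 → ℝ) (i k : Fin 3) :
    ∑ j, ∑ l, y j * y l * (s j k i l + s i l j k - s i k j l - s j l i k)
      = 2 * ∑ j, ∑ l, y j * y l * (
        (if i = k then 1 else 0) * (linRicci s j l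
          - (if j = l then 1 else 0) * ((1 / 4) * ∑ m, linRicci s m m))
        + (if j = l then 1 else 0) * (linRicci s i k
          - (if i = k then 1 else 0) * ((1 / 4) * ∑ m, linRicci s m m))
        - (if i = l then 1 else 0) * (linRicci s j k
          - (if j = k then 1 else 0) * ((1 / 4) * ∑ m, linRicci s m m))
        - (if j = k then 1 else 0) * (linRicci s i l
          - (if i = l then 1 else 0) * ((1 / 4) * ∑ m, linRicci s m m))) := by
  -- Ricci minus a quarter of its trace is the Schouten tensor in dimension three, and the identity
  -- expresses the vanishing of the Weyl tensor. It is linear in `s` and is checked for each `i`,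
  -- `k` after the symmetries have been used to normalise the components.
  have e1 : ∀ a b, s 1 0 a b = s 0 1 a b := h1 1 0
  have e2 : ∀ a b, s 2 0 a b = s 0 2 a b := h1 2 0
  have e3 : ∀ a b, s 2 1 a b = s 1 2 a b := h1 2 1
  have f1 : ∀ a b, s a b 1 0 = s a b 0 1 := fun a b => h2 a b 1 0
  have f2 : ∀ a b, s a b 2 0 = s a b 0 2 := fun a b => h2 a b 2 0
  have f3 : ∀ a b, s a b 2 1 = s a b 1 2 := fun a b => h2 a b 2 1
  fin_cases i <;> fin_cases k <;>
    simp [linRicci, Fin.sum_univ_three, e1, e2, e3, f1, f2, f3] <;> ring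

/-- A metric perturbation in radial gauge is determined by its linearised Ricci tensor. -/
theorem vanish_of_linRicci {q : ℕ} {k : Fin 3 → Fin 3 → E3 → ℝ} (hk : ∀ i j, Vanish 1 (k i j))
    (hs : ∀ i j, k i j = k j i) (hA : ∀ m l, Vanish m fun y => ∑ j, y j * k l j y)
    (hR : ∀ i j, Vanish q fun y => linRicci (fun a b c d => pd a (pd b (k c d)) y) i j)
    (i j : Fin 3) : Vanish (q + 2) (k i j) := by
  have hsm : ∀ i j, ContDiffAt ℝ ∞ (k i j) 0 := fun i j => (hk i j).smooth
  have hyy : ∀ j l {f : E3 → ℝ}, Vanish q f → Vanish (q + 2) fun y => y j * y l * f y :=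
    fun j l f hf => ((Vanish.coord j).mul (Vanish.coord l) le_rfl).mul hf (by omega)
  have htr : Vanish q fun y =>
      (1 / 4) * ∑ m, linRicci (fun a b c d => pd a (pd b (k c d)) y) m m :=
    (Vanish.sum _ fun m _ => hR m m).const_mul _
  -- The right side of `linRiemann_radial`; the two factors of y raise the order from `q` to `q +
  -- 2`.
  have hB := Vanish.const_mul 2 <| Vanish.sum (m := q + 2) Finset.univ fun a _ =>
    Vanish.sum Finset.univ fun b _ => hyy a b <|
    ((((((hR a b).sub (htr.const_mul (if a = b then 1 else 0))).const_mul (if i = j then 1 else 0)).add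
      (((hR i j).sub (htr.const_mul (if i = j then 1 else 0))).const_mul (if a = b then 1 else 0))).sub
      (((hR a j).sub (htr.const_mul (if a = j then 1 else 0))).const_mul (if i = b then 1 else 0))).sub
      (((hR i b).sub (htr.const_mul (if i = b then 1 else 0))).const_mul (if a = j then 1 else 0)))
  have hc : ∀ᶠ y in 𝓝 (0 : E3), ∀ a b c d, pd a (pd b (k c d)) y = pd b (pd a (k c d)) y :=
    Filter.eventually_all.2 fun a => Filter.eventually_all.2 fun b =>
      Filter.eventually_all.2 fun c => Filter.eventually_all.2 fun d => pd_comm (hsm c d) a b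
  have e1 : ∀ᶠ y in 𝓝 (0 : E3), ∀ l a, pd a (fun y => ∑ j, y j * k l j y) y
      = k l a y + ∑ j, y j * pd a (k l j) y :=
    Filter.eventually_all.2 fun l => Filter.eventually_all.2 fun a => pd_contract (hsm l) a
  have e2 : ∀ᶠ y in 𝓝 (0 : E3), ∀ l a b, pd a (pd b (fun y => ∑ j, y j * k l j y)) y
      = pd a (k l b) y + pd b (k l a) y + ∑ j, y j * pd a (pd b (k l j)) y :=
    Filter.eventually_all.2 fun l => Filter.eventually_all.2 fun a =>
      Filter.eventually_all.2 fun b => pd_pd_contract (hsm l) a b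
  have e3 : ∀ᶠ y in 𝓝 (0 : E3), ∀ a, pd a (euler (k i j)) y
      = pd a (k i j) y + euler (pd a (k i j)) y :=
    Filter.eventually_all.2 fun a => pd_euler (hsm i j) a
  have hA1 : ∀ l a, Vanish (q + 2) (pd a fun y => ∑ j, y j * k l j y) := fun l a =>
    (hA (q + 3) l).pd a
  have hA2 : ∀ c l a b, Vanish (q + 2) fun y => y c * pd a (pd b fun y => ∑ j, y j * k l j y) y :=
    fun c l a b => Vanish.mul (a := 0) (smooth_coord c 0) (((hA (q + 4) l).pd b).pd a) (by omega)
  have hflat : Vanish (q + 2) fun y =>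
      (∑ c, y c * pd c (pd j fun y => ∑ j, y j * k i j y) y
        + ∑ c, y c * pd c (pd i fun y => ∑ b, y b * k j b y) y)
      - ∑ c, y c * pd i (pd j fun y => ∑ b, y b * k c b y) y :=
    ((Vanish.sum _ fun c _ => hA2 c i c j).add (Vanish.sum _ fun c _ => hA2 c j c i)).sub
      (Vanish.sum _ fun c _ => hA2 c c i j)
  -- In radial gauge y^b ∂_j k_ib = -k_ij modulo flat terms. Applied to the four terms of the radial
  -- curvature, this leaves -(E² + E)k_ij; the flat terms are collected in `hflat`.
  have main : Vanish (q + 2) fun y => euler (euler (k i j)) y + 1 * euler (k i j) y := by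
    refine (hflat.sub hB).congr ?_
    filter_upwards [hc, e1, e2, e3] with y hc e1 e2 e3
    rw [← linRiemann_radial (fun a b c d => pd a (pd b (k c d)) y) hc
      (fun a b c d => by simp only [hs c d])]
    rw [show euler (euler (k i j)) y = ∑ a, y a * pd a (euler (k i j)) y from rfl]
    simp only [e2, e3, euler]
    simp only [hc i _ _ _, hc _ j _ _]
    simp only [Fin.sum_univ_three, hs 1 0, hs 2 0, hs 2 1]
    fin_cases i <;> fin_cases j <;>
      simp only [Fin.zero_eta, Fin.mk_one, Fin.reduceFinMk, hs 1 0, hs 2 0, hs 2 1,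
        hc 1 0, hc 2 0, hc 2 1] <;> ring
  -- (E + 1)E is inverted factor by factor: E + 1 needs no initial order of vanishing, E needs k(0)
  -- = 0.
  have h1 : Vanish (q + 2) (euler (k i j)) :=
    Vanish.of_euler (m := 0) (by norm_num) (smooth_euler (hsm i j)) main
  exact Vanish.of_euler (c := 0) (by norm_num) (hk i j) (by simpa using h1)

/-! ### Jets of the Levi-Civita connection and of its curvature -/

/-- The components of `g` are smooth at the origin and `g` is invertible there. -/
structure SmoothMetric (g : E3 → Matrix (Fin 3) (Fin 3) ℝ) : Prop where
  smooth : ∀ i j, ContDiffAt ℝ ∞ (fun y => g y i j) 0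
  det_ne : (g 0).det ≠ 0

theorem smooth_det {M : E3 → Matrix (Fin 3) (Fin 3) ℝ}
    (hM : ∀ i j, ContDiffAt ℝ ∞ (fun y => M y i j) 0) :
    ContDiffAt ℝ ∞ (fun y => (M y).det) 0 := by
  simp only [Matrix.det_apply']
  exact ContDiffAt.sum fun σ _ => contDiffAt_const.mul (contDiffAt_prod fun k _ => hM _ _)

namespace SmoothMetric

variable {g g' : E3 → Matrix (Fin 3) (Fin 3) ℝ}

theorem eventually_isUnit_det (h : SmoothMetric g) : ∀ᶠ y in 𝓝 0, IsUnit (g y).det := by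
  filter_upwards [(smooth_det h.smooth).continuousAt.eventually_ne h.det_ne] with y hy
  exact isUnit_iff_ne_zero.2 hy

theorem smooth_inv (h : SmoothMetric g) (i j : Fin 3) :
    ContDiffAt ℝ ∞ (fun y => (g y)⁻¹ i j) 0 := by
  have ha : ContDiffAt ℝ ∞ (fun y => (g y).adjugate i j) 0 := by
    simp only [Matrix.adjugate_apply]
    refine smooth_det fun a b => ?_
    simp only [Matrix.updateRow_apply]
    split_ifs
    · exact contDiffAt_const
    · exact h.smooth a b
  have := ((smooth_det h.smooth).inv h.det_ne).mul ha
  simpa [Matrix.inv_def] using this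

/-- Near the origin g⁻¹ - g'⁻¹ = g⁻¹(g' - g)g'⁻¹, and the middle factor carries the order. -/
theorem jetEq_inv (h : SmoothMetric g) (h' : SmoothMetric g') {m : ℕ}
    (hj : ∀ i j, JetEq m (fun y => g y i j) fun y => g' y i j) (i j : Fin 3) :
    JetEq m (fun y => (g y)⁻¹ i j) fun y => (g' y)⁻¹ i j := by
  refine ⟨h.smooth_inv i j, h'.smooth_inv i j, ?_⟩
  have : Vanish m fun y => ∑ b, (∑ a, (g y)⁻¹ i a * (g' y a b - g y a b)) * (g' y)⁻¹ b j :=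
    Vanish.sum _ fun b _ => Vanish.mul (b := 0) (Vanish.sum _ fun a _ =>
      Vanish.mul (a := 0) (h.smooth_inv i a) (hj a b).symm.sub (Nat.zero_add m).ge)
      (h'.smooth_inv b j) le_rfl
  refine this.congr ?_
  filter_upwards [h.eventually_isUnit_det, h'.eventually_isUnit_det] with y hy hy'
  have e : (g y)⁻¹ - (g' y)⁻¹ = (g y)⁻¹ * (g' y - g y) * (g' y)⁻¹ := by
    rw [mul_sub, sub_mul, Matrix.nonsing_inv_mul _ hy, one_mul, mul_assoc,
      Matrix.mul_nonsing_inv _ hy', mul_one]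
  rw [← Matrix.sub_apply, e, Matrix.mul_apply]
  simp only [Matrix.mul_apply, Matrix.sub_apply]

theorem smooth_christoffel (h : SmoothMetric g) (i j k : Fin 3) :
    ContDiffAt ℝ ∞ (christoffel g i j k) 0 :=
  contDiffAt_const.mul (ContDiffAt.sum fun l _ => (h.smooth_inv i l).mul
    (((smooth_pd (h.smooth l k) j).add (smooth_pd (h.smooth l j) k)).sub
      (smooth_pd (h.smooth j k) l)))

theorem jetEq_christoffel (h : SmoothMetric g) (h' : SmoothMetric g') {m : ℕ}
    (hj : ∀ i j, JetEq (m + 1) (fun y => g y i j) fun y => g' y i j) (i j k : Fin 3) :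
    JetEq m (christoffel g i j k) (christoffel g' i j k) :=
  (JetEq.const _).mul (JetEq.sum _ fun l _ => ((h.jetEq_inv h' hj i l).mono (Nat.le_succ m)).mul
    ((((hj l k).pd j).add ((hj l j).pd k)).minus ((hj j k).pd l)))

theorem jetEq_christoffel' (h : SmoothMetric g) (h' : SmoothMetric g') {m : ℕ}
    (hj : ∀ i j, JetEq m (fun y => g y i j) fun y => g' y i j) (i j k : Fin 3) :
    JetEq (m - 1) (christoffel g i j k) (christoffel g' i j k) := by
  cases m with
  | zero => exact JetEq.zero (h.smooth_christoffel i j k) (h'.smooth_christoffel i j k)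
  | succ m => exact h.jetEq_christoffel h' hj i j k

/-- The leading part of the difference of two connections. -/
theorem christoffel_sub (h : SmoothMetric g) (h' : SmoothMetric g') {m : ℕ}
    (hj : ∀ i j, JetEq (m + 1) (fun y => g y i j) fun y => g' y i j) (h0' : g' 0 = -1)
    (i j k : Fin 3) :
    Vanish (m + 1) fun y => christoffel g i j k y - christoffel g' i j k y
      + (1 / 2) * (pd j (fun z => g z i k - g' z i k) y + pd k (fun z => g z i j - g' z i j) y
        - pd i (fun z => g z j k - g' z j k) y) := by
  -- The metric is negative definite with `g' 0 = -1`, so its inverse is -1 up to first order; hence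
  -- the plus signs here and in the conclusion.
  have hI : ∀ l, Vanish 1 fun y => (g' y)⁻¹ i l + (if i = l then 1 else 0) := fun l =>
    ⟨(h'.smooth_inv i l).add contDiffAt_const, by
      have : (-1 : Matrix (Fin 3) (Fin 3) ℝ)⁻¹ = -1 := Matrix.inv_eq_left_inv (by simp)
      simp only [h0', this, Matrix.neg_apply, Matrix.one_apply]
      ring, fun a => smooth_pd ((h'.smooth_inv i l).add contDiffAt_const) a⟩
  have hd : ∀ a b c, Vanish m (pd a fun z => g z b c - g' z b c) := fun a b c => (hj b c).sub.pd a
  have hC : ∀ l, ContDiffAt ℝ ∞ (fun y => pd j (fun z => g z l k) y + pd k (fun z => g z l j) y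
      - pd l (fun z => g z j k) y) 0 := fun l =>
    ((smooth_pd (h.smooth l k) j).add (smooth_pd (h.smooth l j) k)).sub (smooth_pd (h.smooth j k) l)
  -- The change of the inverse metric is of order `m + 1`. In the other term ∂k has order `m` only,
  -- and replacing `g'⁻¹` by -1 costs an error of one order more.
  have key := Vanish.const_mul (1 / 2) <| Vanish.sum (m := m + 1) Finset.univ fun l _ =>
    (Vanish.mul (b := 0) (h.jetEq_inv h' hj i l).sub (hC l) le_rfl).add
      ((hI l).mul (((hd j l k).add (hd k l j)).sub (hd l j k)) (Nat.add_comm 1 m).ge)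
  refine key.congr ?_
  have hp : ∀ᶠ y in 𝓝 (0 : E3), ∀ a b c, pd a (fun z => g z b c - g' z b c) y
      = pd a (fun z => g z b c) y - pd a (fun z => g' z b c) y :=
    Filter.eventually_all.2 fun a => Filter.eventually_all.2 fun b => Filter.eventually_all.2
      fun c => pd_sub (h.smooth b c) (h'.smooth b c) a
  filter_upwards [hp] with y hp
  simp only [hp, christoffel]
  have e : ∀ F : Fin 3 → ℝ, F i = ∑ l, (if i = l then 1 else 0) * F l := fun F => by simp
  rw [e fun i => pd j (fun z => g z i k) y - pd j (fun z => g' z i k) y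
    + (pd k (fun z => g z i j) y - pd k (fun z => g' z i j) y)
    - (pd i (fun z => g z j k) y - pd i (fun z => g' z j k) y), ← mul_sub, ← mul_add,
    ← Finset.sum_sub_distrib, ← Finset.sum_add_distrib]
  congr 1
  refine Finset.sum_congr rfl fun l _ => ?_
  ring

theorem pd_linear {f f' d : E3 → ℝ} (hf : ContDiffAt ℝ ∞ f 0) (hf' : ContDiffAt ℝ ∞ f' 0)
    (hd : ContDiffAt ℝ ∞ d 0) (c : ℝ) (i : Fin 3) :
    pd i (fun y => f y - f' y + c * d y) =ᶠ[𝓝 0]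
      fun y => pd i f y - pd i f' y + c * pd i d y := by
  filter_upwards [pd_add (hf.sub hf') (contDiffAt_const.mul hd) i (g := fun y => c * d y),
    pd_sub hf hf' i, pd_mul (contDiffAt_const (c := c)) hd i] with y h1 h2 h3
  rw [h1, h2, h3, pd_const]
  ring

/-- The leading part of the difference of two Ricci tensors. -/
theorem ricci_sub (h : SmoothMetric g) (h' : SmoothMetric g') {m : ℕ}
    (hj : ∀ i j, JetEq (m + 1) (fun y => g y i j) fun y => g' y i j) (h0' : g' 0 = -1)
    (hs : ∀ y i j, g y i j = g y j i) (hs' : ∀ y i j, g' y i j = g' y j i) (i j : Fin 3) :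
    Vanish m fun y => ricci g i j y - ricci g' i j y
      + linRicci (fun a b c d => pd a (pd b fun z => g z c d - g' z c d) y) i j := by
  have hsm : ∀ a b, ContDiffAt ℝ ∞ (fun z => g z a b - g' z a b) 0 := fun a b => (hj a b).sub.smooth
  have hD : ∀ a b c, ContDiffAt ℝ ∞ (fun y => pd b (fun z => g z a c - g' z a c) y
      + pd c (fun z => g z a b - g' z a b) y - pd a (fun z => g z b c - g' z b c) y) 0 :=
    fun a b c => ((smooth_pd (hsm a c) b).add (smooth_pd (hsm a b) c)).sub (smooth_pd (hsm b c) a)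
  have h1 := fun a b c d => (h.christoffel_sub h' hj h0' a b c).pd d
  -- The products of Christoffel symbols agree to order `m`, so only the derivatives of the
  -- connection contribute to the leading part.
  have hΓ := h.jetEq_christoffel h' hj
  have key := Vanish.sum (m := m) Finset.univ fun l _ => ((h1 l i j l).sub (h1 l i l j)).add
    (Vanish.sum Finset.univ fun k _ =>
      (((hΓ l l k).mul (hΓ k i j)).minus ((hΓ l j k).mul (hΓ k i l))).sub)
  refine key.congr ?_
  have e1 : ∀ᶠ y in 𝓝 (0 : E3), ∀ a b c d, pd d (fun y => christoffel g a b c y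
      - christoffel g' a b c y + (1 / 2) * (pd b (fun z => g z a c - g' z a c) y
        + pd c (fun z => g z a b - g' z a b) y - pd a (fun z => g z b c - g' z b c) y)) y
      = pd d (christoffel g a b c) y - pd d (christoffel g' a b c) y
        + (1 / 2) * pd d (fun y => pd b (fun z => g z a c - g' z a c) y
        + pd c (fun z => g z a b - g' z a b) y - pd a (fun z => g z b c - g' z b c) y) y :=
    Filter.eventually_all.2 fun a => Filter.eventually_all.2 fun b => Filter.eventually_all.2
      fun c => Filter.eventually_all.2 fun d => pd_linear (h.smooth_christoffel a b c)
        (h'.smooth_christoffel a b c) (hD a b c) (1 / 2) d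
  have e2 : ∀ᶠ y in 𝓝 (0 : E3), ∀ a b c d, pd d (fun y => pd b (fun z => g z a c - g' z a c) y
        + pd c (fun z => g z a b - g' z a b) y - pd a (fun z => g z b c - g' z b c) y) y
      = pd d (pd b (fun z => g z a c - g' z a c)) y + pd d (pd c (fun z => g z a b - g' z a b)) y
        - pd d (pd a (fun z => g z b c - g' z b c)) y :=
    Filter.eventually_all.2 fun a => Filter.eventually_all.2 fun b => Filter.eventually_all.2
      fun c => Filter.eventually_all.2 fun d => by
        filter_upwards [pd_sub ((smooth_pd (hsm a c) b).add (smooth_pd (hsm a b) c))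
          (smooth_pd (hsm b c) a) d, pd_add (smooth_pd (hsm a c) b) (smooth_pd (hsm a b) c) d]
          with y h1 h2
        rw [h1, h2]
  filter_upwards [e1, e2] with y e1 e2
  have hk : ∀ a b, (fun z => g z a b - g' z a b) = fun z => g z b a - g' z b a := fun a b =>
    funext fun z => by rw [hs z a b, hs' z a b]
  simp only [e1, e2, ricci, linRicci]
  rw [Finset.mul_sum, ← Finset.sum_sub_distrib, ← Finset.sum_add_distrib]
  refine Finset.sum_congr rfl fun l _ => ?_
  rw [hk l i, hk l j]
  simp only [Finset.sum_sub_distrib]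
  ring

theorem smooth_iterCovDeriv (h : SmoothMetric g) {φ : E3 → ℝ} (hφ : ContDiffAt ℝ ∞ φ 0) :
    ∀ (p : ℕ) (a : Fin p → Fin 3), ContDiffAt ℝ ∞ (fun y => iterCovDeriv g φ p y a) 0
  | 0, _ => hφ
  | p + 1, a => (smooth_pd (h.smooth_iterCovDeriv hφ p (Fin.tail a)) (a 0)).sub
      (ContDiffAt.sum fun i _ => ContDiffAt.sum fun l _ =>
        (h.smooth_christoffel l (a 0) (Fin.tail a i)).mul (h.smooth_iterCovDeriv hφ p _))

/-- The leading part of the difference of two iterated covariant derivatives. -/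
theorem iterCovDeriv_sub (h : SmoothMetric g) (h' : SmoothMetric g') {p : ℕ}
    (hj : ∀ i j, JetEq p (fun y => g y i j) fun y => g' y i j) {φ φ' : E3 → ℝ}
    (hφ : JetEq p φ φ') : ∀ (q r : ℕ), q + r = p + 1 → ∀ a : Fin q → Fin 3,
    Vanish r fun y => iterCovDeriv g φ q y a - iterCovDeriv g' φ' q y a
      - pds (List.ofFn a) (fun z => φ z - φ' z) y
  | 0, r, _, a => by
    simpa [iterCovDeriv, pds] using Vanish.zero r
  | q + 1, r, hqr, a => by
    have hD := h.smooth_iterCovDeriv hφ.left q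
    have hD' := h'.smooth_iterCovDeriv hφ.right q
    have hu : ContDiffAt ℝ ∞ (fun z => φ z - φ' z) 0 := hφ.sub.smooth
    have ih := h.iterCovDeriv_sub h' hj hφ q (r + 1) (by omega)
    have hT : ∀ b, Vanish r fun y => iterCovDeriv g φ q y b - iterCovDeriv g' φ' q y b := fun b => by
      have : Vanish r (pds (List.ofFn b) fun z => φ z - φ' z) :=
        Vanish.pds (hφ.sub.mono (by simp; omega))
      simpa using (ih b).pred.add this
    -- A slot `i : Fin q` exists only for `q ≥ 1`; then `r ≤ p - 1`, the order to which the
    -- Christoffel symbols agree.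
    have hsum : Vanish r fun y => ∑ i, ∑ l,
        (christoffel g l (a 0) (Fin.tail a i) y
            * iterCovDeriv g φ q y (Function.update (Fin.tail a) i l)
          - christoffel g' l (a 0) (Fin.tail a i) y
            * iterCovDeriv g' φ' q y (Function.update (Fin.tail a) i l)) :=
      Vanish.sum _ fun i _ => Vanish.sum _ fun l _ =>
        (((h.jetEq_christoffel' h' hj l (a 0) (Fin.tail a i)).mono
          (by have := i.pos; omega)).mul ⟨hD _, hD' _, hT _⟩).sub
    refine (((ih (Fin.tail a)).pd (a 0)).sub hsum).congr ?_
    filter_upwards [pd_sub ((hD (Fin.tail a)).sub (hD' (Fin.tail a)))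
      (smooth_pds hu (List.ofFn (Fin.tail a))) (a 0),
      pd_sub (hD (Fin.tail a)) (hD' (Fin.tail a)) (a 0)] with y h1 h2
    rw [h1, h2]
    simp only [iterCovDeriv, covDeriv, List.ofFn_succ, Finset.sum_sub_distrib]
    simp only [pds, List.foldr_cons]
    simp only [Fin.tail_def]
    ring

end SmoothMetric

/-! ### Jets of solutions at the base point -/

/-- The arguments of the coefficient functions `f` and `f^α`. -/
def fieldArg {n : ℕ} (φ : Fin n → E3 → ℝ) (e : Fin 3 → Fin 3 → E3 → ℝ) (y : E3) :
    (Fin n → ℝ) × (Fin n → Fin 3 → ℝ) :=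
  (fun γ => φ γ y, fun γ a => ∑ i, e i a y * pd i (φ γ) y)

/-- The germ of a solution of the field equations in normal coordinates. -/
structure CoordSol {n : ℕ} (S : FieldSystem n) (g : E3 → Matrix (Fin 3) (Fin 3) ℝ)
    (φ : Fin n → E3 → ℝ) (e : Fin 3 → Fin 3 → E3 → ℝ) : Prop where
  smooth_g : ∀ i j, ContDiffAt ℝ ∞ (fun y => g y i j) 0
  smooth_φ : ∀ α, ContDiffAt ℝ ∞ (φ α) 0
  smooth_e : ∀ i a, ContDiffAt ℝ ∞ (e i a) 0
  symm : ∀ y i j, g y i j = g y j i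
  g_zero : g 0 = -1
  e_zero : ∀ i a, e i a 0 = if i = a then 1 else 0
  normal : ∀ᶠ y in 𝓝 0, ∀ i, ∑ j, ∑ k, christoffel g i j k y * y j * y k = 0
  parallel : ∀ᶠ y in 𝓝 0, ∀ i a,
    ∑ j, y j * (pd j (e i a) y + ∑ k, christoffel g i j k y * e k a y) = 0
  mem_domF : ∀ᶠ y in 𝓝 0, (fun γ => φ γ y) ∈ S.domF
  mem_domf : ∀ᶠ y in 𝓝 0, fieldArg φ e y ∈ S.domf
  eq_laplacian : ∀ᶠ y in 𝓝 0, ∀ α, laplacian g (φ α) y = S.f1 α (fieldArg φ e y)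
  eq_ricci : ∀ᶠ y in 𝓝 0, ∀ i j, ricci g i j y
    = ∑ α, S.F1 α (fun γ => φ γ y) * iterCovDeriv g (φ α) 2 y ![i, j]
      + ∑ α, ∑ β, S.F2 α β (fun γ => φ γ y) * pd i (φ α) y * pd j (φ β) y
      + S.f0 (fieldArg φ e y) * g y i j

theorem pds_ofFn_comp_perm {u : E3 → ℝ} (hu : ContDiffAt ℝ ∞ u 0) {p : ℕ} (a : Fin p → Fin 3)
    (σ : Equiv.Perm (Fin p)) : pds (List.ofFn (a ∘ σ)) u 0 = pds (List.ofFn a) u 0 :=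
  (pds_perm hu (Equiv.Perm.ofFn_comp_perm σ a)).self_of_nhds

/-- The derivatives of order `p` form a symmetric trace-free tensor if the derivatives of order
`p - 2` of the Laplacian vanish. -/
theorem pds_mem_stf {u : E3 → ℝ} (hu : ContDiffAt ℝ ∞ u 0) {p : ℕ}
    (hL : Vanish (p - 1) fun y => ∑ k, pd k (pd k u) y) :
    WithLp.toLp 2 (fun a : Fin p → Fin 3 => pds (List.ofFn a) u 0) ∈ stf p := by
  refine ⟨fun σ a => pds_ofFn_comp_perm hu a σ, fun i j hij a => ?_⟩
  obtain ⟨p, rfl⟩ : ∃ r, p = r + 2 :=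
    ⟨p - 2, by have := i.isLt; have := j.isLt; have := Fin.val_ne_of_ne hij; omega⟩
  -- A permutation with `σ 0 = i` and `σ 1 = j` brings the traced slots to the front. Partial
  -- derivatives commute, so the pair can then be moved innermost, where the trace is the Laplacian.
  set σ : Equiv.Perm (Fin (p + 2)) := Equiv.swap 1 (Equiv.swap 0 i j) |>.trans (Equiv.swap 0 i)
  have h0 : σ 0 = i := by
    have : Equiv.swap 0 i j ≠ 0 := by
      rw [Ne, Equiv.swap_apply_eq_iff]
      simpa using hij.symm
    simp [σ, Equiv.swap_apply_of_ne_of_ne (Fin.zero_ne_one) this.symm]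
  have h1 : σ 1 = j := by simp [σ]
  have hk : ∀ k, pds (List.ofFn (Function.update (Function.update a i k) j k)) u 0
      = pds (List.ofFn fun t : Fin p => a (σ t.succ.succ)) (pds [k, k] u) 0 := fun k => by
    rw [← pds_ofFn_comp_perm hu _ σ, ← pds_append]
    refine Filter.EventuallyEq.eq_of_nhds (pds_perm hu ?_)
    refine List.Perm.trans (l₂ := [k, k] ++ List.ofFn fun t : Fin p => a (σ t.succ.succ)) ?_
      List.perm_append_comm
    refine List.Perm.of_eq ?_
    rw [List.ofFn_succ, List.ofFn_succ]
    have e0 : (Function.update (Function.update a i k) j k ∘ σ) 0 = k := by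
      simp [h0, Function.update_apply]
    have e1 : (Function.update (Function.update a i k) j k ∘ σ) (Fin.succ 0) = k := by
      simp [h1]
    rw [e0, e1]
    have e2 : ∀ t : Fin p, (Function.update (Function.update a i k) j k ∘ σ) t.succ.succ
        = a (σ t.succ.succ) := fun t => by
      have n1 : σ t.succ.succ ≠ j := by
        rw [← h1, Ne, σ.injective.eq_iff]
        simp [Fin.ext_iff]
      have n0 : σ t.succ.succ ≠ i := by
        rw [← h0, Ne, σ.injective.eq_iff]
        exact Fin.succ_ne_zero _
      simp [n0, n1]
    simp only [e2]
    rfl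
  show ∑ k, pds (List.ofFn (Function.update (Function.update a i k) j k)) u 0 = 0
  simp only [hk]
  have hs := (pds_sum Finset.univ (f := fun k => pds [k, k] u) (fun k _ => smooth_pds hu [k, k])
    (List.ofFn fun t : Fin p => a (σ t.succ.succ))).self_of_nhds
  refine hs.symm.trans ?_
  -- With the two traced slots split off, `p` derivatives remain and the Laplacian vanishes to order
  -- `p + 1`.
  have hv : Vanish 1 (pds (List.ofFn fun t : Fin p => a (σ t.succ.succ))
      fun y => ∑ k, pd k (pd k u) y) := Vanish.pds (hL.mono (by simp; omega))
  exact hv.eq_zero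

namespace CoordSol

variable {n : ℕ} {S : FieldSystem n} {g g' : E3 → Matrix (Fin 3) (Fin 3) ℝ}
  {φ φ' : Fin n → E3 → ℝ} {e e' : Fin 3 → Fin 3 → E3 → ℝ}

theorem smoothMetric (h : CoordSol S g φ e) : SmoothMetric g :=
  ⟨h.smooth_g, by rw [h.g_zero, Matrix.det_neg]; simp⟩

/-- The radial components of the metric are those of the flat metric up to a flat function. -/
theorem vanish_radial (h : CoordSol S g φ e) (m : ℕ) (l : Fin 3) :
    Vanish m fun y => ∑ k, y k * (g y l k + if l = k then 1 else 0) := by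
  have hsm : ∀ i j, ContDiffAt ℝ ∞ (fun y => g y i j + if i = j then 1 else 0) 0 := fun i j =>
    (h.smooth_g i j).add contDiffAt_const
  refine gauss_lemma (G := fun i j y => g y i j + if i = j then 1 else 0) (fun i j => ?_)
    (fun i j => ?_) ?_ m l
  · refine ⟨hsm i j, ?_, fun a => smooth_pd (hsm i j) a⟩
    simp [h.g_zero, Matrix.one_apply]
  · funext y
    rw [h.symm y i j]
    simp only [eq_comm]
  · have hp : ∀ᶠ y in 𝓝 (0 : E3), ∀ a b c, pd a (fun y => g y b c + if b = c then 1 else 0) y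
        = pd a (fun y => g y b c) y :=
      Filter.eventually_all.2 fun a => Filter.eventually_all.2 fun b => Filter.eventually_all.2
        fun c => by
          filter_upwards [pd_add (h.smooth_g b c) contDiffAt_const a] with y hy
          rw [hy, pd_const, add_zero]
    filter_upwards [hp, h.normal, h.smoothMetric.eventually_isUnit_det] with y hp hn hd l
    simp only [hp]
    -- Lowering the index removes the inverse metric and leaves the condition required by
    -- `gauss_lemma`.
    have hl : ∀ j k, ∑ i, g y l i * christoffel g i j k y = (1 / 2) *
        (pd j (fun z => g z l k) y + pd k (fun z => g z l j) y - pd l (fun z => g z j k) y) := by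
      intro j k
      have hm := Matrix.mul_nonsing_inv (g y) hd
      have hm' : ∀ r, ∑ i, g y l i * (g y)⁻¹ i r = if l = r then 1 else 0 := fun r => by
        rw [← Matrix.mul_apply, hm, Matrix.one_apply]
      simp only [christoffel, mul_left_comm _ (1 / 2 : ℝ), ← Finset.mul_sum]
      congr 1
      simp only [Finset.mul_sum]
      rw [Finset.sum_comm]
      simp only [← mul_assoc, ← Finset.sum_mul, hm']
      simp
    have h2 : ∀ j k, pd j (fun z => g z l k) y + pd k (fun z => g z l j) y
        - pd l (fun z => g z j k) y = 2 * ∑ i, g y l i * christoffel g i j k y := fun j k => by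
      rw [hl]; ring
    simp only [h2]
    have h3 : ∑ i, g y l i * ∑ j, ∑ k, christoffel g i j k y * y j * y k = 0 := by simp [hn]
    have h4 : ∑ j, ∑ k, 2 * (∑ i, g y l i * christoffel g i j k y) * y j * y k
        = 2 * ∑ i, g y l i * ∑ j, ∑ k, christoffel g i j k y * y j * y k := by
      simp only [Fin.sum_univ_three]
      ring
    rw [h4, h3, mul_zero]

/-- The expansion in the standard basis of ℝⁿ × (ℝ³)ⁿ is the form that `JetEq.comp` requires. -/
theorem fieldArg_eq_combination (φ : Fin n → E3 → ℝ) (e : Fin 3 → Fin 3 → E3 → ℝ) (y : E3) :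
    fieldArg φ e y = ∑ c : Fin n ⊕ Fin n × Fin 3,
      (Sum.elim (fun γ => φ γ) (fun x y => ∑ i, e i x.2 y * pd i (φ x.1) y) c : E3 → ℝ) y
        • (Sum.elim (fun γ => (Pi.single γ 1, 0)) (fun x => (0, Pi.single x.1 (Pi.single x.2 1))) c :
          (Fin n → ℝ) × (Fin n → Fin 3 → ℝ)) := by
  rw [Fintype.sum_sum_type]
  refine Prod.ext ?_ ?_
  · funext γ
    simp [fieldArg, Prod.fst_sum, Finset.sum_apply, Pi.single_apply]
  · funext γ a
    simp [fieldArg, Prod.snd_sum, Finset.sum_apply, Pi.single_apply, Fintype.sum_prod_type]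

theorem jetEq_fieldArg (h : CoordSol S g φ e) (h' : CoordSol S g' φ' e') {m : ℕ}
    (hφ : ∀ α, JetEq (m + 1) (φ α) (φ' α)) (he : ∀ i a, JetEq m (e i a) (e' i a))
    {F : (Fin n → ℝ) × (Fin n → Fin 3 → ℝ) → ℝ} (hF : AnalyticOnNhd ℝ F S.domf) :
    JetEq m (fun y => F (fieldArg φ e y)) fun y => F (fieldArg φ' e' y) := by
  have hl := (hF _ h.mem_domf.self_of_nhds).contDiffAt (n := ∞)
  have hr := (hF _ h'.mem_domf.self_of_nhds).contDiffAt (n := ∞)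
  simp only [fieldArg_eq_combination] at hl hr ⊢
  refine JetEq.comp _ (fun c => ?_) hl hr
  rcases c with γ | ⟨γ, a⟩
  · exact (hφ γ).mono (Nat.le_succ m)
  · exact JetEq.sum _ fun i _ => (he i a).mul ((hφ γ).pd i)

theorem jetEq_coeff (h : CoordSol S g φ e) (h' : CoordSol S g' φ' e') {m : ℕ}
    (hφ : ∀ α, JetEq m (φ α) (φ' α)) {F : (Fin n → ℝ) → ℝ} (hF : AnalyticOnNhd ℝ F S.domF) :
    JetEq m (fun y => F fun γ => φ γ y) fun y => F fun γ => φ' γ y := by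
  have hl := (hF _ h.mem_domF.self_of_nhds).contDiffAt (n := ∞)
  have hr := (hF _ h'.mem_domF.self_of_nhds).contDiffAt (n := ∞)
  have e : ∀ (φ : Fin n → E3 → ℝ) (y : E3), (fun γ => φ γ y)
      = ∑ γ, φ γ y • (Pi.single γ 1 : Fin n → ℝ) := fun φ y => by
    funext γ
    simp [Finset.sum_apply, Pi.single_apply]
  simp only [e] at hl hr ⊢
  exact JetEq.comp _ hφ hl hr

/-- The right sides of the first field equation contain at most first derivatives of φ, so they
agree to order `p - 1`. On the left the leading part of the difference is minus the flat Laplacian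
of u. -/
theorem vanish_laplacian (h : CoordSol S g φ e) (h' : CoordSol S g' φ' e') {p : ℕ}
    (hg : ∀ i j, JetEq p (fun y => g y i j) fun y => g' y i j)
    (hφ : ∀ α, JetEq p (φ α) (φ' α)) (he : ∀ i a, JetEq p (e i a) (e' i a)) (α : Fin n) :
    Vanish (p - 1) fun y => ∑ k, pd k (pd k fun z => φ α z - φ' α z) y := by
  have hu : ContDiffAt ℝ ∞ (fun z => φ α z - φ' α z) 0 := (hφ α).sub.smooth
  obtain _ | p := p
  · exact ContDiffAt.sum fun k _ => smooth_pd (smooth_pd hu k) k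
  have hm := h.smoothMetric
  have hm' := h'.smoothMetric
  have hf := (h.jetEq_fieldArg h' hφ (fun i a => (he i a).mono (Nat.le_succ p))
    (S.analytic_f1 α)).sub
  have hI : ∀ i j, Vanish 1 fun y => (g' y)⁻¹ i j + (if i = j then 1 else 0) := fun i j =>
    ⟨(hm'.smooth_inv i j).add contDiffAt_const, by
      have : (-1 : Matrix (Fin 3) (Fin 3) ℝ)⁻¹ = -1 := Matrix.inv_eq_left_inv (by simp)
      simp only [h'.g_zero, this, Matrix.neg_apply, Matrix.one_apply]
      ring, fun a => smooth_pd ((hm'.smooth_inv i j).add contDiffAt_const) a⟩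
  have hD := hm.smooth_iterCovDeriv (h.smooth_φ α) 2
  have hd : ∀ i j, Vanish (p - 1) (pds (List.ofFn ![i, j]) fun z => φ α z - φ' α z) := fun i j =>
    ((hφ α).sub.pd' j).pd' i
  -- Apart from -∂∂u, the difference of the two Laplacians has three parts: the change of the
  -- inverse metric, the connection terms of the Hessian, and ∂∂u multiplied by `g'⁻¹ + 1`. In the
  -- last, the zero of `g'⁻¹ + 1` makes up for the order that ∂∂u lacks.
  have key := Vanish.sum (m := p) Finset.univ fun i _ => Vanish.sum Finset.univ fun j _ =>
    ((Vanish.mul (b := 0) (c := p) (hm.jetEq_inv hm' hg i j).sub (hD ![i, j]) (by omega)).add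
      (Vanish.mul (a := 0) (c := p) (hm'.smooth_inv i j)
        (hm.iterCovDeriv_sub hm' hg (hφ α) 2 p (by omega) ![i, j]) (by omega))).add
      (Vanish.mul (c := p) (hI i j) (hd i j) (by omega))
  refine (key.sub hf).congr ?_
  filter_upwards [h.eq_laplacian, h'.eq_laplacian] with y h1 h2
  rw [← h1 α, ← h2 α, laplacian, laplacian]
  have hk : ∀ k, pd k (pd k fun z => φ α z - φ' α z) y
      = ∑ j, (if k = j then 1 else 0) * pds (List.ofFn ![k, j]) (fun z => φ α z - φ' α z) y :=
    fun k => by simp [pds]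
  simp only [hk, ← Finset.sum_sub_distrib]
  refine Finset.sum_congr rfl fun i _ => Finset.sum_congr rfl fun j _ => ?_
  ring

/-- The right side of the second field equation contains second derivatives of φ but only
undifferentiated components of the metric beyond its connection. It thus agrees to order `q`, and so
does the Ricci tensor; the radial gauge returns two orders for the metric. -/
theorem jetEq_metric (h : CoordSol S g φ e) (h' : CoordSol S g' φ' e') {q : ℕ}
    (hg : ∀ i j, JetEq (q + 1) (fun y => g y i j) fun y => g' y i j)
    (hφ : ∀ α, JetEq (q + 2) (φ α) (φ' α)) (he : ∀ i a, JetEq (q + 1) (e i a) (e' i a))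
    (i j : Fin 3) : JetEq (q + 2) (fun y => g y i j) fun y => g' y i j := by
  have hm := h.smoothMetric
  have hm' := h'.smoothMetric
  have hD : ∀ α i j, JetEq q (fun y => iterCovDeriv g (φ α) 2 y ![i, j])
      fun y => iterCovDeriv g' (φ' α) 2 y ![i, j] := fun α i j =>
    ⟨hm.smooth_iterCovDeriv (h.smooth_φ α) 2 _, hm'.smooth_iterCovDeriv (h'.smooth_φ α) 2 _, by
      have h1 := hm.iterCovDeriv_sub hm' hg ((hφ α).mono (Nat.le_succ _)) 2 q (by omega) ![i, j]
      have h2 : Vanish q (pds (List.ofFn ![i, j]) fun z => φ α z - φ' α z) := ((hφ α).sub.pd j).pd i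
      simpa using h1.add h2⟩
  have hrhs : ∀ i j, JetEq q (ricci g i j) (ricci g' i j) := fun i j => by
    refine JetEq.congr (JetEq.add (JetEq.add (JetEq.sum Finset.univ fun α _ =>
      (h.jetEq_coeff h' (fun α => (hφ α).mono (by omega)) (S.analytic_F1 α)).mul (hD α i j))
      (JetEq.sum Finset.univ fun α _ => JetEq.sum Finset.univ fun β _ =>
        ((h.jetEq_coeff h' (fun α => (hφ α).mono (by omega)) (S.analytic_F2 α β)).mul
          (((hφ α).pd i).mono (by omega))).mul (((hφ β).pd j).mono (by omega))))
      ((h.jetEq_fieldArg h' (fun α => (hφ α).mono (by omega))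
        (fun i a => (he i a).mono (Nat.le_succ q)) S.analytic_f0).mul ((hg i j).mono (by omega))))
      ?_ ?_
    · filter_upwards [h.eq_ricci] with y hy using (hy i j).symm
    · filter_upwards [h'.eq_ricci] with y hy using (hy i j).symm
  refine ⟨h.smooth_g i j, h'.smooth_g i j, vanish_of_linRicci (k := fun i j z => g z i j - g' z i j)
    (fun i j => (hg i j).sub.mono (by omega)) (fun i j => funext fun z => by
      rw [h.symm z i j, h'.symm z i j]) (fun m l => ?_) (fun i j => ?_) i j⟩
  · convert (h.vanish_radial m l).sub (h'.vanish_radial m l) using 2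
    rw [← Finset.sum_sub_distrib]
    exact Finset.sum_congr rfl fun k _ => by ring
  · simpa using (hm.ricci_sub hm' hg h'.g_zero h.symm h'.symm i j).sub (hrhs i j).sub

/-- Along rays E e = -y^j Γ_j e. The factor y^j gives one order more than is known of the frame, and
E is invertible on the difference because the frames coincide at the origin. -/
theorem jetEq_frame (h : CoordSol S g φ e) (h' : CoordSol S g' φ' e') {q : ℕ}
    (hg : ∀ i j, JetEq (q + 1) (fun y => g y i j) fun y => g' y i j) :
    ∀ r ≤ q + 1, ∀ i a, JetEq r (e i a) (e' i a)
  | 0, _, i, a => JetEq.zero (h.smooth_e i a) (h'.smooth_e i a)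
  | r + 1, hr, i, a => by
    have ih := h.jetEq_frame h' hg r (by omega)
    have hsm : ContDiffAt ℝ ∞ (fun y => e i a y - e' i a y) 0 :=
      (h.smooth_e i a).sub (h'.smooth_e i a)
    have hΓ := h.smoothMetric.jetEq_christoffel h'.smoothMetric hg
    have key := (JetEq.sum Finset.univ fun j _ => JetEq.coord_mul (JetEq.sum Finset.univ fun k _ =>
      ((hΓ i j k).mono (by omega : r ≤ q)).mul (ih k a)) j).sub.neg
    refine ⟨h.smooth_e i a, h'.smooth_e i a, Vanish.of_euler (c := 0) (m := 1) (by norm_num)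
      ⟨hsm, by simp [h.e_zero, h'.e_zero], fun l => smooth_pd hsm l⟩ (key.congr ?_)⟩
    have hp : ∀ᶠ y in 𝓝 (0 : E3), ∀ l, pd l (fun y => e i a y - e' i a y) y
        = pd l (e i a) y - pd l (e' i a) y :=
      Filter.eventually_all.2 fun l => pd_sub (h.smooth_e i a) (h'.smooth_e i a) l
    filter_upwards [h.parallel, h'.parallel, hp] with y h1 h2 hp
    have h1 := h1 i a
    have h2 := h2 i a
    simp only [mul_add, Finset.sum_add_distrib] at h1 h2
    simp only [euler, hp, mul_sub, Finset.sum_sub_distrib]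
    linarith

/-- Two solutions agree to infinite order at the base point, if symmetric trace-free tensors that
are differences of the normal expansion coefficients vanish. -/
theorem jetEq (h : CoordSol S g φ e) (h' : CoordSol S g' φ' e')
    (hnull : ∀ α p, WithLp.toLp 2 (fun a : Fin p → Fin 3 => iterCovDeriv g (φ α) p 0 a
        - iterCovDeriv g' (φ' α) p 0 a) ∈ stf p →
      ∀ a, iterCovDeriv g (φ α) p 0 a = iterCovDeriv g' (φ' α) p 0 a) (p : ℕ) :
    (∀ i j, JetEq p (fun y => g y i j) fun y => g' y i j) ∧ (∀ α, JetEq p (φ α) (φ' α)) ∧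
      ∀ i a, JetEq p (e i a) (e' i a) := by
  induction p with
  | zero => exact ⟨fun i j => JetEq.zero (h.smooth_g i j) (h'.smooth_g i j),
      fun α => JetEq.zero (h.smooth_φ α) (h'.smooth_φ α),
      fun i a => JetEq.zero (h.smooth_e i a) (h'.smooth_e i a)⟩
  | succ p ih =>
    obtain ⟨hg, hφ, he⟩ := ih
    -- At the origin the covariant derivatives of order `p` differ by ∂^p u alone, a symmetric
    -- trace-free tensor, to which the hypothesis applies.
    have hφ' : ∀ α, JetEq (p + 1) (φ α) (φ' α) := fun α => by
      have hT : ∀ a : Fin p → Fin 3, iterCovDeriv g (φ α) p 0 a - iterCovDeriv g' (φ' α) p 0 a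
          = pds (List.ofFn a) (fun z => φ α z - φ' α z) 0 := fun a =>
        sub_eq_zero.1 (h.smoothMetric.iterCovDeriv_sub h'.smoothMetric hg (hφ α) p 1 rfl a).eq_zero
      have hz := hnull α p (by
        simp only [hT]
        exact pds_mem_stf (hφ α).sub.smooth (h.vanish_laplacian h' hg hφ he α))
      refine ⟨h.smooth_φ α, h'.smooth_φ α, (hφ α).sub.succ_of_pds fun l hl => ?_⟩
      subst hl
      have := hT l.get
      rw [hz, sub_self, List.ofFn_get] at this
      exact this.symm
    -- The first order is the normalisation `g 0 = -1`; from then on the Ricci equation is used,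
    -- with the order of φ just gained.
    have hg' : ∀ i j, JetEq (p + 1) (fun y => g y i j) fun y => g' y i j := by
      cases p with
      | zero => exact fun i j => ⟨h.smooth_g i j, h'.smooth_g i j, (hg i j).sub,
          by simp [h.g_zero, h'.g_zero], fun a => smooth_pd (hg i j).sub a⟩
      | succ q => exact h.jetEq_metric h' hg hφ' he
    exact ⟨hg', hφ', h.jetEq_frame h' hg' (p + 1) le_rfl⟩

theorem iterCovDeriv_eq (h : CoordSol S g φ e) (h' : CoordSol S g' φ' e')
    (hj : ∀ p, (∀ i j, JetEq p (fun y => g y i j) fun y => g' y i j) ∧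
      (∀ α, JetEq p (φ α) (φ' α)) ∧ ∀ i a, JetEq p (e i a) (e' i a)) (α : Fin n) (p : ℕ)
    (a : Fin p → Fin 3) : iterCovDeriv g (φ α) p 0 a = iterCovDeriv g' (φ' α) p 0 a := by
  have h1 := (h.smoothMetric.iterCovDeriv_sub h'.smoothMetric (hj p).1 ((hj p).2.1 α) p 1 rfl
    a).eq_zero
  have h2 : Vanish 1 (pds (List.ofFn a) fun z => φ α z - φ' α z) :=
    Vanish.pds (((hj (p + 1)).2.1 α).sub.mono (by simp; omega))
  rw [h2.eq_zero, sub_zero] at h1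
  exact sub_eq_zero.1 h1

end CoordSol

/-! ### Symmetric trace-free tensors -/

/-- The map exchanging the entry `a j` with `u` is an involution of the summation range. -/
theorem sum_update_swap {p : ℕ} {K M : Type*} [Fintype K] [AddCommMonoid M] (j : Fin p)
    (H : (Fin p → K) → K → M) :
    ∑ a, ∑ u, H a u = ∑ a, ∑ u, H (Function.update a j u) (a j) := by
  rw [← Fintype.sum_prod_type', ← Fintype.sum_prod_type']
  let f : (Fin p → K) × K → (Fin p → K) × K := fun x => (Function.update x.1 j x.2, x.1 j)
  have hf : Function.Involutive f := fun x => by simp [f]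
  exact (Fintype.sum_equiv hf.toPerm (fun x => H (f x).1 (f x).2) (fun x => H x.1 x.2)
    fun x => rfl).symm

theorem sum_sum_update {p : ℕ} {M : Type*} [AddCommMonoid M] (j : Fin p)
    (G : (Fin p → Fin 3) → M) : ∑ a, ∑ u, G (Function.update a j u) = 3 • ∑ a, G a := by
  rw [← sum_update_swap j fun a _ => G a]
  simp [Finset.sum_nsmul]

/-- This makes the values in two slots free summation variables without splitting the index type;
the factor 9 is cancelled afterwards. -/
theorem sum_update_update {p : ℕ} {M : Type*} [AddCommMonoid M] (j k : Fin p)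
    (G : (Fin p → Fin 3) → M) :
    ∑ a, ∑ u, ∑ v, G (Function.update (Function.update a j u) k v) = 9 • ∑ a, G a := by
  rw [sum_sum_update j fun a => ∑ v, G (Function.update a k v), sum_sum_update k, smul_smul]
  norm_num

theorem prod_update_update {p : ℕ} {M K : Type*} [CommMonoid M] {j k : Fin p} (hjk : j ≠ k)
    (a : Fin p → K) (u v : K) (G : Fin p → K → M) :
    ∏ m, G m (Function.update (Function.update a j u) k v m)
      = G j u * G k v * ∏ m ∈ ((Finset.univ.erase j).erase k), G m (a m) := by
  rw [← Finset.mul_prod_erase _ _ (Finset.mem_univ j),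
    ← Finset.mul_prod_erase _ _ (Finset.mem_erase.2 ⟨hjk.symm, Finset.mem_univ k⟩), ← mul_assoc]
  congr 1
  · simp [hjk]
  · refine Finset.prod_congr rfl fun m hm => ?_
    simp only [Finset.mem_erase] at hm
    rw [Function.update_of_ne hm.1, Function.update_of_ne hm.2.1]

theorem update_update_comp_swap {p : ℕ} {K : Type*} {j k : Fin p} (hjk : j ≠ k) (a : Fin p → K)
    (u v : K) : Function.update (Function.update a j u) k v ∘ Equiv.swap j k
      = Function.update (Function.update a j v) k u := by
  funext m
  simp only [Function.comp_apply, Function.update_apply, Equiv.swap_apply_def]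
  split_ifs <;> simp_all

/-! ### Matrices acting on tensors and the trace-free projection -/

theorem rotate_sub (R : Matrix (Fin 3) (Fin 3) ℝ) {p : ℕ} (T T' : Tensor p) :
    rotate R (fun a => T a - T' a) = fun a => rotate R T a - rotate R T' a := by
  funext a
  simp only [rotate, mul_sub, Finset.sum_sub_distrib]

theorem rotate_rotate (R R' : Matrix (Fin 3) (Fin 3) ℝ) {p : ℕ} (T : Tensor p) :
    rotate R (rotate R' T) = rotate (R * R') T := by
  funext a
  simp only [rotate, Finset.mul_sum]
  rw [Finset.sum_comm]
  refine Finset.sum_congr rfl fun c _ => ?_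
  simp only [← mul_assoc, ← Finset.sum_mul, ← Finset.prod_mul_distrib]
  simp only [Matrix.mul_apply, Fintype.prod_sum]

theorem rotate_one {p : ℕ} (T : Tensor p) : rotate 1 T = T := by
  funext a
  simp only [rotate, Matrix.one_apply]
  rw [Finset.sum_eq_single a]
  · simp
  · intro b _ hb
    obtain ⟨k, hk⟩ := Function.ne_iff.1 hb
    rw [Finset.prod_eq_zero (Finset.mem_univ k) (if_neg hk.symm), zero_mul]
  · simp

theorem sum_rotate_mul (R : Matrix (Fin 3) (Fin 3) ℝ) {p : ℕ} (T U : Tensor p) :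
    ∑ a, rotate R T a * U a = ∑ a, T a * rotate R.transpose U a := by
  simp only [rotate, Finset.sum_mul, Finset.mul_sum, Matrix.transpose_apply]
  rw [Finset.sum_comm]
  exact Finset.sum_congr rfl fun a _ => Finset.sum_congr rfl fun b _ => by ring

theorem rotate_mem_stf {R : Matrix (Fin 3) (Fin 3) ℝ} (hR : R.transpose * R = 1) {p : ℕ}
    {T : Tensor p} (hT : WithLp.toLp 2 T ∈ stf p) : WithLp.toLp 2 (rotate R T) ∈ stf p := by
  refine ⟨fun σ a => ?_, fun i j hij a => ?_⟩
  · show rotate R T (a ∘ σ) = rotate R T a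
    refine Fintype.sum_equiv (Equiv.arrowCongr σ (Equiv.refl _)) _ _ fun b => ?_
    have hb : T (b ∘ σ.symm) = T b := hT.1 σ.symm b
    rw [show (Equiv.arrowCongr σ (Equiv.refl (Fin 3))) b = b ∘ σ.symm from rfl, hb]
    congr 1
    exact Fintype.prod_equiv σ _ _ fun k => by simp
  · show ∑ k, rotate R T (Function.update (Function.update a i k) j k) = 0
    have hRR : ∀ b c, ∑ k, R k b * R k c = if b = c then 1 else 0 := fun b c => by
      have := congrFun (congrFun hR b) c
      rwa [Matrix.mul_apply, Matrix.one_apply] at this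
    -- Summing over the traced index turns the two factors of `R` into a Kronecker delta, so the
    -- trace falls on `T` itself.
    have h1 : ∑ k, rotate R T (Function.update (Function.update a i k) j k)
        = ∑ b : Fin p → Fin 3, ((if b i = b j then 1 else 0)
          * ∏ m ∈ (Finset.univ.erase i).erase j, R (a m) (b m)) * T b := by
      simp only [rotate]
      rw [Finset.sum_comm]
      refine Finset.sum_congr rfl fun b _ => ?_
      simp only [prod_update_update hij a _ _ fun m x => R x (b m)]
      rw [← Finset.sum_mul, ← Finset.sum_mul, hRR]
    have h9 : (9 : ℕ) • ∑ k, rotate R T (Function.update (Function.update a i k) j k) = 0 := by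
      rw [h1, ← sum_update_update i j]
      refine Finset.sum_eq_zero fun b _ => ?_
      have hprod : ∀ u v, ∏ m ∈ (Finset.univ.erase i).erase j,
          R (a m) (Function.update (Function.update b i u) j v m)
          = ∏ m ∈ (Finset.univ.erase i).erase j, R (a m) (b m) := fun u v =>
        Finset.prod_congr rfl fun m hm => by
          simp only [Finset.mem_erase] at hm
          rw [Function.update_of_ne hm.1, Function.update_of_ne hm.2.1]
      have htr : ∑ k, T (Function.update (Function.update b i k) j k) = 0 := hT.2 i j hij b
      simp only [hprod, Function.update_self, Function.update_of_ne hij, ite_mul, one_mul,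
        zero_mul, Finset.sum_ite_eq, Finset.mem_univ, if_true]
      rw [← Finset.mul_sum, htr, mul_zero]
    simpa using h9

theorem stfPart_of_mem {p : ℕ} {T : Tensor p} (hT : WithLp.toLp 2 T ∈ stf p) : stfPart T = T := by
  funext a
  rw [stfPart, Submodule.starProjection_eq_self_iff.2 hT]

theorem stfPart_sub {p : ℕ} (T T' : Tensor p) :
    stfPart (fun a => T a - T' a) = fun a => stfPart T a - stfPart T' a := by
  funext a
  have : WithLp.toLp 2 (fun a => T a - T' a) = WithLp.toLp 2 T - WithLp.toLp 2 T' := rfl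
  rw [stfPart, this, map_sub]
  rfl

/-- The adjoint of `rotate R` is `rotate R.transpose`. Both preserve the symmetric trace-free
tensors, hence also their orthogonal complement, so the projection commutes with them. -/
theorem stfPart_rotate {R : Matrix (Fin 3) (Fin 3) ℝ} (hR : R.transpose * R = 1)
    (hR' : R * R.transpose = 1) {p : ℕ} (T : Tensor p) :
    stfPart (rotate R T) = rotate R (stfPart T) := by
  have hmem : WithLp.toLp 2 (stfPart T) ∈ stf p := (stf p).starProjection_apply_mem _
  have key : (stf p).starProjection (WithLp.toLp 2 (rotate R T))
      = WithLp.toLp 2 (rotate R (stfPart T)) := by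
    refine Submodule.eq_starProjection_of_mem_of_inner_eq_zero (rotate_mem_stf hR hmem)
      fun w hw => ?_
    have hw' : WithLp.toLp 2 (rotate R.transpose w.ofLp) ∈ stf p :=
      rotate_mem_stf (by rwa [Matrix.transpose_transpose]) hw
    have h0 : inner ℝ (WithLp.toLp 2 T - (stf p).starProjection (WithLp.toLp 2 T))
        (WithLp.toLp 2 (rotate R.transpose w.ofLp)) = 0 :=
      Submodule.starProjection_inner_eq_zero _ _ hw'
    have e1 : ∀ X Y : EuclideanSpace ℝ (Fin p → Fin 3), inner ℝ X Y = ∑ a, X a * Y a :=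
      fun X Y => by simp [PiLp.inner_apply, mul_comm]
    rw [e1] at h0 ⊢
    have h2 := sum_rotate_mul R (fun a => T a - stfPart T a) w.ofLp
    rw [rotate_sub] at h2
    exact h2.trans h0
  funext a
  rw [stfPart, key]

/-! ### Spinors of tensors -/

theorem waerden_symm (a : Fin 3) (A B : Fin 2) : waerden a A B = waerden a B A := by
  fin_cases a <;> fin_cases A <;> fin_cases B <;> simp [waerden]

theorem inv_sqrt_two_sq : (((Real.sqrt 2 : ℝ) : ℂ)⁻¹) * ((Real.sqrt 2 : ℝ) : ℂ)⁻¹ = 1 / 2 := by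
  rw [← mul_inv, ← Complex.ofReal_mul, Real.mul_self_sqrt (by norm_num)]
  norm_num

theorem waerden_orthonormal (a c : Fin 3) :
    ∑ A, ∑ B, starRingEnd ℂ (waerden c A B) * waerden a A B = if a = c then 1 else 0 := by
  have h := inv_sqrt_two_sq
  fin_cases a <;> fin_cases c <;> simp [waerden, Fin.sum_univ_two] <;>
    first
    | linear_combination 2 * h
    | (ring_nf; try simp [Complex.I_sq]; try linear_combination 2 * h)

theorem waerden_reality (a : Fin 3) (A B : Fin 2) :
    ∑ A', ∑ B', tau A A' * tau B B' * starRingEnd ℂ (waerden a A' B') = -waerden a A B := by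
  fin_cases a <;> fin_cases A <;> fin_cases B <;>
    simp [waerden, tau, eps, Fin.sum_univ_two]

/-- The part antisymmetric in `A` and `C` is a multiple of ε_AC. By the symmetry of `t` its other
factor is antisymmetric in `B` and `D`, so it is proportional to the trace. -/
theorem waerden_exchange (t : Fin 3 → Fin 3 → ℂ) (hs : ∀ u v, t u v = t v u)
    (ht : ∑ u, t u u = 0) (A B C D : Fin 2) :
    ∑ u, ∑ v, waerden u A B * waerden v C D * t u v
      = ∑ u, ∑ v, waerden u C B * waerden v A D * t u v := by
  have h2 : t 2 2 = -t 0 0 - t 1 1 := by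
    rw [Fin.sum_univ_three] at ht
    linear_combination ht
  fin_cases A <;> fin_cases B <;> fin_cases C <;> fin_cases D <;>
    simp [waerden, Fin.sum_univ_three, h2, hs 1 0, hs 2 0, hs 2 1] <;>
    ring_nf <;> simp [Complex.I_sq] <;> ring

theorem sum_pairs_prod {p : ℕ} (G : Fin p → Fin 2 → Fin 2 → ℂ) :
    ∑ s : Fin p × Fin 2 → Fin 2, ∏ k, G k (s (k, 0)) (s (k, 1)) = ∏ k, ∑ A, ∑ B, G k A B := by
  have h1 : ∀ k, ∑ A, ∑ B, G k A B = ∑ x : Fin 2 → Fin 2, G k (x 0) (x 1) := fun k => by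
    rw [← Fintype.sum_prod_type']
    exact (Fintype.sum_equiv (finTwoArrowEquiv (Fin 2)) _ _ fun x => rfl).symm
  simp only [h1, Fintype.prod_sum]
  exact Fintype.sum_equiv (Equiv.curry _ _ _) _ _ fun s => rfl

theorem toSpinor_sub {p : ℕ} (T T' : Tensor p) :
    toSpinor (fun a => T a - T' a) = fun s => toSpinor T s - toSpinor T' s := by
  funext s
  simp only [toSpinor, Complex.ofReal_sub, mul_sub, Finset.sum_sub_distrib]

/-- The van der Waerden symbols are orthonormal, so contraction with their conjugates recovers the
tensor. -/
theorem eq_zero_of_toSpinor {p : ℕ} {T : Tensor p} (h : ∀ s, toSpinor T s = 0)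
    (c : Fin p → Fin 3) : T c = 0 := by
  have h1 : ∑ s : Fin p × Fin 2 → Fin 2,
      (∏ k, starRingEnd ℂ (waerden (c k) (s (k, 0)) (s (k, 1)))) * toSpinor T s = (T c : ℂ) := by
    simp only [toSpinor, Finset.mul_sum]
    rw [Finset.sum_comm]
    simp only [← mul_assoc, ← Finset.sum_mul, ← Finset.prod_mul_distrib]
    have h2 : ∀ a : Fin p → Fin 3, ∑ s : Fin p × Fin 2 → Fin 2,
        ∏ k, starRingEnd ℂ (waerden (c k) (s (k, 0)) (s (k, 1)))
          * waerden (a k) (s (k, 0)) (s (k, 1)) = ∏ k, if a k = c k then 1 else 0 := fun a => by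
      rw [sum_pairs_prod fun k A B => starRingEnd ℂ (waerden (c k) A B) * waerden (a k) A B]
      simp only [waerden_orthonormal]
    simp only [h2]
    rw [Finset.sum_eq_single c]
    · simp
    · intro b _ hb
      obtain ⟨k, hk⟩ := Function.ne_iff.1 hb
      rw [Finset.prod_eq_zero (Finset.mem_univ k) (if_neg hk), zero_mul]
    · simp
  simp only [h, mul_zero, Finset.sum_const_zero] at h1
  exact_mod_cast h1.symm

/-- Each symbol α^a is reproduced with a factor -1 by τ, τ and conjugation; `p` slots give `(-1)^p`,
and the components of `T` are real. -/
theorem realityCondition_toSpinor {p : ℕ} (T : Tensor p) : RealityCondition (toSpinor T) := by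
  intro s
  have h1 : ∀ s' : Fin p × Fin 2 → Fin 2, (∏ k, tau (s k) (s' k)) * starRingEnd ℂ (toSpinor T s')
      = ∑ a : Fin p → Fin 3, (∏ k, tau (s (k, 0)) (s' (k, 0)) * tau (s (k, 1)) (s' (k, 1))
        * starRingEnd ℂ (waerden (a k) (s' (k, 0)) (s' (k, 1)))) * (T a : ℂ) := fun s' => by
    simp only [toSpinor, map_sum, map_mul, map_prod, Complex.conj_ofReal, Finset.mul_sum,
      ← mul_assoc, Fintype.prod_prod_type, Fin.prod_univ_two, Finset.prod_mul_distrib]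
  simp only [h1]
  rw [Finset.sum_comm]
  simp only [← Finset.sum_mul]
  have h2 : ∀ a : Fin p → Fin 3, ∑ s' : Fin p × Fin 2 → Fin 2,
      ∏ k, tau (s (k, 0)) (s' (k, 0)) * tau (s (k, 1)) (s' (k, 1))
        * starRingEnd ℂ (waerden (a k) (s' (k, 0)) (s' (k, 1)))
      = (-1) ^ p * ∏ k, waerden (a k) (s (k, 0)) (s (k, 1)) := fun a => by
    rw [sum_pairs_prod fun k A B => tau (s (k, 0)) A * tau (s (k, 1)) B
      * starRingEnd ℂ (waerden (a k) A B)]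
    simp only [waerden_reality]
    rw [Finset.prod_neg]
    simp
  simp only [h2]
  simp only [mul_assoc, ← Finset.mul_sum]
  rw [← mul_assoc, ← mul_pow]
  simp [toSpinor]

/-- With the other slots fixed, `T` is a symmetric trace-free tensor in the slots `j` and `k`, so
`waerden_exchange` applies. -/
theorem toSpinor_comp_swap_pairs {p : ℕ} {T : Tensor p} (hT : WithLp.toLp 2 T ∈ stf p)
    {j k : Fin p} (hjk : j ≠ k) (s : Fin p × Fin 2 → Fin 2) :
    toSpinor T (s ∘ Equiv.swap (j, 0) (k, 0)) = toSpinor T s := by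
  have key : ∀ A C : Fin 2, (9 : ℕ) • ∑ a : Fin p → Fin 3,
      (waerden (a j) A (s (j, 1)) * waerden (a k) C (s (k, 1))
        * ∏ m ∈ (Finset.univ.erase j).erase k, waerden (a m) (s (m, 0)) (s (m, 1))) * (T a : ℂ)
      = ∑ a : Fin p → Fin 3, (∏ m ∈ (Finset.univ.erase j).erase k,
          waerden (a m) (s (m, 0)) (s (m, 1)))
        * ∑ u, ∑ v, waerden u A (s (j, 1)) * waerden v C (s (k, 1))
          * (T (Function.update (Function.update a j u) k v) : ℂ) := by
    intro A C
    rw [← sum_update_update j k]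
    refine Finset.sum_congr rfl fun a _ => ?_
    simp only [Finset.mul_sum]
    refine Finset.sum_congr rfl fun u _ => Finset.sum_congr rfl fun v _ => ?_
    have hprod : ∏ m ∈ (Finset.univ.erase j).erase k,
        waerden (Function.update (Function.update a j u) k v m) (s (m, 0)) (s (m, 1))
        = ∏ m ∈ (Finset.univ.erase j).erase k, waerden (a m) (s (m, 0)) (s (m, 1)) :=
      Finset.prod_congr rfl fun m hm => by
        simp only [Finset.mem_erase] at hm
        rw [Function.update_of_ne hm.1, Function.update_of_ne hm.2.1]
    rw [hprod]
    simp only [Function.update_self, Function.update_of_ne hjk]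
    ring
  have expand : ∀ (a : Fin p → Fin 3) (G : Fin p → ℂ), ∏ m, G m
      = G j * G k * ∏ m ∈ (Finset.univ.erase j).erase k, G m := fun a G => by
    rw [← Finset.mul_prod_erase _ _ (Finset.mem_univ j),
      ← Finset.mul_prod_erase _ _ (Finset.mem_erase.2 ⟨hjk.symm, Finset.mem_univ k⟩), ← mul_assoc]
  have h1 : toSpinor T s = ∑ a : Fin p → Fin 3,
      (waerden (a j) (s (j, 0)) (s (j, 1)) * waerden (a k) (s (k, 0)) (s (k, 1))
        * ∏ m ∈ (Finset.univ.erase j).erase k, waerden (a m) (s (m, 0)) (s (m, 1))) * (T a : ℂ) :=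
    Finset.sum_congr rfl fun a _ => by rw [expand a]
  have h2 : toSpinor T (s ∘ Equiv.swap (j, 0) (k, 0)) = ∑ a : Fin p → Fin 3,
      (waerden (a j) (s (k, 0)) (s (j, 1)) * waerden (a k) (s (j, 0)) (s (k, 1))
        * ∏ m ∈ (Finset.univ.erase j).erase k, waerden (a m) (s (m, 0)) (s (m, 1)))
        * (T a : ℂ) := by
    refine Finset.sum_congr rfl fun a _ => ?_
    have hn : ∀ m b : Fin p, (m, (1 : Fin 2)) ≠ (b, (0 : Fin 2)) := fun m b => by simp
    rw [expand a]
    simp only [Function.comp_apply, Equiv.swap_apply_left, Equiv.swap_apply_right,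
      Equiv.swap_apply_of_ne_of_ne (hn _ _) (hn _ _)]
    congr 2
    refine Finset.prod_congr rfl fun m hm => ?_
    simp only [Finset.mem_erase] at hm
    rw [Equiv.swap_apply_of_ne_of_ne] <;> simp [hm.1, hm.2.1]
  have h3 : (9 : ℕ) • toSpinor T (s ∘ Equiv.swap (j, 0) (k, 0)) = (9 : ℕ) • toSpinor T s := by
    rw [h1, h2, key, key]
    refine Finset.sum_congr rfl fun a _ => ?_
    congr 1
    refine (waerden_exchange (fun u v => (T (Function.update (Function.update a j u) k v) : ℂ))
      (fun u v => ?_) ?_ _ _ _ _).symm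
    · have := hT.1 (Equiv.swap j k) (Function.update (Function.update a j u) k v)
      rw [update_update_comp_swap hjk] at this
      exact congrArg _ this.symm
    · have := hT.2 j k hjk a
      exact_mod_cast this
  simpa using h3

theorem toSpinor_totallySymmetric {p : ℕ} {T : Tensor p} (hT : WithLp.toLp 2 T ∈ stf p) :
    TotallySymmetric (toSpinor T) := by
  -- The permutations that fix the spinor form a group; it suffices that it contains all
  -- transpositions.
  let H : Subgroup (Equiv.Perm (Fin p × Fin 2)) :=
    { carrier := {σ | ∀ s, toSpinor T (s ∘ σ) = toSpinor T s}
      mul_mem' := fun {σ ρ} hσ hρ s => by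
        rw [Equiv.Perm.coe_mul, ← Function.comp_assoc, hρ, hσ]
      one_mem' := fun s => rfl
      inv_mem' := fun {σ} hσ s => by
        rw [← hσ (s ∘ ⇑σ⁻¹), Function.comp_assoc, ← Equiv.Perm.coe_mul, inv_mul_cancel]
        rfl }
  have hin : ∀ j b, Equiv.swap (j, (0 : Fin 2)) (j, b) ∈ H := by
    intro j b
    fin_cases b
    · have : Equiv.swap (j, (0 : Fin 2)) (j, 0) = 1 := Equiv.swap_self _
      exact this ▸ H.one_mem
    · intro s
      refine Finset.sum_congr rfl fun a _ => ?_
      congr 1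
      refine Finset.prod_congr rfl fun m _ => ?_
      by_cases hm : m = j
      · subst hm
        simp [waerden_symm (a m) (s (m, 1))]
      · simp only [Function.comp_apply]
        rw [Equiv.swap_apply_of_ne_of_ne, Equiv.swap_apply_of_ne_of_ne] <;> simp [hm]
  have hswap : ∀ x y, x ≠ y → Equiv.swap x y ∈ H := by
    rintro ⟨j, b⟩ ⟨k, c⟩ hne
    by_cases hjk : j = k
    · subst hjk
      have h1 := Equiv.swap_apply_apply (Equiv.swap (j, (0 : Fin 2)) (j, b)) (j, 0) (j, c)
      rcases eq_or_ne b 0 with rfl | hb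
      · exact hin j c
      rcases eq_or_ne c 0 with rfl | hc
      · rw [Equiv.swap_comm]; exact hin j b
      · exact absurd (by rw [Fin.eq_one_of_ne_zero b hb, Fin.eq_one_of_ne_zero c hc]) hne
    -- A general transposition between two pairs is that of the first indices conjugated by
    -- transpositions within the pairs.
    · have hf := Equiv.swap_apply_apply
        (Equiv.swap (j, (0 : Fin 2)) (j, b) * Equiv.swap (k, (0 : Fin 2)) (k, c)) (j, 0) (k, 0)
      have e1 : (Equiv.swap (j, (0 : Fin 2)) (j, b) * Equiv.swap (k, (0 : Fin 2)) (k, c)) (j, 0)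
          = (j, b) := by
        rw [Equiv.Perm.mul_apply, Equiv.swap_apply_of_ne_of_ne (a := (k, (0 : Fin 2)))] <;>
          simp [hjk]
      have e2 : (Equiv.swap (j, (0 : Fin 2)) (j, b) * Equiv.swap (k, (0 : Fin 2)) (k, c)) (k, 0)
          = (k, c) := by
        rw [Equiv.Perm.mul_apply, Equiv.swap_apply_left, Equiv.swap_apply_of_ne_of_ne] <;>
          simp [Ne.symm hjk]
      rw [e1, e2] at hf
      rw [hf]
      have hm := H.mul_mem (hin j b) (hin k c)
      exact H.mul_mem (H.mul_mem hm fun s => toSpinor_comp_swap_pairs hT hjk s) (H.inv_mem hm)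
  have htop : H = ⊤ := by
    rw [eq_top_iff, ← Equiv.Perm.closure_isSwap, Subgroup.closure_le]
    rintro σ ⟨x, y, hxy, rfl⟩
    exact hswap x y hxy
  exact fun σ s => (htop ▸ Subgroup.mem_top σ : σ ∈ H) s

theorem symPart_of_totallySymmetric {p : ℕ} {T : Spinor p} (hT : TotallySymmetric T) :
    symPart T = T := by
  funext s
  have hc : Fintype.card (Equiv.Perm (Fin p × Fin 2)) = (2 * p).factorial := by
    rw [Fintype.card_perm, Fintype.card_prod, Fintype.card_fin, Fintype.card_fin, mul_comm]
  have h0 : ((2 * p).factorial : ℂ) ≠ 0 := by exact_mod_cast Nat.factorial_ne_zero _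
  simp only [symPart, fun σ => hT σ s, Finset.sum_const, Finset.card_univ, hc, nsmul_eq_mul]
  field_simp

theorem symPart_sub {p : ℕ} (T T' : Spinor p) :
    symPart (fun s => T s - T' s) = fun s => symPart T s - symPart T' s := by
  funext s
  simp only [symPart, Finset.sum_sub_distrib, mul_sub]

/-! ### Covariance under rotations -/

/-- The linear map `ρ` is given by the orthogonal matrix `R`. -/
structure IsRotation (R : Matrix (Fin 3) (Fin 3) ℝ) (ρ : E3 ≃L[ℝ] E3) : Prop where
  apply : ∀ y i, ρ y i = ∑ j, R i j * y j
  left : R.transpose * R = 1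
  right : R * R.transpose = 1

theorem exists_isRotation {R : Matrix (Fin 3) (Fin 3) ℝ}
    (hR : R ∈ Matrix.specialOrthogonalGroup (Fin 3) ℝ) : ∃ ρ, IsRotation R ρ := by
  have h := (Matrix.mem_specialOrthogonalGroup_iff.1 hR).1
  have h1 : R.transpose * R = 1 := (Matrix.mem_orthogonalGroup_iff' _ _).1 h
  have h2 : R * R.transpose = 1 := (Matrix.mem_orthogonalGroup_iff _ _).1 h
  refine ⟨ContinuousLinearEquiv.equivOfInverse (Matrix.toEuclideanCLM (𝕜 := ℝ) R)
    (Matrix.toEuclideanCLM (𝕜 := ℝ) R.transpose) (fun y => ?_) (fun y => ?_), ?_, h1, h2⟩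
  · rw [← mul_apply_eq_comp, ← map_mul, h1, map_one]; rfl
  · rw [← mul_apply_eq_comp, ← map_mul, h2, map_one]; rfl
  · intro y i
    rfl

/-- Conjugation by an orthogonal matrix. -/
def conjBy (R : Matrix (Fin 3) (Fin 3) ℝ) :
    Matrix (Fin 3) (Fin 3) ℝ →ₗ[ℝ] Matrix (Fin 3) (Fin 3) ℝ where
  toFun X := R.transpose * X * R
  map_add' X Y := by rw [mul_add, add_mul]
  map_smul' c X := by simp

theorem conjBy_apply (R X : Matrix (Fin 3) (Fin 3) ℝ) (i j : Fin 3) :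
    conjBy R X i j = ∑ a, ∑ b, R a i * R b j * X a b := by
  simp only [conjBy, LinearMap.coe_mk, AddHom.coe_mk, Matrix.mul_apply, Matrix.transpose_apply,
    Finset.sum_mul]
  rw [Finset.sum_comm]
  exact Finset.sum_congr rfl fun a _ => Finset.sum_congr rfl fun b _ => by ring

/-- The partial derivative of a matrix valued function. -/
def pdM (i : Fin 3) (M : E3 → Matrix (Fin 3) (Fin 3) ℝ) (y : E3) : Matrix (Fin 3) (Fin 3) ℝ :=
  Matrix.of fun a b => pd i (fun z => M z a b) y

/-- The matrix `Γ^i_{jk}` for given `j`. -/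
def christoffelM (g : E3 → Matrix (Fin 3) (Fin 3) ℝ) (j : Fin 3) (y : E3) :
    Matrix (Fin 3) (Fin 3) ℝ := Matrix.of fun i k => christoffel g i j k y

/-- The curvature matrices. -/
def curvatureM (g : E3 → Matrix (Fin 3) (Fin 3) ℝ) (l j : Fin 3) (y : E3) :
    Matrix (Fin 3) (Fin 3) ℝ :=
  pdM l (christoffelM g j) y - pdM j (christoffelM g l) y
    + (christoffelM g l y * christoffelM g j y - christoffelM g j y * christoffelM g l y)

theorem pdM_congr {M M' : E3 → Matrix (Fin 3) (Fin 3) ℝ} (h : M =ᶠ[𝓝 0] M') (i : Fin 3) :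
    pdM i M =ᶠ[𝓝 0] pdM i M' := by
  have : ∀ᶠ y in 𝓝 (0 : E3), ∀ a b, pd i (fun z => M z a b) y = pd i (fun z => M' z a b) y :=
    Filter.eventually_all.2 fun a => Filter.eventually_all.2 fun b =>
      pd_congr (h.mono fun y hy => by rw [hy]) i
  filter_upwards [this] with y hy
  ext a b
  exact hy a b

theorem pd_const_mul {f : E3 → ℝ} (hf : ContDiffAt ℝ ∞ f 0) (c : ℝ) (i : Fin 3) :
    pd i (fun y => c * f y) =ᶠ[𝓝 0] fun y => c * pd i f y := by
  filter_upwards [pd_mul (contDiffAt_const (c := c)) hf i] with y h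
  rw [h, pd_const]
  ring

theorem pdM_sum_smul {M : Fin 3 → E3 → Matrix (Fin 3) (Fin 3) ℝ}
    (hM : ∀ b i j, ContDiffAt ℝ ∞ (fun y => M b y i j) 0) (c : Fin 3 → ℝ) (i : Fin 3) :
    pdM i (fun y => ∑ b, c b • M b y) =ᶠ[𝓝 0] fun y => ∑ b, c b • pdM i (M b) y := by
  have h : ∀ᶠ y in 𝓝 (0 : E3), ∀ a d, pd i (fun z => ∑ b, c b * M b z a d) y
      = ∑ b, pd i (fun z => c b * M b z a d) y :=
    Filter.eventually_all.2 fun a => Filter.eventually_all.2 fun d =>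
      pd_sum Finset.univ (f := fun b z => c b * M b z a d)
        (fun b _ => contDiffAt_const.mul (hM b a d)) i
  have h' : ∀ᶠ y in 𝓝 (0 : E3), ∀ a d b, pd i (fun z => c b * M b z a d) y
      = c b * pd i (fun z => M b z a d) y :=
    Filter.eventually_all.2 fun a => Filter.eventually_all.2 fun d => Filter.eventually_all.2
      fun b => pd_const_mul (hM b a d) (c b) i
  filter_upwards [h, h'] with y h h'
  ext a d
  simp only [pdM, Matrix.of_apply, Matrix.sum_apply, Matrix.smul_apply, smul_eq_mul]
  rw [h]
  simp only [h']

theorem christoffel_symm {g : E3 → Matrix (Fin 3) (Fin 3) ℝ} (hs : ∀ y i j, g y i j = g y j i)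
    (i j k : Fin 3) (y : E3) : christoffel g i j k y = christoffel g i k j y := by
  have : (fun z => g z j k) = fun z => g z k j := funext fun z => hs z j k
  simp only [christoffel]
  congr 1
  refine Finset.sum_congr rfl fun l _ => ?_
  rw [show pd l (fun z => g z j k) y = pd l (fun z => g z k j) y by simp only [hs _ j k]]
  ring

/-- As a trace of curvature matrices, the Ricci tensor transforms by means of identities for matrix
products. -/
theorem ricci_eq_curvatureM {g : E3 → Matrix (Fin 3) (Fin 3) ℝ} (hs : ∀ y i j, g y i j = g y j i)
    (i j : Fin 3) (y : E3) : ricci g i j y = ∑ l, curvatureM g l j y l i := by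
  refine Finset.sum_congr rfl fun l _ => ?_
  have h1 : christoffel g l i j = christoffel g l j i := funext fun z => christoffel_symm hs l i j z
  have h2 : christoffel g l i l = christoffel g l l i := funext fun z => christoffel_symm hs l i l z
  simp only [curvatureM, Matrix.add_apply, Matrix.sub_apply, Matrix.mul_apply, pdM, christoffelM,
    Matrix.of_apply, ← Finset.sum_sub_distrib]
  rw [h1, h2]
  congr 1
  refine Finset.sum_congr rfl fun m _ => ?_
  rw [christoffel_symm hs m i j, christoffel_symm hs m i l]

/-- The pull-back of a matrix valued function by a rotation. -/
def pullM (R : Matrix (Fin 3) (Fin 3) ℝ) (ρ : E3 ≃L[ℝ] E3) (M : E3 → Matrix (Fin 3) (Fin 3) ℝ)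
    (y : E3) : Matrix (Fin 3) (Fin 3) ℝ := conjBy R (M (ρ y))

/-! ### Connection, curvature and covariant derivatives of a rotated metric -/

namespace IsRotation

variable {R : Matrix (Fin 3) (Fin 3) ℝ} {ρ : E3 ≃L[ℝ] E3}

theorem sum_right (h : IsRotation R ρ) (i j : Fin 3) :
    ∑ k, R i k * R j k = if i = j then 1 else 0 := by
  have := congrFun (congrFun h.right i) j
  rwa [Matrix.mul_apply, Matrix.one_apply] at this

/-- Since R⁻¹ = Rᵀ, upper and lower indices transform alike, and one conjugation serves metrics,
inverses, connection matrices and frames. -/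
theorem conjBy_mul (h : IsRotation R ρ) (X Y : Matrix (Fin 3) (Fin 3) ℝ) :
    conjBy R X * conjBy R Y = conjBy R (X * Y) := by
  simp only [conjBy, LinearMap.coe_mk, AddHom.coe_mk]
  calc R.transpose * X * R * (R.transpose * Y * R)
      = R.transpose * X * (R * R.transpose) * Y * R := by simp only [mul_assoc]
    _ = _ := by rw [h.right]; simp only [mul_assoc, one_mul]

theorem conjBy_one (h : IsRotation R ρ) : conjBy R 1 = 1 := by
  simp [conjBy, h.left]

theorem conjBy_inv (h : IsRotation R ρ) (X : Matrix (Fin 3) (Fin 3) ℝ) :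
    (conjBy R X)⁻¹ = conjBy R X⁻¹ := by
  simp only [conjBy, LinearMap.coe_mk, AddHom.coe_mk, Matrix.mul_inv_rev,
    Matrix.inv_eq_left_inv h.left, Matrix.inv_eq_left_inv h.right, mul_assoc]

theorem tendsto (_ : IsRotation R ρ) : Tendsto ρ (𝓝 0) (𝓝 0) := by
  simpa using ρ.continuous.tendsto 0

theorem single (h : IsRotation R ρ) (i : Fin 3) :
    ρ (EuclideanSpace.single i 1) = ∑ b, R b i • (EuclideanSpace.single b 1 : E3) := by
  ext b
  rw [h.apply]
  simp [Finset.sum_apply, Pi.single_apply]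

theorem pd_comp (h : IsRotation R ρ) (f : E3 → ℝ) (i : Fin 3) (y : E3) :
    pd i (fun z => f (ρ z)) y = ∑ b, R b i * pd b f (ρ y) := by
  simp only [pd]
  rw [show (fun z => f (ρ z)) = f ∘ ρ from rfl, ρ.comp_right_fderiv]
  simp [h.single]

theorem smooth_comp {f : E3 → ℝ} (hf : ContDiffAt ℝ ∞ f 0) :
    ContDiffAt ℝ ∞ (fun y => f (ρ y)) 0 :=
  ContDiffAt.comp (0 : E3) (by simpa using hf) ρ.contDiff.contDiffAt

theorem smooth_pullM {M : E3 → Matrix (Fin 3) (Fin 3) ℝ}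
    (hM : ∀ i j, ContDiffAt ℝ ∞ (fun y => M y i j) 0) (i j : Fin 3) :
    ContDiffAt ℝ ∞ (fun y => pullM R ρ M y i j) 0 := by
  simp only [pullM, conjBy_apply]
  exact ContDiffAt.sum fun a _ => ContDiffAt.sum fun b _ => contDiffAt_const.mul
    (smooth_comp (hM a b))

theorem pdM_pullM (h : IsRotation R ρ) {M : E3 → Matrix (Fin 3) (Fin 3) ℝ}
    (hM : ∀ i j, ContDiffAt ℝ ∞ (fun y => M y i j) 0) (i : Fin 3) :
    pdM i (pullM R ρ M) =ᶠ[𝓝 0] fun y => ∑ b, R b i • conjBy R (pdM b M (ρ y)) := by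
  have h1 : ∀ᶠ y in 𝓝 (0 : E3), ∀ a d, pd i (fun z => ∑ x : Fin 3 × Fin 3,
      R x.1 a * R x.2 d * M (ρ z) x.1 x.2) y
      = ∑ x : Fin 3 × Fin 3, pd i (fun z => R x.1 a * R x.2 d * M (ρ z) x.1 x.2) y :=
    Filter.eventually_all.2 fun a => Filter.eventually_all.2 fun d =>
      pd_sum Finset.univ (f := fun (x : Fin 3 × Fin 3) z => R x.1 a * R x.2 d * M (ρ z) x.1 x.2)
        (fun b _ => contDiffAt_const.mul (smooth_comp (hM _ _))) i
  have h2 : ∀ᶠ y in 𝓝 (0 : E3), ∀ a d, ∀ x : Fin 3 × Fin 3,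
      pd i (fun z => R x.1 a * R x.2 d * M (ρ z) x.1 x.2) y
      = R x.1 a * R x.2 d * pd i (fun z => M (ρ z) x.1 x.2) y :=
    Filter.eventually_all.2 fun a => Filter.eventually_all.2 fun d => Filter.eventually_all.2
      fun x => pd_const_mul (smooth_comp (hM _ _)) _ i
  filter_upwards [h1, h2] with y h1 h2
  ext a d
  simp only [pdM, Matrix.of_apply, Matrix.sum_apply, Matrix.smul_apply, smul_eq_mul, pullM,
    conjBy_apply]
  have h1 := h1 a d
  simp only [Fintype.sum_prod_type, h2, fun x x' => h.pd_comp (fun z => M z x x')] at h1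
  rw [h1]
  simp only [Fin.sum_univ_three]
  ring

theorem christoffelM_eq {g : E3 → Matrix (Fin 3) (Fin 3) ℝ} (hs : ∀ y i j, g y i j = g y j i)
    (j : Fin 3) (y : E3) : christoffelM g j y = (1 / 2 : ℝ) • ((g y)⁻¹ * (pdM j g y
      + (Matrix.of fun l k => pdM k g y l j) - (Matrix.of fun l k => pdM l g y k j))) := by
  ext i k
  simp only [christoffelM, christoffel, Matrix.of_apply, Matrix.smul_apply, smul_eq_mul,
    Matrix.mul_apply, Matrix.sub_apply, Matrix.add_apply, pdM]
  simp only [hs _ k j]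

/-- `R` is constant, so there is no inhomogeneous term. -/
theorem christoffelM_pull (h : IsRotation R ρ) {g : E3 → Matrix (Fin 3) (Fin 3) ℝ}
    (hg : SmoothMetric g) (hs : ∀ y i j, g y i j = g y j i) :
    ∀ᶠ y in 𝓝 (0 : E3), ∀ j, christoffelM (pullM R ρ g) j y
      = ∑ b, R b j • pullM R ρ (christoffelM g b) y := by
  have hs' : ∀ y i j, pullM R ρ g y i j = pullM R ρ g y j i := fun y i j => by
    simp only [pullM, conjBy_apply]
    rw [Finset.sum_comm]
    exact Finset.sum_congr rfl fun a _ => Finset.sum_congr rfl fun b _ => by rw [hs _ a b]; ring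
  have hp : ∀ᶠ y in 𝓝 (0 : E3), ∀ i, pdM i (pullM R ρ g) y
      = ∑ b, R b i • conjBy R (pdM b g (ρ y)) :=
    Filter.eventually_all.2 fun i => h.pdM_pullM hg.smooth i
  filter_upwards [hp] with y hp j
  have e1 : (Matrix.of fun l k => pdM k (pullM R ρ g) y l j)
      = ∑ b, R b j • conjBy R (Matrix.of fun l k => pdM k g (ρ y) l b) := by
    ext l k
    simp only [hp, Matrix.of_apply, Matrix.sum_apply, Matrix.smul_apply, smul_eq_mul, conjBy_apply]
    simp only [Fin.sum_univ_three]
    ring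
  have e2 : (Matrix.of fun l k => pdM l (pullM R ρ g) y k j)
      = ∑ b, R b j • conjBy R (Matrix.of fun l k => pdM l g (ρ y) k b) := by
    ext l k
    simp only [hp, Matrix.of_apply, Matrix.sum_apply, Matrix.smul_apply, smul_eq_mul, conjBy_apply]
    simp only [Fin.sum_univ_three]
    ring
  rw [christoffelM_eq hs', e1, e2, hp, ← Finset.sum_add_distrib, ← Finset.sum_sub_distrib,
    Finset.mul_sum, Finset.smul_sum]
  refine Finset.sum_congr rfl fun b _ => ?_
  rw [← smul_add, ← smul_sub, ← map_add, ← map_sub, pullM, pullM, christoffelM_eq hs,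
    h.conjBy_inv, mul_smul_comm, h.conjBy_mul, map_smul, smul_comm]

theorem curvatureM_pull (h : IsRotation R ρ) {g : E3 → Matrix (Fin 3) (Fin 3) ℝ}
    (hg : SmoothMetric g) (hs : ∀ y i j, g y i j = g y j i) :
    ∀ᶠ y in 𝓝 (0 : E3), ∀ l j, curvatureM (pullM R ρ g) l j y
      = ∑ d, ∑ b, (R d l * R b j) • conjBy R (curvatureM g d b (ρ y)) := by
  have hΓ := h.christoffelM_pull hg hs
  have hsm : ∀ b i j, ContDiffAt ℝ ∞ (fun y => christoffelM g b y i j) 0 := fun b i j =>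
    hg.smooth_christoffel i b j
  have h1 : ∀ᶠ y in 𝓝 (0 : E3), ∀ l j, pdM l (christoffelM (pullM R ρ g) j) y
      = pdM l (fun y => ∑ b, R b j • pullM R ρ (christoffelM g b) y) y :=
    Filter.eventually_all.2 fun l => Filter.eventually_all.2 fun j =>
      pdM_congr (hΓ.mono fun y hy => hy j) l
  have h2 : ∀ᶠ y in 𝓝 (0 : E3), ∀ l j, pdM l (fun y => ∑ b, R b j
      • pullM R ρ (christoffelM g b) y) y
      = ∑ b, R b j • pdM l (pullM R ρ (christoffelM g b)) y :=
    Filter.eventually_all.2 fun l => Filter.eventually_all.2 fun j =>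
      pdM_sum_smul (fun b => smooth_pullM (hsm b)) _ l
  have h3 : ∀ᶠ y in 𝓝 (0 : E3), ∀ l b, pdM l (pullM R ρ (christoffelM g b)) y
      = ∑ d, R d l • conjBy R (pdM d (christoffelM g b) (ρ y)) :=
    Filter.eventually_all.2 fun l => Filter.eventually_all.2 fun b => h.pdM_pullM (hsm b) l
  filter_upwards [hΓ, h1, h2, h3] with y hΓ h1 h2 h3 l j
  simp only [curvatureM, h1, h2, h3]
  simp only [hΓ, pullM, map_add, map_sub, smul_add, smul_sub,
    Finset.sum_add_distrib, Finset.sum_sub_distrib, Finset.sum_mul, Finset.mul_sum,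
    smul_mul_assoc, mul_smul_comm, h.conjBy_mul, Finset.smul_sum, smul_smul]
  refine congrArg₂ (· + ·) (congrArg₂ (· - ·) ?_ ?_) (congrArg₂ (· - ·) ?_ ?_)
  · rw [Finset.sum_comm]
    exact Finset.sum_congr rfl fun d _ => Finset.sum_congr rfl fun b _ => by rw [mul_comm]
  · rfl
  · rw [Finset.sum_comm]
    exact Finset.sum_congr rfl fun d _ => Finset.sum_congr rfl fun b _ => by rw [mul_comm]
  · exact Finset.sum_congr rfl fun d _ => Finset.sum_congr rfl fun b _ => by rw [mul_comm]

theorem ricci_pull (h : IsRotation R ρ) {g : E3 → Matrix (Fin 3) (Fin 3) ℝ}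
    (hg : SmoothMetric g) (hs : ∀ y i j, g y i j = g y j i) :
    ∀ᶠ y in 𝓝 (0 : E3), ∀ i j, ricci (pullM R ρ g) i j y
      = ∑ a, ∑ b, R a i * R b j * ricci g a b (ρ y) := by
  have hs' : ∀ y i j, pullM R ρ g y i j = pullM R ρ g y j i := fun y i j => by
    simp only [pullM, conjBy_apply]
    rw [Finset.sum_comm]
    exact Finset.sum_congr rfl fun a _ => Finset.sum_congr rfl fun b _ => by rw [hs _ a b]; ring
  filter_upwards [h.curvatureM_pull hg hs] with y hy i j
  -- Summation over the traced index `l` contracts `d` with `e`, by R Rᵀ = 1.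
  have key : ∀ F : Fin 3 → Fin 3 → Fin 3 → ℝ,
      ∑ l, ∑ d, ∑ e, R d l * R e l * (∑ a, R a i * F d e a) = ∑ a, R a i * ∑ d, F d d a := by
    intro F
    have : ∀ d e, ∑ l, R d l * R e l * (∑ a, R a i * F d e a)
        = (if d = e then 1 else 0) * ∑ a, R a i * F d e a := fun d e => by
      rw [← Finset.sum_mul, h.sum_right]
    rw [Finset.sum_comm]
    have h1 : ∀ d, ∑ l, ∑ e, R d l * R e l * (∑ a, R a i * F d e a) = ∑ a, R a i * F d d a :=
      fun d => by
        rw [Finset.sum_comm]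
        simp [this]
    simp only [h1]
    rw [Finset.sum_comm]
    simp only [Finset.mul_sum]
  rw [ricci_eq_curvatureM hs']
  simp only [ricci_eq_curvatureM hs, hy]
  have := key fun d e a => ∑ b, R b j * curvatureM g d b (ρ y) e a
  have e2 : ∑ a, ∑ b, R a i * R b j * ∑ l, curvatureM g l b (ρ y) l a
      = ∑ a, R a i * ∑ d, ∑ b, R b j * curvatureM g d b (ρ y) d a := by
    refine Finset.sum_congr rfl fun a _ => ?_
    rw [Finset.sum_comm, Finset.mul_sum]
    exact Finset.sum_congr rfl fun b _ => by rw [← Finset.mul_sum]; ring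
  rw [e2, ← this]
  refine Finset.sum_congr rfl fun l _ => ?_
  rw [Matrix.sum_apply]
  refine Finset.sum_congr rfl fun d _ => ?_
  rw [Matrix.sum_apply]
  simp only [Matrix.smul_apply, smul_eq_mul, conjBy_apply]
  simp only [Fin.sum_univ_three]
  ring

theorem christoffel_pull (h : IsRotation R ρ) {g : E3 → Matrix (Fin 3) (Fin 3) ℝ}
    (hg : SmoothMetric g) (hs : ∀ y i j, g y i j = g y j i) :
    ∀ᶠ y in 𝓝 (0 : E3), ∀ i j k, christoffel (pullM R ρ g) i j k y
      = ∑ c, R c j * ∑ n, R n k * ∑ m, R m i * christoffel g m c n (ρ y) := by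
  filter_upwards [h.christoffelM_pull hg hs] with y hy i j k
  have := congrFun (congrFun (hy j) i) k
  rw [show christoffel (pullM R ρ g) i j k y = christoffelM (pullM R ρ g) j y i k from rfl, this]
  simp only [Matrix.sum_apply, Matrix.smul_apply, smul_eq_mul, pullM, conjBy_apply, christoffelM,
    Matrix.of_apply]
  simp only [Fin.sum_univ_three]
  ring

/-- The connection term of slot `i` in the inductive step of `iterCovDeriv_pull`. Summation over `l`
cancels two factors of `R`, and `sum_update_swap` exchanges the contracted index with the entry `b
i`. -/
theorem connection_pull (h : IsRotation R ρ) {p : ℕ} (Γ : Fin 3 → Fin 3 → Fin 3 → ℝ)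
    (T : Tensor p) (j : Fin 3) (A : Fin p → Fin 3) (i : Fin p) :
    ∑ l, (∑ c, R c j * ∑ n, R n (A i) * ∑ m, R m l * Γ m c n)
        * rotate R.transpose T (Function.update A i l)
      = ∑ c, R c j * ∑ b : Fin p → Fin 3, (∏ k, R (b k) (A k))
        * ∑ l, Γ l c (b i) * T (Function.update b i l) := by
  have hrot : ∀ l, rotate R.transpose T (Function.update A i l)
      = ∑ b : Fin p → Fin 3, R (b i) l * ((∏ k ∈ Finset.univ.erase i, R (b k) (A k)) * T b) := by
    intro l
    refine Finset.sum_congr rfl fun b _ => ?_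
    simp only [Matrix.transpose_apply]
    rw [← Finset.mul_prod_erase _ _ (Finset.mem_univ i), Function.update_self, ← mul_assoc]
    congr 2
    refine Finset.prod_congr rfl fun k hk => ?_
    rw [Function.update_of_ne (Finset.ne_of_mem_erase hk)]
  have hδ : ∀ (m : Fin 3) (b : Fin p → Fin 3), ∑ l, R m l * R (b i) l = if m = b i then 1 else 0 :=
    fun m b => h.sum_right m (b i)
  have hl : ∀ c n, ∑ l, (∑ m, R m l * Γ m c n) * rotate R.transpose T (Function.update A i l)
      = ∑ b : Fin p → Fin 3, Γ (b i) c n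
        * ((∏ k ∈ Finset.univ.erase i, R (b k) (A k)) * T b) := by
    intro c n
    simp only [hrot, Finset.mul_sum]
    rw [Finset.sum_comm]
    refine Finset.sum_congr rfl fun b _ => ?_
    have : ∀ l, (∑ m, R m l * Γ m c n) * (R (b i) l
        * ((∏ k ∈ Finset.univ.erase i, R (b k) (A k)) * T b))
        = (∑ m, (R m l * R (b i) l) * Γ m c n)
          * ((∏ k ∈ Finset.univ.erase i, R (b k) (A k)) * T b) := fun l => by
      simp only [Finset.sum_mul]
      exact Finset.sum_congr rfl fun m _ => by ring
    simp only [this]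
    rw [← Finset.sum_mul, Finset.sum_comm]
    simp only [← Finset.sum_mul, hδ]
    simp
  have h1 : ∑ l, (∑ c, R c j * ∑ n, R n (A i) * ∑ m, R m l * Γ m c n)
        * rotate R.transpose T (Function.update A i l)
      = ∑ c, R c j * ∑ n, R n (A i) * ∑ l, (∑ m, R m l * Γ m c n)
        * rotate R.transpose T (Function.update A i l) := by
    simp only [Fin.sum_univ_three]
    ring
  rw [h1]
  refine Finset.sum_congr rfl fun c _ => ?_
  congr 1
  simp only [hl, Finset.mul_sum]
  rw [Finset.sum_comm, sum_update_swap i]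
  refine Finset.sum_congr rfl fun b _ => Finset.sum_congr rfl fun l _ => ?_
  rw [← Finset.mul_prod_erase _ _ (Finset.mem_univ i), Function.update_self]
  have : ∏ k ∈ Finset.univ.erase i, R (Function.update b i l k) (A k)
      = ∏ k ∈ Finset.univ.erase i, R (b k) (A k) :=
    Finset.prod_congr rfl fun k hk => by
      rw [Function.update_of_ne (Finset.ne_of_mem_erase hk)]
  rw [this]
  ring

theorem iterCovDeriv_pull (h : IsRotation R ρ) {g : E3 → Matrix (Fin 3) (Fin 3) ℝ}
    (hg : SmoothMetric g) (hs : ∀ y i j, g y i j = g y j i) {φ : E3 → ℝ}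
    (hφ : ContDiffAt ℝ ∞ φ 0) : ∀ p, ∀ᶠ y in 𝓝 (0 : E3), ∀ a,
    iterCovDeriv (pullM R ρ g) (fun z => φ (ρ z)) p y a
      = rotate R.transpose (iterCovDeriv g φ p (ρ y)) a
  | 0 => Eventually.of_forall fun y a => by
      simp [iterCovDeriv, rotate]
  | p + 1 => by
    have ih := h.iterCovDeriv_pull hg hs hφ p
    have hD := hg.smooth_iterCovDeriv hφ p
    have h1 : ∀ᶠ y in 𝓝 (0 : E3), ∀ (j : Fin 3) (a : Fin p → Fin 3),
        pd j (fun z => iterCovDeriv (pullM R ρ g) (fun z => φ (ρ z)) p z a) y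
        = pd j (fun z => rotate R.transpose (iterCovDeriv g φ p (ρ z)) a) y :=
      Filter.eventually_all.2 fun j => Filter.eventually_all.2 fun a =>
        pd_congr (ih.mono fun y hy => hy a) j
    have h2 : ∀ᶠ y in 𝓝 (0 : E3), ∀ (j : Fin 3) (a : Fin p → Fin 3),
        pd j (fun z => rotate R.transpose (iterCovDeriv g φ p (ρ z)) a) y
        = ∑ b : Fin p → Fin 3, pd j (fun z => (∏ k, R.transpose (a k) (b k))
          * iterCovDeriv g φ p (ρ z) b) y :=
      Filter.eventually_all.2 fun j => Filter.eventually_all.2 fun a =>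
        pd_sum Finset.univ (f := fun b z => (∏ k, R.transpose (a k) (b k))
          * iterCovDeriv g φ p (ρ z) b)
          (fun b _ => contDiffAt_const.mul (smooth_comp (hD b))) j
    have h3 : ∀ᶠ y in 𝓝 (0 : E3), ∀ (j : Fin 3) (a b : Fin p → Fin 3),
        pd j (fun z => (∏ k, R.transpose (a k) (b k)) * iterCovDeriv g φ p (ρ z) b) y
        = (∏ k, R.transpose (a k) (b k)) * pd j (fun z => iterCovDeriv g φ p (ρ z) b) y :=
      Filter.eventually_all.2 fun j => Filter.eventually_all.2 fun a => Filter.eventually_all.2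
        fun b => pd_const_mul (smooth_comp (hD b)) _ j
    filter_upwards [ih, h1, h2, h3, h.christoffel_pull hg hs] with y ih h1 h2 h3 hΓ a
    have hsum : ∀ H : (Fin (p + 1) → Fin 3) → ℝ, ∑ b, H b
        = ∑ c, ∑ b : Fin p → Fin 3, H (Fin.cons c b) := fun H => by
      rw [← Fintype.sum_prod_type']
      exact (Fintype.sum_equiv (Fin.consEquiv fun _ => Fin 3) _ _ fun x => rfl).symm
    simp only [iterCovDeriv, covDeriv, h1, h2, h3, ih, hΓ]
    simp only [h.connection_pull (fun m c n => christoffel g m c n (ρ y)),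
      fun b => h.pd_comp (fun z => iterCovDeriv g φ p z b)]
    rw [rotate, hsum, Finset.sum_comm (s := (Finset.univ : Finset (Fin p))),
      Finset.sum_congr rfl fun b _ => Finset.mul_sum _ _ _, Finset.sum_comm,
      ← Finset.sum_sub_distrib]
    refine Finset.sum_congr rfl fun c _ => ?_
    rw [← Finset.mul_sum, Finset.sum_comm, Finset.mul_sum, ← Finset.sum_sub_distrib]
    refine Finset.sum_congr rfl fun b _ => ?_
    simp only [covDeriv, Fin.prod_univ_succ, Fin.cons_zero, Fin.cons_succ, Fin.tail_cons,
      Matrix.transpose_apply]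
    rw [mul_sub, ← Finset.mul_sum]
    simp only [Fin.tail_def]
    ring

end IsRotation

namespace IsRotation

variable {R : Matrix (Fin 3) (Fin 3) ℝ} {ρ : E3 ≃L[ℝ] E3}

theorem hessian_pull (h : IsRotation R ρ) {g : E3 → Matrix (Fin 3) (Fin 3) ℝ}
    (hg : SmoothMetric g) (hs : ∀ y i j, g y i j = g y j i) {φ : E3 → ℝ}
    (hφ : ContDiffAt ℝ ∞ φ 0) : ∀ᶠ y in 𝓝 (0 : E3), ∀ i j,
    iterCovDeriv (pullM R ρ g) (fun z => φ (ρ z)) 2 y ![i, j]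
      = conjBy R (Matrix.of fun a b => iterCovDeriv g φ 2 (ρ y) ![a, b]) i j := by
  filter_upwards [h.iterCovDeriv_pull hg hs hφ 2] with y hy i j
  rw [hy, conjBy_apply, ← Fintype.sum_prod_type', rotate]
  refine Fintype.sum_equiv (finTwoArrowEquiv (Fin 3)) _ _ fun b => ?_
  simp only [Fin.prod_univ_two, Matrix.transpose_apply, finTwoArrowEquiv_apply, Matrix.of_apply]
  congr 2
  funext k
  fin_cases k <;> rfl

theorem laplacian_pull (h : IsRotation R ρ) {g : E3 → Matrix (Fin 3) (Fin 3) ℝ}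
    (hg : SmoothMetric g) (hs : ∀ y i j, g y i j = g y j i) {φ : E3 → ℝ}
    (hφ : ContDiffAt ℝ ∞ φ 0) : ∀ᶠ y in 𝓝 (0 : E3),
    laplacian (pullM R ρ g) (fun z => φ (ρ z)) y = laplacian g φ (ρ y) := by
  have htr : ∀ A B : Matrix (Fin 3) (Fin 3) ℝ,
      ∑ i, ∑ j, A i j * B i j = (A * B.transpose).trace := fun A B => by
    simp [Matrix.trace, Matrix.mul_apply]
  have hct : ∀ B, (conjBy R B).transpose = conjBy R B.transpose := fun B => by
    simp [conjBy, Matrix.transpose_mul, mul_assoc]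
  have hc : ∀ A, (conjBy R A).trace = A.trace := fun A => by
    simp only [conjBy, LinearMap.coe_mk, AddHom.coe_mk]
    rw [Matrix.trace_mul_comm, ← mul_assoc, h.right, one_mul]
  filter_upwards [h.hessian_pull hg hs hφ] with y hy
  simp only [laplacian, hy, pullM, h.conjBy_inv]
  rw [htr, hct, h.conjBy_mul, hc, ← htr]
  rfl

end IsRotation

/-- The rotation of a solution. -/
theorem CoordSol.rotate {n : ℕ} {S : FieldSystem n} {g : E3 → Matrix (Fin 3) (Fin 3) ℝ}
    {φ : Fin n → E3 → ℝ} {e : Fin 3 → Fin 3 → E3 → ℝ} (s : CoordSol S g φ e)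
    {R : Matrix (Fin 3) (Fin 3) ℝ} (hR : R ∈ Matrix.specialOrthogonalGroup (Fin 3) ℝ)
    {ρ : E3 ≃L[ℝ] E3} (h : IsRotation R ρ) :
    CoordSol S (pullM R ρ g) (fun α y => φ α (ρ y))
      (fun i a => fun y => pullM R ρ (fun z => Matrix.of fun i a => e i a z) y i a) := by
  have hg := s.smoothMetric
  have hs := s.symm
  have hRt : R.transpose ∈ Matrix.specialOrthogonalGroup (Fin 3) ℝ := by
    have := Matrix.mem_specialOrthogonalGroup_iff.1 hR
    refine Matrix.mem_specialOrthogonalGroup_iff.2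
      ⟨(Matrix.mem_orthogonalGroup_iff _ _).2 (by simpa using h.left), by simpa using this.2⟩
  -- The frame becomes Rᵀ e R: the left factor pulls vectors back, the right one restores the
  -- coordinate frame at the origin. The frame components of Dφ are thereby rotated by Rᵀ, and this
  -- is where the invariance of f and f^α enters.
  have harg : ∀ y, fieldArg (fun α y => φ α (ρ y))
      (fun i a => fun y => pullM R ρ (fun z => Matrix.of fun i a => e i a z) y i a) y
      = ((fieldArg φ e (ρ y)).1, fun γ => R.transpose.mulVec ((fieldArg φ e (ρ y)).2 γ)) := by
    intro y
    refine Prod.ext rfl ?_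
    funext γ a
    simp only [fieldArg, Matrix.mulVec, dotProduct, Matrix.transpose_apply, h.pd_comp, pullM,
      conjBy_apply, Matrix.of_apply]
    have hδ := h.sum_right
    have e1 : ∀ i, (∑ c, ∑ b, R c i * R b a * e c b (ρ y)) * ∑ d, R d i * pd d (φ γ) (ρ y)
        = ∑ c, ∑ d, (R c i * R d i) * ((∑ b, R b a * e c b (ρ y)) * pd d (φ γ) (ρ y)) := fun i => by
      simp only [Fin.sum_univ_three]
      ring
    have e2 : ∀ c, ∑ i, ∑ d, (R c i * R d i) * ((∑ b, R b a * e c b (ρ y)) * pd d (φ γ) (ρ y))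
        = (∑ b, R b a * e c b (ρ y)) * pd c (φ γ) (ρ y) := fun c => by
      rw [Finset.sum_comm]
      simp only [← Finset.sum_mul, hδ]
      simp
    calc _ = ∑ c, ∑ i, ∑ d, (R c i * R d i) * ((∑ b, R b a * e c b (ρ y)) * pd d (φ γ) (ρ y)) := by
          rw [Finset.sum_congr rfl fun i _ => e1 i, Finset.sum_comm]
      _ = ∑ c, (∑ b, R b a * e c b (ρ y)) * pd c (φ γ) (ρ y) := Finset.sum_congr rfl fun c _ => e2 c
      _ = _ := by
          simp only [Fin.sum_univ_three]
          ring
  have hdom := h.tendsto.eventually s.mem_domf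
  refine ⟨IsRotation.smooth_pullM s.smooth_g, fun α => IsRotation.smooth_comp (s.smooth_φ α),
    fun i a => IsRotation.smooth_pullM (M := fun z => Matrix.of fun i a => e i a z) s.smooth_e i a,
    fun y i j => ?_, ?_, fun i a => ?_, ?_, ?_, ?_, ?_, ?_, ?_⟩
  · simp only [pullM, conjBy_apply]
    rw [Finset.sum_comm]
    exact Finset.sum_congr rfl fun a _ => Finset.sum_congr rfl fun b _ => by rw [hs _ a b]; ring
  · rw [pullM, map_zero, s.g_zero, map_neg, h.conjBy_one]
  · have h0 : (Matrix.of fun i a => e i a 0) = (1 : Matrix (Fin 3) (Fin 3) ℝ) := by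
      ext i a
      simp [s.e_zero, Matrix.one_apply]
    simp only [pullM, map_zero, h0, h.conjBy_one, Matrix.one_apply]
  · filter_upwards [h.tendsto.eventually s.normal, h.christoffel_pull hg hs] with y hn hΓ i
    have : ∑ m, R m i * ∑ c, ∑ n, christoffel g m c n (ρ y) * ρ y c * ρ y n = 0 := by simp [hn]
    rw [← this]
    simp only [hΓ, h.apply]
    simp only [Fin.sum_univ_three]
    ring
  · have hpd := fun j => h.pdM_pullM (M := fun z => Matrix.of fun i a => e i a z) s.smooth_e j
    filter_upwards [h.tendsto.eventually s.parallel, h.christoffelM_pull hg hs,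
      Filter.eventually_all.2 hpd] with y hp hΓ hpd i a
    -- As a matrix identity the parallel transport equation can be conjugated as a whole; the sums
    -- over R and y combine to `ρ y`.
    have hz : ∑ b, ρ y b • (pdM b (fun z => Matrix.of fun i a => e i a z) (ρ y)
        + christoffelM g b (ρ y) * Matrix.of fun i a => e i a (ρ y)) = 0 := by
      ext i a
      simp only [Matrix.sum_apply, Matrix.smul_apply, Matrix.add_apply, pdM, christoffelM,
        Matrix.mul_apply, Matrix.of_apply, Matrix.zero_apply, smul_eq_mul]
      exact hp i a
    have hj : ∑ j, y j • (pdM j (pullM R ρ fun z => Matrix.of fun i a => e i a z) y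
        + christoffelM (pullM R ρ g) j y * pullM R ρ (fun z => Matrix.of fun i a => e i a z) y)
        = 0 := by
      rw [← map_zero (conjBy R), ← hz]
      simp only [hpd, hΓ, pullM, Finset.sum_mul, smul_mul_assoc, h.conjBy_mul,
        ← Finset.sum_add_distrib, ← smul_add, ← map_add]
      simp only [Finset.smul_sum, smul_smul, map_sum, map_smul, h.apply, Finset.sum_smul]
      rw [Finset.sum_comm]
      simp only [mul_comm]
    have := congrFun (congrFun hj i) a
    simp only [Matrix.sum_apply, Matrix.smul_apply, Matrix.add_apply, pdM, christoffelM,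
      Matrix.mul_apply, Matrix.of_apply, Matrix.zero_apply, smul_eq_mul] at this
    exact this
  · exact h.tendsto.eventually s.mem_domF
  · filter_upwards [hdom] with y hy
    rw [harg]
    exact S.domf_scalar _ hRt _ hy
  · filter_upwards [hdom, h.tendsto.eventually s.eq_laplacian,
      Filter.eventually_all.2 fun α => h.laplacian_pull hg hs (s.smooth_φ α)] with y hy h1 h2 α
    rw [h2 α, h1 α, harg]
    exact (S.f1_scalar _ hRt _ hy α).symm
  · filter_upwards [hdom, h.tendsto.eventually s.eq_ricci, h.ricci_pull hg hs,
      Filter.eventually_all.2 fun α => h.hessian_pull hg hs (s.smooth_φ α)] with y hy h1 h2 h3 i j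
    have hM : (Matrix.of fun i j => ricci g i j (ρ y))
        = ∑ α, S.F1 α (fun γ => φ γ (ρ y)) • (Matrix.of fun i j =>
            iterCovDeriv g (φ α) 2 (ρ y) ![i, j])
          + ∑ α, ∑ β, S.F2 α β (fun γ => φ γ (ρ y)) • (Matrix.of fun i j =>
            pd i (φ α) (ρ y) * pd j (φ β) (ρ y))
          + S.f0 (fieldArg φ e (ρ y)) • g (ρ y) := by
      ext i j
      simp only [Matrix.of_apply, h1, Matrix.add_apply, Matrix.sum_apply, Matrix.smul_apply,
        smul_eq_mul, mul_assoc]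
    have h4 : ricci (pullM R ρ g) i j y = conjBy R (Matrix.of fun i j => ricci g i j (ρ y)) i j := by
      rw [h2, conjBy_apply]; rfl
    have h5 : ∀ α β, conjBy R (Matrix.of fun i j => pd i (φ α) (ρ y) * pd j (φ β) (ρ y)) i j
        = pd i (fun z => φ α (ρ z)) y * pd j (fun z => φ β (ρ z)) y := fun α β => by
      simp only [h.pd_comp, conjBy_apply, Matrix.of_apply, Fin.sum_univ_three]
      ring
    rw [h4, hM, harg, S.f0_scalar _ hRt _ hy]
    simp only [map_add, map_sum, map_smul, Matrix.add_apply, Matrix.sum_apply, Matrix.smul_apply,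
      smul_eq_mul, h3, h5, pullM, mul_assoc]

open Asymptotics

/-! ### Flat analytic germs -/

/-- The bounds on the partial derivatives bound the derivative on a ball, and the mean value
inequality supplies one more power of `‖y‖`. -/
theorem Vanish.isBigO : ∀ {m : ℕ} {f : E3 → ℝ}, Vanish m f → f =O[𝓝 0] fun y => ‖y‖ ^ m
  | 0, f, h => by simpa using h.smooth.continuousAt.tendsto.isBigO_one ℝ
  | m + 1, f, h => by
    have h1 : ∀ i, ∃ C, ∀ᶠ y in 𝓝 (0 : E3), ‖NullData.pd i f y‖ ≤ C * ‖‖y‖ ^ m‖ := fun i =>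
      (h.pd i).isBigO.bound
    choose C hC using h1
    obtain ⟨δ, hδ, hb⟩ := Metric.eventually_nhds_iff_ball.1
      ((eventually_differentiableAt h.smooth).and (Filter.eventually_all.2 hC))
    refine IsBigO.of_bound (∑ i, C i) ?_
    filter_upwards [Metric.ball_mem_nhds 0 hδ] with y hy
    have hy' : ‖y‖ < δ := by simpa using hy
    have hC0 : ∀ z ∈ Metric.ball (0 : E3) δ, ‖fderiv ℝ f z‖ ≤ (∑ i, C i) * ‖z‖ ^ m := by
      intro z hz
      have hnn : 0 ≤ (∑ i, C i) * ‖z‖ ^ m := by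
        rw [Finset.sum_mul]
        refine Finset.sum_nonneg fun i _ => le_trans (norm_nonneg (NullData.pd i f z)) ?_
        simpa using (hb z hz).2 i
      refine ContinuousLinearMap.opNorm_le_bound _ hnn fun v => ?_
      have hv : v = ∑ i, v i • (EuclideanSpace.single i 1 : E3) := by
        ext j
        simp [Finset.sum_apply, Pi.single_apply]
      have hf : fderiv ℝ f z v = ∑ i, v i * NullData.pd i f z := by
        conv_lhs => rw [hv]
        simp [NullData.pd]
      rw [hf, Finset.sum_mul, Finset.sum_mul]
      refine (norm_sum_le _ _).trans (Finset.sum_le_sum fun i _ => ?_)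
      rw [norm_mul, mul_comm]
      have := (hb z hz).2 i
      rw [norm_pow, norm_norm] at this
      exact mul_le_mul this (PiLp.norm_apply_le v i) (norm_nonneg _) ((norm_nonneg _).trans this)
    have hsub : Metric.closedBall (0 : E3) ‖y‖ ⊆ Metric.ball 0 δ :=
      Metric.closedBall_subset_ball hy'
    -- The constants taken from the asymptotic bounds carry no sign, but the derivative bound at a
    -- point `y ≠ 0` forces their sum to be nonnegative.
    have hs0 : 0 ≤ ∑ i, C i ∨ y = 0 := by
      by_cases hy0 : y = 0
      · exact Or.inr hy0
      · refine Or.inl (nonneg_of_mul_nonneg_left ((norm_nonneg _).trans (hC0 y hy)) ?_)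
        positivity
    rcases hs0 with hs0 | rfl
    swap
    · simp [h.eq_zero]
    have := (convex_closedBall (0 : E3) ‖y‖).norm_image_sub_le_of_norm_fderiv_le (𝕜 := ℝ) (f := f)
      (C := (∑ i, C i) * ‖y‖ ^ m) (fun z hz => (hb z (hsub hz)).1) (fun z hz => by
        refine (hC0 z (hsub hz)).trans (mul_le_mul_of_nonneg_left ?_ hs0)
        exact pow_le_pow_left₀ (norm_nonneg _) (by simpa using hz) m)
      (x := 0) (y := y) (by simp) (by simp)
    rw [h.eq_zero, sub_zero, sub_zero, mul_assoc, ← pow_succ] at this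
    simpa using this

/-- If the terms of degree below `n` of the power series vanish on the diagonal, the term of degree
`n` differs from `f` by O(‖y‖^(n+1)). As `f` has this size too, the homogeneous term is zero. -/
theorem eventually_eq_zero_of_vanish {f : E3 → ℝ} (hf : AnalyticAt ℝ f 0)
    (hv : ∀ m, Vanish m f) : ∀ᶠ y in 𝓝 0, f y = 0 := by
  obtain ⟨p, hp⟩ := hf
  have hz : ∀ n y, p n (fun _ => y) = 0 := by
    intro n
    induction n using Nat.strong_induction_on with
    | _ n ih =>
      intro y
      refine IsBigO.continuousMultilinearMap_apply_eq_zero (p := p n) ?_ y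
      have h1 := hp.isBigO_sub_partialSum_pow (n + 1)
      have h2 := (hv (n + 1)).isBigO
      have h3 : ∀ y, p.partialSum (n + 1) y = p n fun _ => y := fun y => by
        rw [FormalMultilinearSeries.partialSum, Finset.sum_range_succ,
          Finset.sum_eq_zero fun k hk => ih k (Finset.mem_range.1 hk) y, zero_add]
      simp only [zero_add, h3] at h1
      simpa using h2.sub h1
  filter_upwards [hp.eventually_hasSum] with y hy
  simp only [hz, zero_add] at hy
  exact hy.unique hasSum_zero

/-! ### Solutions in normal coordinates -/

section Manifold

variable {n : ℕ} {S : FieldSystem n} {r : WithTop ℕ∞}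
  {N : Type u} [TopologicalSpace N] [ChartedSpace E3 N] [IsManifold (𝓡 3) r N]

namespace NormalSolution

variable (s : NormalSolution S r N)

theorem zero_mem_target : (0 : E3) ∈ s.x.target := by
  rw [← s.x_q]
  exact s.x.map_source (by simp [s.x_source])

theorem target_mem_nhds : s.x.target ∈ 𝓝 (0 : E3) :=
  s.x.open_target.mem_nhds s.zero_mem_target

theorem mdifferentiable_x (hr : 1 ≤ r) : s.x.MDifferentiable (𝓡 3) (𝓡 3) :=
  ⟨(contMDiffOn_of_mem_maximalAtlas s.x_mem).mdifferentiableOn (by positivity),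
    (contMDiffOn_symm_of_mem_maximalAtlas s.x_mem).mdifferentiableOn (by positivity)⟩

theorem contDiffAt_φ (α : Fin n) : ContDiffAt ℝ r (s.φ α ∘ s.x.symm) 0 := by
  have h : ContMDiffAt (𝓡 3) 𝓘(ℝ, ℝ) r (s.φ α ∘ s.x.symm) 0 :=
    ((s.φ_reg α).contMDiffAt).comp _
      (contMDiffAt_symm_of_mem_maximalAtlas s.x_mem s.zero_mem_target)
  exact h.contDiffAt

theorem contDiffAt_metric (i j : Fin 3) :
    ContDiffAt ℝ r (fun y => metricInChart s.x s.h y i j) 0 :=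
  (s.h_reg i j).contDiffAt s.target_mem_nhds

theorem metricInChart_zero (hr : 1 ≤ r) : metricInChart s.x s.h 0 = -1 := by
  have hd := s.mdifferentiable_x hr
  -- By `c_q` the coordinate vectors and the frame vectors have the same image under the injective
  -- differential of `x`; orthonormality then yields the value -1.
  have hc : ∀ a, mfderiv (𝓡 3) (𝓡 3) s.x.symm (0 : E3) (EuclideanSpace.single a (1 : ℝ) : E3)
      = s.c a (s.x.symm 0) := fun a => by
    refine hd.mfderiv_injective (s.x.map_target s.zero_mem_target) ?_
    have h1 := DFunLike.congr_fun (hd.comp_symm_deriv s.zero_mem_target)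
      (EuclideanSpace.single a (1 : ℝ) : E3)
    refine h1.trans ?_
    have h2 : ∀ i, frameInChart s.x s.c i a 0 = (EuclideanSpace.single a (1 : ℝ) : E3) i :=
      fun i => by rw [s.c_q]; simp
    exact PiLp.ext (x := (EuclideanSpace.single a (1 : ℝ) : E3)) fun i => (h2 i).symm
  ext i j
  simp only [metricInChart, Matrix.of_apply, hc, s.c_orthonormal, Matrix.neg_apply,
    Matrix.one_apply]
  split_ifs <;> simp

/-- A solution in normal coordinates. -/
theorem coordSol (hr : ∞ ≤ r) : CoordSol S (metricInChart s.x s.h) (fun α => s.φ α ∘ s.x.symm)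
    (frameInChart s.x s.c) := by
  have h1 : 1 ≤ r := le_trans (by exact_mod_cast le_top) hr
  have hev : ∀ {P : E3 → Prop}, (∀ y ∈ s.x.target, P y) → ∀ᶠ y in 𝓝 (0 : E3), P y := fun hP => by
    filter_upwards [s.target_mem_nhds] with y hy using hP y hy
  exact ⟨fun i j => (s.contDiffAt_metric i j).of_le hr, fun α => (s.contDiffAt_φ α).of_le hr,
    fun i a => ((s.c_reg i a).contDiffAt s.target_mem_nhds).of_le hr,
    fun y i j => s.h_symm _ _ _, s.metricInChart_zero h1, s.c_q, hev s.x_normal, hev s.c_parallel,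
    hev s.mem_domF, hev s.mem_domf, hev s.eq_laplacian, hev s.eq_ricci⟩

theorem coeff_eq (α : Fin n) (p : ℕ) : s.coeff α p
    = iterCovDeriv (metricInChart s.x s.h) (s.φ α ∘ s.x.symm) p 0 := by
  rw [← rotate_one (iterCovDeriv (metricInChart s.x s.h) (s.φ α ∘ s.x.symm) p 0)]
  funext a
  simp only [coeff, rotate, s.c_q, Matrix.one_apply, eq_comm]

theorem h_symm_mfderiv (y u w : E3) :
    s.h (s.x.symm y) (mfderiv (𝓡 3) (𝓡 3) s.x.symm y u) (mfderiv (𝓡 3) (𝓡 3) s.x.symm y w)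
      = ∑ i, ∑ j, u i * w j * metricInChart s.x s.h y i j := by
  let L : E3 →L[ℝ] E3 := mfderiv (𝓡 3) (𝓡 3) s.x.symm y
  let B : E3 →L[ℝ] E3 →L[ℝ] ℝ := s.h (s.x.symm y)
  have hv : ∀ v : E3, v = ∑ i, v i • (EuclideanSpace.single i 1 : E3) := fun v => by
    ext j
    simp [Finset.sum_apply, Pi.single_apply]
  show B (L u) (L w) = ∑ i, ∑ j, u i * w j * B (L (EuclideanSpace.single i (1 : ℝ)))
    (L (EuclideanSpace.single j (1 : ℝ)))
  conv_lhs => rw [hv u, hv w]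
  simp only [map_sum, map_smul, sum_apply, smul_apply, smul_eq_mul, Finset.mul_sum]
  rw [Finset.sum_comm]
  exact Finset.sum_congr rfl fun i _ => Finset.sum_congr rfl fun j _ => by ring

end NormalSolution

end Manifold

/-! ### From equality of jets to the two assertions -/

/-- Analytic solutions that coincide near the origin after a rotation of the normal coordinates
are isometric. -/
theorem locallyIsometric_of_eventuallyEq {n : ℕ} {S : FieldSystem n}
    {N : Type u} [TopologicalSpace N] [ChartedSpace E3 N] [IsManifold (𝓡 3) ω N]
    {N' : Type v} [TopologicalSpace N'] [ChartedSpace E3 N'] [IsManifold (𝓡 3) ω N']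
    (s : NormalSolution S ω N) (s' : NormalSolution S ω N')
    {R : Matrix (Fin 3) (Fin 3) ℝ} {ρ : E3 ≃L[ℝ] E3} (hρ : IsRotation R ρ)
    (hg : ∀ᶠ y in 𝓝 (0 : E3), metricInChart s.x s.h y = pullM R ρ (metricInChart s'.x s'.h) y)
    (hφ : ∀ᶠ y in 𝓝 (0 : E3), ∀ α, s.φ α (s.x.symm y) = s'.φ α (s'.x.symm (ρ y))) :
    LocallyIsometric s s' := by
  obtain ⟨V, hV, hVo, h0V⟩ := eventually_nhds_iff.1 (hg.and hφ)
  -- The isometry is `ρ` read in the two normal coordinate systems, to be restricted to the points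
  -- with coordinates in `V`.
  set P : OpenPartialHomeomorph N N' :=
    (s.x.trans ρ.toHomeomorph.toOpenPartialHomeomorph).trans s'.x.symm with hP
  have hcont : Continuous s.x := by
    have := s.x.continuousOn
    rwa [s.x_source, continuousOn_univ] at this
  have hd := s.mdifferentiable_x le_top
  have hd' := s'.mdifferentiable_x le_top
  refine ⟨P.restrOpen (s.x ⁻¹' V) (hVo.preimage hcont), ?_, ?_, ?_, ?_, ?_, ?_⟩
  · rw [OpenPartialHomeomorph.restrOpen_source]
    refine ⟨?_, by simpa [s.x_q] using h0V⟩
    simp [hP, s.x_source, s.x_q, s'.zero_mem_target]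
  · show s'.x.symm (ρ (s.x s.q)) = s'.q
    rw [s.x_q, map_zero, ← s'.x_q, s'.x.left_inv (by simp [s'.x_source])]
  · refine (contMDiffOn_symm_of_mem_maximalAtlas s'.x_mem).comp
      (t := s'.x.target) (f := fun p => ρ (s.x p)) ?_ ?_
    · refine (ρ.contDiff.contMDiff.comp_contMDiffOn
        ((contMDiffOn_of_mem_maximalAtlas s.x_mem).mono ?_))
      simp [s.x_source]
    · intro p hp
      rw [OpenPartialHomeomorph.restrOpen_source] at hp
      simpa [hP, s.x_source] using hp.1
  · refine (contMDiffOn_symm_of_mem_maximalAtlas s.x_mem).comp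
      (t := s.x.target) (f := fun p => ρ.symm (s'.x p)) ?_ ?_
    · refine (ρ.symm.contDiff.contMDiff.comp_contMDiffOn
        ((contMDiffOn_of_mem_maximalAtlas s'.x_mem).mono ?_))
      simp [s'.x_source]
    · intro p hp
      have : p ∈ P.target := by
        rw [OpenPartialHomeomorph.restrOpen_toPartialEquiv] at hp
        simp only [PartialEquiv.restr_target] at hp
        exact hp.1
      simpa [hP, s'.x_source] using this
  · intro p hp v w
    obtain ⟨y, hyV, hyt, hyt', rfl⟩ :
        ∃ y, y ∈ V ∧ y ∈ s.x.target ∧ ρ y ∈ s'.x.target ∧ s.x.symm y = p := by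
      rw [OpenPartialHomeomorph.restrOpen_source] at hp
      refine ⟨s.x p, hp.2, s.x.map_source (by simp [s.x_source]), ?_,
        s.x.left_inv (by simp [s.x_source])⟩
      simpa [hP, s.x_source] using hp.1
    obtain ⟨u, rfl⟩ := hd.symm.mfderiv_surjective hyt v
    obtain ⟨z, rfl⟩ := hd.symm.mfderiv_surjective hyt w
    have hval : P (s.x.symm y) = s'.x.symm (ρ y) := by
      show s'.x.symm (ρ (s.x (s.x.symm y))) = _
      rw [s.x.right_inv hyt]
    have hPd : MDifferentiableAt (𝓡 3) (𝓡 3) P (s.x.symm y) := by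
      refine MDifferentiableAt.comp (I := 𝓡 3) (I' := 𝓡 3) (I'' := 𝓡 3)
        (g := s'.x.symm) (f := fun p => ρ (s.x p)) (s.x.symm y) ?_ ?_
      · refine hd'.mdifferentiableAt_symm ?_
        rw [s.x.right_inv hyt]
        exact hyt'
      · exact MDifferentiableAt.comp (I := 𝓡 3) (I' := 𝓡 3) (I'' := 𝓡 3) (g := ρ) (s.x.symm y)
          ρ.differentiableAt.mdifferentiableAt (hd.mdifferentiableAt (by simp [s.x_source]))
    have hder : ∀ u : E3, (mfderiv (𝓡 3) (𝓡 3) P (s.x.symm y)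
          (mfderiv (𝓡 3) (𝓡 3) s.x.symm y u) : E3)
        = (mfderiv (𝓡 3) (𝓡 3) s'.x.symm (ρ y) (ρ u) : E3) := by
      intro u
      have h1 := mfderiv_comp y hPd (hd.mdifferentiableAt_symm hyt)
      have h2 := mfderiv_comp y (hd'.mdifferentiableAt_symm hyt')
        (ρ.differentiableAt (x := y)).mdifferentiableAt
      have h3 : P ∘ s.x.symm =ᶠ[𝓝 y] s'.x.symm ∘ ρ := by
        filter_upwards [s.x.open_target.mem_nhds hyt] with z hz
        show s'.x.symm (ρ (s.x (s.x.symm z))) = _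
        rw [s.x.right_inv hz]; rfl
      have h4 := h3.mfderiv_eq (I := 𝓡 3) (I' := 𝓡 3)
      rw [h1] at h4
      rw [h2] at h4
      have h5 := DFunLike.congr_fun h4 u
      have h6 : mfderiv (𝓡 3) (𝓡 3) ρ y u = ρ u := by
        rw [mfderiv_eq_fderiv, ρ.fderiv]; rfl
      refine h5.trans ?_
      show mfderiv (𝓡 3) (𝓡 3) s'.x.symm (ρ y) (mfderiv (𝓡 3) (𝓡 3) ρ y u) = _
      rw [h6]
    -- With all tangent spaces read as `E3`, the base point can be rewritten independently of the
    -- vectors.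
    let H : N' → E3 → E3 → ℝ := fun p v w => s'.h p v w
    have hH : H (P (s.x.symm y)) (mfderiv (𝓡 3) (𝓡 3) P (s.x.symm y)
          (mfderiv (𝓡 3) (𝓡 3) s.x.symm y u)) (mfderiv (𝓡 3) (𝓡 3) P (s.x.symm y)
          (mfderiv (𝓡 3) (𝓡 3) s.x.symm y z))
        = H (s'.x.symm (ρ y)) (mfderiv (𝓡 3) (𝓡 3) s'.x.symm (ρ y) (ρ u))
          (mfderiv (𝓡 3) (𝓡 3) s'.x.symm (ρ y) (ρ z)) := by
      rw [hval]
      exact congrArg₂ (H (s'.x.symm (ρ y))) (hder u) (hder z)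
    have hsum : ∀ u z : E3, ∑ i, ∑ j, ρ u i * ρ z j * metricInChart s'.x s'.h (ρ y) i j
        = ∑ i, ∑ j, u i * z j * metricInChart s.x s.h y i j := fun u z => by
      simp only [(hV y hyV).1, pullM, conjBy_apply, hρ.apply, Fin.sum_univ_three]
      ring
    exact hH.trans ((s'.h_symm_mfderiv (ρ y) (ρ u) (ρ z)).trans
      ((hsum u z).trans (s.h_symm_mfderiv y u z).symm))
  · intro p hp α
    rw [OpenPartialHomeomorph.restrOpen_source] at hp
    have h1 := (hV (s.x p) hp.2).2 α
    rw [s.x.left_inv (by simp [s.x_source])] at h1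
    exact h1.symm

/-- The normal expansion coefficients are determined by the null data. -/
theorem NormalSolution.coeff_eq_of_nullSpinor {n : ℕ} {S : FieldSystem n} {r : WithTop ℕ∞}
    (hr : ∞ ≤ r)
    {N : Type u} [TopologicalSpace N] [ChartedSpace E3 N] [IsManifold (𝓡 3) r N]
    {N' : Type v} [TopologicalSpace N'] [ChartedSpace E3 N'] [IsManifold (𝓡 3) r N']
    (s : NormalSolution S r N) (s' : NormalSolution S r N')
    (h : ∀ α p, s.nullSpinor α p = s'.nullSpinor α p) (α : Fin n) (p : ℕ) :
    s.coeff α p = s'.coeff α p := by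
  have hs := s.coordSol hr
  have hs' := s'.coordSol hr
  -- If the difference of the coefficients is symmetric trace-free, its spinor equals its own
  -- symmetric part, which is the difference of the null data and hence zero.
  have hj := hs.jetEq hs' fun α p hT a => by
    have h1 := h α p
    simp only [nullSpinor, coeffSpinor, coeff_eq] at h1
    have h2 := symPart_of_totallySymmetric (toSpinor_totallySymmetric hT)
    rw [toSpinor_sub, symPart_sub, h1] at h2
    have h3 : ∀ t, toSpinor (fun a => iterCovDeriv (metricInChart s.x s.h) (s.φ α ∘ s.x.symm) p 0 a
        - iterCovDeriv (metricInChart s'.x s'.h) (s'.φ α ∘ s'.x.symm) p 0 a) t = 0 := fun t => by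
      rw [toSpinor_sub]
      simpa using (congrFun h2 t).symm
    exact sub_eq_zero.1 (eq_zero_of_toSpinor h3 a)
  funext a
  rw [coeff_eq, coeff_eq]
  exact hs.iterCovDeriv_eq hs' hj α p a

/-- Analytic solutions whose null data differ by a rotation are isometric. -/
theorem NormalSolution.locallyIsometric_of_nullTensor {n : ℕ} {S : FieldSystem n}
    {N : Type u} [TopologicalSpace N] [ChartedSpace E3 N] [IsManifold (𝓡 3) ω N]
    {N' : Type v} [TopologicalSpace N'] [ChartedSpace E3 N'] [IsManifold (𝓡 3) ω N']
    (s : NormalSolution S ω N) (s' : NormalSolution S ω N')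
    {R : Matrix (Fin 3) (Fin 3) ℝ} (hR : R ∈ Matrix.specialOrthogonalGroup (Fin 3) ℝ)
    (h : ∀ α p, s'.nullTensor α p = rotate R (s.nullTensor α p)) : LocallyIsometric s s' := by
  obtain ⟨ρ, hρ⟩ := exists_isRotation hR
  have hs := s.coordSol le_top
  have hs' := s'.coordSol le_top
  -- Pulling back by `ρ` multiplies the null data of `s'` by Rᵀ, which undoes the rotation `R` in
  -- the hypothesis; `s` and the rotated `s'` then have equal null data.
  have hρs := hs'.rotate hR hρ
  have hD : ∀ α p, iterCovDeriv (pullM R ρ (metricInChart s'.x s'.h))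
      (fun y => (s'.φ α ∘ s'.x.symm) (ρ y)) p 0 = rotate R.transpose (s'.coeff α p) :=
    fun α p => funext fun a => by
      rw [(hρ.iterCovDeriv_pull hs'.smoothMetric hs'.symm (hs'.smooth_φ α) p).self_of_nhds a,
        map_zero, coeff_eq]
  have hj := hs.jetEq hρs fun α p hT a => by
    have h1 : stfPart (rotate R.transpose (s'.coeff α p)) = stfPart (s.coeff α p) := by
      rw [stfPart_rotate (by simpa using hρ.right) (by simpa using hρ.left)]
      have := h α p
      simp only [nullTensor] at this
      rw [this, rotate_rotate, hρ.left, rotate_one]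
    have h2 := stfPart_of_mem hT
    rw [stfPart_sub, hD, h1, coeff_eq] at h2
    rw [hD]
    exact sub_eq_zero.1 ((congrFun h2 a).symm.trans (sub_self _))
  have hsmooth : ∀ i j, ContDiffAt ℝ ω
      (fun y => pullM R ρ (metricInChart s'.x s'.h) y i j) 0 := fun i j => by
    simp only [pullM, conjBy_apply]
    exact ContDiffAt.sum fun a _ => ContDiffAt.sum fun b _ => contDiffAt_const.mul
      (ContDiffAt.comp (g := fun y => metricInChart s'.x s'.h y a b) (0 : E3)
        (by simpa using s'.contDiffAt_metric a b) ρ.contDiff.contDiffAt)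
  have hφs : ∀ α, ContDiffAt ℝ ω (fun y => (s'.φ α ∘ s'.x.symm) (ρ y)) 0 := fun α =>
    ContDiffAt.comp (g := s'.φ α ∘ s'.x.symm) (0 : E3) (by simpa using s'.contDiffAt_φ α)
      ρ.contDiff.contDiffAt
  have han : ∀ {f : E3 → ℝ}, ContDiffAt ℝ ω f 0 → AnalyticAt ℝ f 0 := fun hf => by
    rw [← analyticWithinAt_univ, ← contDiffWithinAt_omega_iff_analyticWithinAt]
    exact hf
  refine locallyIsometric_of_eventuallyEq s s' hρ ?_ ?_
  · have := Filter.eventually_all.2 fun i => Filter.eventually_all.2 fun j =>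
      eventually_eq_zero_of_vanish (han ((s.contDiffAt_metric i j).sub (hsmooth i j)))
        fun m => ((hj m).1 i j).sub
    filter_upwards [this] with y hy
    ext i j
    exact sub_eq_zero.1 (hy i j)
  · have := Filter.eventually_all.2 fun α =>
      eventually_eq_zero_of_vanish (han ((s.contDiffAt_φ α).sub (hφs α)))
        fun m => ((hj m).2.1 α).sub
    filter_upwards [this] with y hy α
    exact sub_eq_zero.1 (hy α)

end NullData

end

theorem lemma2p1 {n : ℕ} (S : NullData.FieldSystem n) :
    -- the normal expansion coefficients satisfy the reality condition and are determined by the data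
    (∀ (ψ : Fin n → (p : ℕ) → NullData.Spinor p),
      (∀ α p, NullData.TotallySymmetric (ψ α p)) →
      (∀ α p, NullData.RealityCondition (ψ α p)) →
      ∀ (r : WithTop ℕ∞), ∞ ≤ r →
      ∀ (N : Type u) [TopologicalSpace N] [ChartedSpace NullData.E3 N] [IsManifold (𝓡 3) r N]
        (s : NullData.NormalSolution S r N),
        (∀ α p, s.nullSpinor α p = ψ α p) →
        (∀ α p, NullData.RealityCondition (s.coeffSpinor α p)) ∧
        ∀ (N' : Type v) [TopologicalSpace N'] [ChartedSpace NullData.E3 N']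
          [IsManifold (𝓡 3) r N'] (s' : NullData.NormalSolution S r N'),
          (∀ α p, s'.nullSpinor α p = ψ α p) →
          ∀ α p, s'.coeffSpinor α p = s.coeffSpinor α p) ∧
    -- analytic solutions whose null data differ by a rotation are isometric
    (∀ (N : Type u) [TopologicalSpace N] [ChartedSpace NullData.E3 N] [IsManifold (𝓡 3) ω N]
        (N' : Type v) [TopologicalSpace N'] [ChartedSpace NullData.E3 N'] [IsManifold (𝓡 3) ω N']
        (s : NullData.NormalSolution S ω N) (s' : NullData.NormalSolution S ω N'),
        (∃ R ∈ Matrix.specialOrthogonalGroup (Fin 3) ℝ,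
          ∀ α p, s'.nullTensor α p = NullData.rotate R (s.nullTensor α p)) →
        NullData.LocallyIsometric s s') := by
  refine ⟨fun ψ _ _ r hr N _ _ _ s hs => ⟨fun α p => NullData.realityCondition_toSpinor _,
    fun N' _ _ _ s' hs' α p => ?_⟩, fun N _ _ _ N' _ _ _ s s' ⟨R, hR, h⟩ =>
      s.locallyIsometric_of_nullTensor s' hR h⟩
  rw [NullData.NormalSolution.coeffSpinor, NullData.NormalSolution.coeffSpinor,
    s.coeff_eq_of_nullSpinor hr s' fun α p => (hs α p).trans (hs' α p).symm]
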